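/- Let $m_1\le m_2$ be elements of $\{2,3,4,\dots\}\cup\{\infty\}$ with $\frac1{m_1}+\frac1{m_2}<1$ (where $\frac1\infty=0$), and let $a,b,c\in\mathbb{Q}$ be the solution of $$1-a-b=\tfrac1{m_1},\qquad 1-b-c=\tfrac1{m_2},\qquad 1-a-c=0 .$$ Write $\dot t=q\,\frac{dt}{dq}$. Consider $t_1,t_2,t_3\in\mathbb{Q}[[q]]$ with $t_1\neq t_3$ that satisfy the Halphen system $$\begin{aligned} \dot t_1&=(a-1)(t_1t_2+t_1t_3-t_2t_3)+(b+c-1)t_1^2,\\ \dot t_2&=(b-1)(t_2t_1+t_2t_3-t_1t_3)+(a+c-1)t_2^2,\\ \dot t_3&=(c-1)(t_3t_1+t_3t_2-t_1t_2)+(a+b-1)t_3^2 \end{aligned}$$ with the initial conditions $t_1(0)=t_3(0)=0$, $t_2(0)=-1$ and, if $m_1<m_2$, with the coefficient of $q$ in $t_2$ equal to $-(m_1+1)$ when $m_2=\infty$ and to $m_1^2m_2+m_1^2-m_1m_2^2-m_2^2$ when $m_2<\infty$. (If $m_1=m_2$, such a solution is determined only up to a rescaling $q\mapsto\lambda q$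 with $\lambda\in\mathbb{Q}^\times$, and any of them may be taken.) Such $t_1,t_2,t_3$ exist. For any of them, the Hauptmodul $$J=\frac{t_3-t_2}{t_3-t_1}\in\mathbb{Q}((q))$$ of the triangle group of type $(m_1,m_2,\infty)$ is almost integral if and only if $(m_1,m_2,\infty)$ is one of the nine types $$(2,3,\infty),\ (2,4,\infty),\ (2,6,\infty),\ (2,\infty,\infty),\ (3,3,\infty),\ (3,\infty,\infty),\ (4,4,\infty),\ (6,6,\infty),\ (\infty,\infty,\infty).$$ Here a Laurent series $f\in\mathbb{Q}((q))$ is called $p$-integral, for a prime $p$, if there is a nonzero constant $C\in\mathbb{Q}$ such that all coefficients of $Cf$ are $p$-adic integers, and $f$ is called almost integral if it is $p$-integral for all but finitely many primes $p$. -/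

import Mathlib

open PowerSeries

namespace TriangleHauptmodul

noncomputable section

/-- The reciprocal `1 / m` of `m ∈ ℕ ∪ {∞}`, with `1 / ∞ = 0`. -/
def recip (m : ℕ∞) : ℚ :=
  if m = ⊤ then 0 else 1 / (m.toNat : ℚ)

/-- `(m₁, m₂, ∞)` is a hyperbolic type: `2 ≤ m₁ ≤ m₂ ≤ ∞` and `1 / m₁ + 1 / m₂ < 1`. -/
def IsHyperbolicType (m₁ m₂ : ℕ∞) : Prop :=
  2 ≤ m₁ ∧ m₁ ≤ m₂ ∧ recip m₁ + recip m₂ < 1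

/-- The parameter `a` of the Halphen system of type `(m₁, m₂, ∞)`. -/
def parA (m₁ m₂ : ℕ∞) : ℚ := (1 - recip m₁ + recip m₂) / 2

/-- The parameter `b` of the Halphen system of type `(m₁, m₂, ∞)`. -/
def parB (m₁ m₂ : ℕ∞) : ℚ := (1 - recip m₁ - recip m₂) / 2

/-- The parameter `c` of the Halphen system of type `(m₁, m₂, ∞)`. -/
def parC (m₁ m₂ : ℕ∞) : ℚ := (1 + recip m₁ - recip m₂) / 2

/-- The parameters are the solution of the linear system
`1 - a - b = 1 / m₁`, `1 - b - c = 1 / m₂`, `1 - a - c = 0`. -/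
theorem par_unique (m₁ m₂ : ℕ∞) (a b c : ℚ) :
    (1 - a - b = recip m₁ ∧ 1 - b - c = recip m₂ ∧ 1 - a - c = 0) ↔
      (a = parA m₁ m₂ ∧ b = parB m₁ m₂ ∧ c = parC m₁ m₂) := by
  unfold parA parB parC
  constructor
  · rintro ⟨h1, h2, h3⟩
    refine ⟨?_, ?_, ?_⟩ <;> linarith
  · rintro ⟨rfl, rfl, rfl⟩
    refine ⟨?_, ?_, ?_⟩ <;> ring

/-- The derivation `q d/dq` on formal power series in `q`. -/
def theta (f : ℚ⟦X⟧) : ℚ⟦X⟧ := X * derivative ℚ f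

/-- The Halphen system with parameters `a, b, c`, for formal power series in `q`. -/
def HalphenSystem (a b c : ℚ) (t₁ t₂ t₃ : ℚ⟦X⟧) : Prop :=
  theta t₁ = (a - 1) • (t₁ * t₂ + t₁ * t₃ - t₂ * t₃) + (b + c - 1) • t₁ ^ 2 ∧
  theta t₂ = (b - 1) • (t₂ * t₁ + t₂ * t₃ - t₁ * t₃) + (a + c - 1) • t₂ ^ 2 ∧
  theta t₃ = (c - 1) • (t₃ * t₁ + t₃ * t₂ - t₁ * t₂) + (a + b - 1) • t₃ ^ 2

/-- The prescribed coefficient of `q` in `t₂` for `m₁ < m₂`. -/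
def linCoeff (m₁ m₂ : ℕ∞) : ℚ :=
  if m₂ = ⊤ then -((m₁.toNat : ℚ) + 1)
  else (m₁.toNat : ℚ) ^ 2 * m₂.toNat + (m₁.toNat : ℚ) ^ 2
    - (m₁.toNat : ℚ) * (m₂.toNat : ℚ) ^ 2 - (m₂.toNat : ℚ) ^ 2

/-- `t₁, t₂, t₃` is the solution of the Halphen system attached to the triangle group of type
`(m₁, m₂, ∞)`. The coefficient of `q` in `t₂` fixes the scale of `q` if `m₁ < m₂`. If `m₁ = m₂`,
the system forces that coefficient to be `0`, and it leaves the scale of `q` free: any rational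
scale is then allowed, and `t₁ ≠ t₃` excludes the constant solution `(0, -1, 0)`. -/
structure IsHalphenSolution (m₁ m₂ : ℕ∞) (t₁ t₂ t₃ : ℚ⟦X⟧) : Prop where
  system : HalphenSystem (parA m₁ m₂) (parB m₁ m₂) (parC m₁ m₂) t₁ t₂ t₃
  t₁_zero : coeff 0 t₁ = 0
  t₂_zero : coeff 0 t₂ = -1
  t₃_zero : coeff 0 t₃ = 0
  t₂_one : m₁ < m₂ → coeff 1 t₂ = linCoeff m₁ m₂
  nonconst : t₁ ≠ t₃

/-- The Hauptmodul `J = (t₃ - t₂) / (t₃ - t₁)`, a formal Laurent series in `q`. -/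
def hauptmodul (t₁ t₂ t₃ : ℚ⟦X⟧) : LaurentSeries ℚ :=
  ((t₃ - t₂ : ℚ⟦X⟧) : LaurentSeries ℚ) / ((t₃ - t₁ : ℚ⟦X⟧) : LaurentSeries ℚ)

/-- A Laurent series is `p`-integral if, after multiplication by a nonzero constant, all its
coefficients are `p`-adic integers. -/
def IsPIntegral (p : ℕ) (f : LaurentSeries ℚ) : Prop :=
  ∃ C : ℚ, C ≠ 0 ∧ ∀ n : ℤ, padicNorm p (C * f.coeff n) ≤ 1

/-- A Laurent series is almost integral if it is `p`-integral for all but finitely many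
primes `p`. -/
def IsAlmostIntegral (f : LaurentSeries ℚ) : Prop :=
  {p : ℕ | p.Prime ∧ ¬ IsPIntegral p f}.Finite

end

end TriangleHauptmodul

/-!
# Almost integral Hauptmoduln of triangle groups with a cusp

Let `F = ₂F₁(a, b; 1; z)`, let `F log z + G` be the logarithmic solution of the same differential
equation, and let `z U(z) = z exp (G / F)` be the mirror map. In the coordinate `z` the Halphen
system with `c = 1 - a` is solved by `F`, `θ F` and the Wronskian (`exists_halphen_z`). If `z(q)`
is the inverse of the mirror map, this gives a solution in `q`, and since the recursion for the
coefficients leaves only the scale of `q` free (`HalphenSystem.unique`), every solution has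
`J = 1 / z(r q)` for some `r ≠ 0`. The factor `r` is a unit at almost all primes. So the question is
whether the coefficients of `w = q / z(q)`, which satisfies `w = U(z(q))`, are bounded at almost all
primes `p`.

Let `x ↦ x'` be Dwork's operation, `p x' - x ∈ {0, …, p - 1}`, and let `U'` belong to `(a', b')`.
Dwork's congruences, in the form that antisymmetric convolutions of the hypergeometric
coefficients have highly divisible tails (`padicNorm_sum_antisymm_le`), yield the Frobenius
structure `U'(z ^ p) = U(z) ^ p E` with `E ≡ 1` modulo `p` (`IsDworkPair.exists_frobenius`).

* If `U' = U`, the Dieudonné–Dwork lemma shows that `U` is integral at `p`, and hence so is `w`.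
  As `U` is symmetric in `a, b` and invariant under `(a, b) ↦ (1 - a, 1 - b)` (Euler's
  transformation, `hypU_reflect`), this applies as soon as multiplication by `p` maps `{a, b}` to
  `{a, b}` or `{-a, -b}` modulo `1`. For the nine types, all of whose parameters are in
  `ℤ / 24`, it does for every `p > 24`.
* Conversely, let `w` have bounded denominators at `p`. If some coefficient `wₙ` were not
  `p`-integral, there would be one with `|wₙ| ^ (1 / n)` maximal; but on the disc that this defines,
  the Frobenius structure forces a strict inequality (`IsDworkPair.gaussBound_of_bounded`).
  Hence `w` and `U` are integral, and `U' ≡ U` modulo `p`. For large `p` the first two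
  coefficients of this congruence are equalities, and they say that `{a', b'}` is `{a, b}` or
  `{1 - a, 1 - b}` (`IsDworkPair.sum_mul_eq_of_bounded`). Since `a + b = 1 - 1 / m₁` and
  `a - b = 1 / m₂`, it follows that all large primes are `±1` modulo each finite `mᵢ`. By
  Dirichlet's theorem `mᵢ ∈ {2, 3, 4, 6, ∞}`, and among these the five types other than the nine
  are excluded by a residue class modulo `24`.
-/

namespace TriangleHauptmodul

set_option linter.unusedSectionVars false

/-! ### Ultrametric estimates -/

section Ultrametric

variable {p : ℕ} [hp : Fact p.Prime]

theorem padicNorm_add_le {x y t : ℚ} (hx : padicNorm p x ≤ t) (hy : padicNorm p y ≤ t) :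
    padicNorm p (x + y) ≤ t :=
  padicNorm.nonarchimedean.trans (max_le hx hy)

theorem padicNorm_sub_le {x y t : ℚ} (hx : padicNorm p x ≤ t) (hy : padicNorm p y ≤ t) :
    padicNorm p (x - y) ≤ t :=
  padicNorm.sub.trans (max_le hx hy)

theorem padicNorm_sub_comm (x y : ℚ) : padicNorm p (x - y) = padicNorm p (y - x) := by
  rw [← padicNorm.neg, neg_sub]

theorem padicNorm_mul_le {x y s t : ℚ} (hx : padicNorm p x ≤ s) (hy : padicNorm p y ≤ t) :
    padicNorm p (x * y) ≤ s * t := by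
  rw [padicNorm.mul]
  exact mul_le_mul hx hy (padicNorm.nonneg _) ((padicNorm.nonneg _).trans hx)

theorem padicNorm_mul_le_one {x y : ℚ} (hx : padicNorm p x ≤ 1) (hy : padicNorm p y ≤ 1) :
    padicNorm p (x * y) ≤ 1 := by
  simpa using padicNorm_mul_le hx hy

theorem padicNorm_eq_of_sub_lt {x y : ℚ} (h : padicNorm p (x - y) < padicNorm p y) :
    padicNorm p x = padicNorm p y := by
  have := padicNorm.add_eq_max_of_ne (p := p) h.ne
  rwa [sub_add_cancel, max_eq_right h.le] at this

theorem padicNorm_prime_lt_one : padicNorm p (p : ℚ) < 1 :=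
  padicNorm.padicNorm_p_lt_one_of_prime

/-- The nonzero `p`-adic absolute values below `1` are at most `1 / p = |p|`. -/
theorem padicNorm_le_of_lt_one {x : ℚ} (h : padicNorm p x < 1) :
    padicNorm p x ≤ padicNorm p (p : ℚ) := by
  rcases eq_or_ne x 0 with rfl | hx
  · simp
  have hp1 : (1 : ℚ) < p := by exact_mod_cast hp.out.one_lt
  obtain ⟨z, hz⟩ := padicNorm.values_discrete (p := p) hx
  rw [hz] at h ⊢
  rw [padicNorm.padicNorm_p_of_prime, ← zpow_neg_one]
  have : -z < 0 := by
    by_contra hc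
    exact absurd h (not_lt.2 (one_le_zpow₀ hp1.le (not_lt.1 hc)))
  exact zpow_le_zpow_right₀ hp1.le (by omega)

theorem one_lt_padicNorm {x : ℚ} (h : 1 < padicNorm p x) : (p : ℚ) ≤ padicNorm p x := by
  have hx : x ≠ 0 := by
    rintro rfl
    simp at h
    linarith
  have hp0 : (0 : ℚ) < p := by exact_mod_cast hp.out.pos
  have h1 : padicNorm p x⁻¹ < 1 := by
    rw [inv_eq_one_div, padicNorm.div, padicNorm.one]
    exact (div_lt_one (by linarith)).2 h
  have h2 := padicNorm_le_of_lt_one h1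
  rw [inv_eq_one_div, padicNorm.div, padicNorm.one, padicNorm.padicNorm_p_of_prime,
    div_le_iff₀ (by linarith), inv_mul_eq_div, le_div_iff₀ hp0] at h2
  linarith

theorem padicNorm_natCast_sub_of_lt {i j : ℕ} (hi : i < p) (hj : j < p) (hij : i ≠ j) :
    padicNorm p ((i : ℚ) - j) = 1 := by
  have : ((i : ℚ) - j) = ((i - j : ℤ) : ℚ) := by push_cast; ring
  rw [this, padicNorm.int_eq_one_iff]
  intro h
  have := Int.eq_zero_of_abs_lt_dvd h (by rw [abs_lt]; constructor <;> omega)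
  omega

theorem padicNorm_prod_sub_prod_le {ι : Type*} (s : Finset ι) (f g : ι → ℚ) {δ : ℚ}
    (hδ : 0 ≤ δ)
    (hf : ∀ i ∈ s, padicNorm p (f i) ≤ 1) (hg : ∀ i ∈ s, padicNorm p (g i) ≤ 1)
    (hfg : ∀ i ∈ s, padicNorm p (f i - g i) ≤ δ) :
    padicNorm p (∏ i ∈ s, f i - ∏ i ∈ s, g i) ≤ δ := by
  classical
  suffices padicNorm p (∏ i ∈ s, f i) ≤ 1 ∧ padicNorm p (∏ i ∈ s, f i - ∏ i ∈ s, g i) ≤ δ from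
    this.2
  induction s using Finset.induction_on with
  | empty => simp [hδ]
  | insert a s ha ih =>
    simp only [Finset.forall_mem_insert] at hf hg hfg
    obtain ⟨h1, h2⟩ := ih hf.2 hg.2 hfg.2
    rw [Finset.prod_insert ha, Finset.prod_insert ha]
    refine ⟨padicNorm_mul_le_one hf.1 h1, ?_⟩
    have : f a * ∏ i ∈ s, f i - g a * ∏ i ∈ s, g i =
        (f a - g a) * ∏ i ∈ s, f i + g a * (∏ i ∈ s, f i - ∏ i ∈ s, g i) := by ring
    rw [this]
    exact padicNorm_add_le (by simpa using padicNorm_mul_le hfg.1 h1)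
      (by simpa using padicNorm_mul_le hg.1 h2)

/-- `f : ℕ → ℚ` takes `p`-integral values and is `p`-adically Lipschitz with constant
`1 / p`. -/
structure IsDigitFactor (p : ℕ) (f : ℕ → ℚ) : Prop where
  le_one : ∀ u, padicNorm p (f u) ≤ 1
  lipschitz : ∀ u w, padicNorm p (f u - f w) ≤ padicNorm p (p * ((u : ℚ) - w))

theorem IsDigitFactor.mul {f g : ℕ → ℚ} (hf : IsDigitFactor p f) (hg : IsDigitFactor p g) :
    IsDigitFactor p (fun u => f u * g u) where
  le_one u := padicNorm_mul_le_one (hf.le_one u) (hg.le_one u)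
  lipschitz u w := by
    have : f u * g u - f w * g w = (f u - f w) * g u + f w * (g u - g w) := by ring
    rw [this]
    exact padicNorm_add_le (by simpa using padicNorm_mul_le (hf.lipschitz u w) (hg.le_one u))
      (by simpa using padicNorm_mul_le (hf.le_one w) (hg.lipschitz u w))

end Ultrametric

/-! ### Dwork's prime operation and Pochhammer quotients -/

/-- The rational numbers in `(0, 1]` whose denominator divides `N`. -/
def fracSet (N : ℕ) : Set ℚ := {x | 0 < x ∧ x ≤ 1 ∧ ∃ k : ℕ, (N : ℚ) * x = k}

/-- `x'` is the Dwork prime of `x`: `p x' - x = i` with `i ∈ {0, …, p - 1}`. -/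
structure IsDworkPrime (p : ℕ) (x x' : ℚ) (i : ℕ) : Prop where
  mul_eq : (p : ℚ) * x' = x + i
  lt : i < p

/-- The quotient `(x)ₙ / n!` of a Pochhammer symbol by a factorial. -/
def pochQuot (x : ℚ) (n : ℕ) : ℚ := ∏ i ∈ Finset.range n, (x + i) / (i + 1)

theorem pochQuot_succ (x : ℚ) (n : ℕ) :
    pochQuot x (n + 1) = pochQuot x n * ((x + n) / (n + 1)) := Finset.prod_range_succ _ _

@[simp] theorem pochQuot_zero (x : ℚ) : pochQuot x 0 = 1 := by simp [pochQuot]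

open Classical in
/-- `y` if `y` is a `p`-adic unit, and `1` otherwise. -/
noncomputable def unitPart (p : ℕ) (y : ℚ) : ℚ := if padicNorm p y = 1 then y else 1

/-- The product of those among `x, x + 1, …, x + n - 1` that are `p`-adic units. -/
noncomputable def unitProd (p : ℕ) (x : ℚ) (n : ℕ) : ℚ :=
  ∏ i ∈ Finset.range n, unitPart p (x + i)

section Pochhammer

variable {p : ℕ} [hp : Fact p.Prime]

theorem padicNorm_unitPart (y : ℚ) : padicNorm p (unitPart p y) = 1 := by
  unfold unitPart
  split_ifs with h
  · exact h
  · simp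

theorem unitPart_sub_le {x y δ : ℚ} (hδ : δ < 1) (h : padicNorm p (x - y) ≤ δ) :
    padicNorm p (unitPart p x - unitPart p y) ≤ δ := by
  have h0 : 0 ≤ δ := (padicNorm.nonneg _).trans h
  unfold unitPart
  split_ifs with h1 h2 h2
  · exact h
  · exfalso
    apply h2
    rw [← h1]
    apply padicNorm_eq_of_sub_lt
    rw [padicNorm_sub_comm, h1]
    exact h.trans_lt hδ
  · exfalso
    apply h1
    rw [← h2]
    apply padicNorm_eq_of_sub_lt
    rw [h2]
    exact h.trans_lt hδ
  · simpa using h0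

theorem padicNorm_unitProd (x : ℚ) (n : ℕ) : padicNorm p (unitProd p x n) = 1 := by
  unfold unitProd
  induction n with
  | zero => simp
  | succ n ih => rw [Finset.prod_range_succ, padicNorm.mul, ih, padicNorm_unitPart, one_mul]

theorem unitProd_ne_zero (x : ℚ) (n : ℕ) : unitProd p x n ≠ 0 := by
  intro h
  have := padicNorm_unitProd (p := p) x n
  simp [h] at this

theorem unitProd_add (x : ℚ) (m n : ℕ) :
    unitProd p x (m + n) = unitProd p x m * unitProd p (x + m) n := by
  unfold unitProd
  rw [Finset.prod_range_add]
  congr 1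
  refine Finset.prod_congr rfl fun i _ => ?_
  push_cast
  congr 1
  ring

theorem padicNorm_add_natCast_le_one {x : ℚ} (hx : padicNorm p x ≤ 1) (n : ℕ) :
    padicNorm p (x + n) ≤ 1 :=
  padicNorm_add_le hx (padicNorm.of_nat n)

/-- The unit part of a product of `m` consecutive numbers is, modulo `m`, independent of the
starting point: shifting by one replaces one factor by a congruent one. -/
theorem unitProd_natCast_sub_le {m : ℕ} (hm : padicNorm p (m : ℚ) < 1) (k : ℕ) :
    padicNorm p (unitProd p k m - unitProd p 0 m) ≤ padicNorm p (m : ℚ) := by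
  induction k with
  | zero => simpa using padicNorm.nonneg _
  | succ k ih =>
    have h1 : unitPart p k * unitProd p (k + 1) m = unitProd p k m * unitPart p (k + m) := by
      have e1 := unitProd_add (p := p) (k : ℚ) 1 m
      have e2 := unitProd_add (p := p) (k : ℚ) m 1
      rw [add_comm 1 m, e2] at e1
      simpa [unitProd] using e1.symm
    have h2 : padicNorm p (unitProd p (k + 1) m - unitProd p k m) ≤ padicNorm p (m : ℚ) := by
      have h3 : unitPart p k * (unitProd p (k + 1) m - unitProd p k m) =
          unitProd p k m * (unitPart p (k + m) - unitPart p k) := by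
        rw [mul_sub, h1]; ring
      have h4 := congrArg (padicNorm p) h3
      rw [padicNorm.mul, padicNorm.mul, padicNorm_unitPart, padicNorm_unitProd, one_mul,
        one_mul] at h4
      rw [h4]
      refine unitPart_sub_le hm ?_
      simp
    have : unitProd p (k + 1 : ℕ) m - unitProd p 0 m =
        (unitProd p (k + 1) m - unitProd p k m) + (unitProd p k m - unitProd p 0 m) := by
      push_cast; ring
    rw [this]
    exact padicNorm_add_le h2 ih

theorem unitProd_sub_le_of_near {x : ℚ} {m : ℕ}
    (hm : padicNorm p (m : ℚ) < 1) {k : ℕ} (hk : padicNorm p (x - k) ≤ padicNorm p (m : ℚ)) :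
    padicNorm p (unitProd p x m - unitProd p 0 m) ≤ padicNorm p (m : ℚ) := by
  have h1 : padicNorm p (unitProd p x m - unitProd p k m) ≤ padicNorm p (m : ℚ) := by
    refine padicNorm_prod_sub_prod_le _ _ _ (padicNorm.nonneg _)
      (fun i _ => (padicNorm_unitPart _).le) (fun i _ => (padicNorm_unitPart _).le) fun i _ => ?_
    refine unitPart_sub_le hm ?_
    simpa using hk
  have := padicNorm_add_le h1 (unitProd_natCast_sub_le hm k)
  simpa using this

variable {N : ℕ}

theorem one_mem_fracSet (N : ℕ) : (1 : ℚ) ∈ fracSet N := ⟨one_pos, le_rfl, N, by simp⟩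

theorem padicNorm_natCast_eq_one_of_coprime (hN : N.Coprime p) : padicNorm p (N : ℚ) = 1 := by
  rw [padicNorm.nat_eq_one_iff]
  intro h
  have := Nat.dvd_gcd h dvd_rfl
  rw [hN] at this
  exact hp.out.one_lt.ne' (Nat.dvd_one.1 this)

theorem padicNorm_le_one_of_mem (hN : N.Coprime p) {x : ℚ} (hx : x ∈ fracSet N) :
    padicNorm p x ≤ 1 := by
  obtain ⟨-, -, k, hk⟩ := hx
  have h := congrArg (padicNorm p) hk
  rw [padicNorm.mul, padicNorm_natCast_eq_one_of_coprime hN, one_mul] at h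
  rw [h]
  exact padicNorm.of_nat k

/-- An element of `fracSet N` is `p`-adically close to natural numbers. -/
theorem exists_natCast_near (hN : N.Coprime p) {x : ℚ} (hx : x ∈ fracSet N) (t : ℕ) :
    ∃ k : ℕ, padicNorm p (x - k) ≤ (p : ℚ) ^ (-(t : ℤ)) := by
  obtain ⟨-, -, l, hl⟩ := hx
  have hNp : N.Coprime (p ^ (t + 1)) := hN.pow_right _
  have htot : 0 < (p ^ (t + 1)).totient := Nat.totient_pos.2 (pow_pos hp.out.pos _)
  obtain ⟨e, he⟩ : ∃ e, (p ^ (t + 1)).totient = e + 1 := ⟨_, (Nat.sub_add_cancel htot).symm⟩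
  have hmod := Nat.ModEq.pow_totient hNp
  refine ⟨l * N ^ e, ?_⟩
  have h1 : (N : ℚ) * (x - (l * N ^ e : ℕ)) =
      l * (((1 : ℤ) - (N : ℤ) ^ (p ^ (t + 1)).totient : ℤ) : ℚ) := by
    rw [mul_sub, hl, he]
    push_cast
    ring
  have h2 := congrArg (padicNorm p) h1
  rw [padicNorm.mul, padicNorm.mul, padicNorm_natCast_eq_one_of_coprime hN, one_mul] at h2
  rw [h2]
  have h3 : ((p ^ (t + 1) : ℕ) : ℤ) ∣ 1 - (N : ℤ) ^ (p ^ (t + 1)).totient := by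
    have := (Nat.modEq_iff_dvd.1 hmod)
    simpa using this
  have h4 := (padicNorm.dvd_iff_norm_le (p := p)).1 ((pow_dvd_pow (p : ℤ) (Nat.le_succ t)).trans
    (by exact_mod_cast h3) : ((p ^ t : ℕ) : ℤ) ∣ _)
  simpa using mul_le_mul (padicNorm.of_nat (p := p) l) h4 (padicNorm.nonneg _) zero_le_one

theorem unitProd_sub_le (hN : N.Coprime p) {x : ℚ} (hx : x ∈ fracSet N) (n : ℕ) {m : ℕ}
    (hm : padicNorm p (m : ℚ) < 1) :
    padicNorm p (unitProd p (x + n) m - unitProd p 0 m) ≤ padicNorm p (m : ℚ) := by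
  rcases Nat.eq_zero_or_pos m with rfl | hm0
  · simp [unitProd]
  obtain ⟨z, hz⟩ := padicNorm.values_discrete (p := p) (q := (m : ℚ)) (by exact_mod_cast hm0.ne')
  have hp1 : (1 : ℚ) < p := by exact_mod_cast hp.out.one_lt
  obtain ⟨k, hk⟩ := exists_natCast_near hN hx z.toNat
  refine unitProd_sub_le_of_near (k := k + n) hm ?_
  rw [hz]
  push_cast
  rw [add_sub_add_right_eq_sub]
  refine hk.trans (zpow_le_zpow_right₀ hp1.le ?_)
  have := Int.self_le_toNat z
  omega

/-- Every element of `fracSet N` has a Dwork prime in `fracSet N`. -/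
theorem exists_isDworkPrime (hN : N.Coprime p) {x : ℚ} (hx : x ∈ fracSet N) :
    ∃ x' ∈ fracSet N, ∃ i, IsDworkPrime p x x' i := by
  obtain ⟨h0, h1, k, hk⟩ := hx
  have hp0 : (0 : ℚ) < p := by exact_mod_cast hp.out.pos
  have : NeZero p := ⟨hp.out.ne_zero⟩
  let y : ZMod p := -(k : ZMod p) * (N : ZMod p)⁻¹
  have hy : p ∣ k + N * y.val := by
    rw [← CharP.cast_eq_zero_iff (ZMod p) p]
    have hu : (N : ZMod p) * (N : ZMod p)⁻¹ = 1 := ZMod.coe_mul_inv_eq_one N hN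
    push_cast
    rw [ZMod.natCast_val, ZMod.cast_id', id_eq]
    linear_combination -(k : ZMod p) * hu
  obtain ⟨l, hl⟩ := hy
  have hi : (y.val : ℚ) + 1 ≤ p := by exact_mod_cast ZMod.val_lt y
  refine ⟨(x + y.val) / p, ⟨by positivity, ?_, l, ?_⟩, y.val, ?_, ZMod.val_lt y⟩
  · rw [div_le_one hp0]
    linarith
  · have : ((k : ℚ) + N * y.val) = p * l := by exact_mod_cast hl
    rw [← mul_div_assoc, mul_add, hk, this]
    field_simp
  · field_simp

end Pochhammer

section DigitExpansion

variable {p : ℕ} [hp : Fact p.Prime] {x x' : ℚ} {i₀ : ℕ}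

theorem IsDworkPrime.add_eq (h : IsDworkPrime p x x' i₀) (u v : ℕ) :
    x + (v + p * u : ℕ) = p * (x' + u) + (v - i₀) := by
  have := h.mul_eq
  push_cast
  linear_combination -this

theorem IsDworkPrime.padicNorm_eq_one (h : IsDworkPrime p x x' i₀) (hx' : padicNorm p x' ≤ 1)
    {v : ℕ} (hv : v < p) (hne : v ≠ i₀) (u : ℕ) : padicNorm p (x + (v + p * u : ℕ)) = 1 := by
  have h1 := padicNorm_natCast_sub_of_lt (p := p) hv h.lt hne
  rw [← h1]
  apply padicNorm_eq_of_sub_lt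
  rw [h1, h.add_eq, add_sub_cancel_right]
  calc _ ≤ padicNorm p (p : ℚ) * 1 :=
        padicNorm_mul_le le_rfl (padicNorm_add_natCast_le_one hx' u)
    _ < 1 := by simpa using padicNorm_prime_lt_one (p := p)

theorem IsDworkPrime.add_eq_mul (h : IsDworkPrime p x x' i₀) (u : ℕ) :
    x + (i₀ + p * u : ℕ) = p * (x' + u) := by
  rw [h.add_eq]; ring

theorem IsDworkPrime.padicNorm_lt_one (h : IsDworkPrime p x x' i₀) (hx' : padicNorm p x' ≤ 1)
    (u : ℕ) : padicNorm p (x + (i₀ + p * u : ℕ)) < 1 := by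
  rw [h.add_eq_mul]
  calc _ ≤ padicNorm p (p : ℚ) * 1 :=
        padicNorm_mul_le le_rfl (padicNorm_add_natCast_le_one hx' u)
    _ < 1 := by simpa using padicNorm_prime_lt_one (p := p)

/-- The non-unit factor contributed to `(x)_{v + p u}` by an incomplete block of `v` factors. -/
def carry (p : ℕ) (x' : ℚ) (i₀ v u : ℕ) : ℚ := if i₀ < v then p * (x' + u) else 1

theorem IsDworkPrime.prod_block (h : IsDworkPrime p x x' i₀) (hx' : padicNorm p x' ≤ 1) (u : ℕ)
    {v : ℕ} (hv : v ≤ p) :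
    ∏ i ∈ Finset.range v, (x + (p * u + i : ℕ)) =
      (∏ i ∈ Finset.range v, unitPart p (x + (p * u + i : ℕ))) * carry p x' i₀ v u := by
  induction v with
  | zero => simp [carry]
  | succ v ih =>
    rw [Finset.prod_range_succ, Finset.prod_range_succ, ih (by omega)]
    rcases eq_or_ne v i₀ with rfl | hne
    · have h1 : unitPart p (x + (p * u + v : ℕ)) = 1 := by
        rw [unitPart, if_neg]
        rw [add_comm (p * u)]
        exact (h.padicNorm_lt_one hx' u).ne
      rw [h1, add_comm (p * u) v, h.add_eq_mul]
      simp [carry]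
    · have h1 : unitPart p (x + (p * u + v : ℕ)) = x + (p * u + v : ℕ) := by
        rw [unitPart, if_pos]
        rw [add_comm (p * u)]
        exact h.padicNorm_eq_one hx' (by omega) hne u
      rw [h1]
      have : carry p x' i₀ (v + 1) u = carry p x' i₀ v u := by
        unfold carry
        congr 1
        simp only [eq_iff_iff]
        omega
      rw [this]
      ring

theorem IsDworkPrime.prod_eq (h : IsDworkPrime p x x' i₀) (hx' : padicNorm p x' ≤ 1) (u : ℕ)
    {v : ℕ} (hv : v ≤ p) :
    ∏ i ∈ Finset.range (v + p * u), (x + i) =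
      unitProd p x (v + p * u) * carry p x' i₀ v u * (p ^ u * ∏ j ∈ Finset.range u, (x' + j)) := by
  have key : ∀ u, ∏ i ∈ Finset.range (p * u), (x + i) =
      unitProd p x (p * u) * (p ^ u * ∏ j ∈ Finset.range u, (x' + j)) := by
    intro u
    induction u with
    | zero => simp [unitProd]
    | succ u ih =>
      rw [mul_add, mul_one, Finset.prod_range_add, ih, unitProd, unitProd, Finset.prod_range_add,
        h.prod_block hx' u le_rfl, Finset.prod_range_succ _ u, carry, if_pos h.lt]
      ring
  rw [add_comm v, Finset.prod_range_add, key, h.prod_block hx' u hv, unitProd, unitProd,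
    Finset.prod_range_add]
  ring

theorem isDworkPrime_one : IsDworkPrime p 1 1 (p - 1) where
  mul_eq := by
    have := hp.out.one_le
    push_cast [Nat.cast_sub this]
    ring
  lt := Nat.sub_lt hp.out.pos one_pos

/-- The ratio of `(x)_{v + p u} / (v + p u)!` to `(x')_u / u!`. -/
noncomputable def digitFactor (p : ℕ) (x x' : ℚ) (i₀ v u : ℕ) : ℚ :=
  unitProd p x (v + p * u) / unitProd p 1 (v + p * u) * carry p x' i₀ v u

theorem pochQuot_eq_div (x : ℚ) (n : ℕ) :
    pochQuot x n = (∏ i ∈ Finset.range n, (x + i)) / ∏ i ∈ Finset.range n, ((1 : ℚ) + i) := by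
  rw [pochQuot, Finset.prod_div_distrib]
  simp [add_comm]

theorem IsDworkPrime.pochQuot_eq (h : IsDworkPrime p x x' i₀) (hx' : padicNorm p x' ≤ 1) (u : ℕ)
    {v : ℕ} (hv : v < p) :
    pochQuot x (v + p * u) = digitFactor p x x' i₀ v u * pochQuot x' u := by
  have hp0 : (p : ℚ) ≠ 0 := by exact_mod_cast hp.out.ne_zero
  rw [pochQuot_eq_div, pochQuot_eq_div, h.prod_eq hx' u hv.le,
    isDworkPrime_one.prod_eq (p := p) (by simp) u hv.le, digitFactor]
  have hc : carry p 1 (p - 1) v u = 1 := by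
    rw [carry, if_neg]; omega
  have h1 := unitProd_ne_zero (p := p) 1 (v + p * u)
  have h2 : ∏ j ∈ Finset.range u, ((1 : ℚ) + j) ≠ 0 :=
    Finset.prod_ne_zero_iff.2 fun j _ => by positivity
  rw [hc]
  field_simp

theorem isDigitFactor_unitProd_div {N : ℕ} (hN : N.Coprime p) (hx : x ∈ fracSet N) (v : ℕ) :
    IsDigitFactor p (fun u => unitProd p x (v + p * u) / unitProd p 1 (v + p * u)) where
  le_one u := by simp [padicNorm.div, padicNorm_unitProd]
  lipschitz u w := by
    wlog huw : w ≤ u generalizing u w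
    · have := this w u (by omega)
      rw [padicNorm_sub_comm, ← neg_sub (w : ℚ), mul_neg, padicNorm.neg]
      exact this
    obtain ⟨d, rfl⟩ := Nat.exists_eq_add_of_le huw
    set n := v + p * w with hn
    have hn' : v + p * (w + d) = n + p * d := by rw [hn]; ring
    have hlt : padicNorm p ((p * d : ℕ) : ℚ) < 1 := by
      push_cast
      calc _ ≤ padicNorm p (p : ℚ) * 1 := padicNorm_mul_le le_rfl (padicNorm.of_nat d)
        _ < 1 := by simpa using padicNorm_prime_lt_one (p := p)
    have e : unitProd p x (n + p * d) / unitProd p 1 (n + p * d) - unitProd p x n / unitProd p 1 n =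
        unitProd p x n / unitProd p 1 n * ((unitProd p (x + n) (p * d) - unitProd p (1 + n) (p * d))
          / unitProd p (1 + n) (p * d)) := by
      rw [unitProd_add x n, unitProd_add 1 n]
      have h1 := unitProd_ne_zero (p := p) 1 n
      have h2 := unitProd_ne_zero (p := p) (1 + n) (p * d)
      field_simp
    simp only [hn']
    rw [e]
    have e2 : padicNorm p (unitProd p (x + n) (p * d) - unitProd p (1 + n) (p * d)) ≤
        padicNorm p ((p * d : ℕ) : ℚ) := by
      have h1 := unitProd_sub_le hN hx n hlt
      have h2 := unitProd_sub_le hN (one_mem_fracSet N) n hlt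
      simpa using padicNorm_sub_le h1 h2
    rw [padicNorm.mul, padicNorm.div, padicNorm.div, padicNorm_unitProd, padicNorm_unitProd,
      padicNorm_unitProd, div_one, div_one, one_mul]
    refine e2.trans (le_of_eq ?_)
    congr 1
    push_cast
    ring

theorem isDigitFactor_carry (hx' : padicNorm p x' ≤ 1) (v : ℕ) :
    IsDigitFactor p (carry p x' i₀ v) where
  le_one u := by
    unfold carry
    split_ifs
    · exact padicNorm_mul_le_one (padicNorm.of_nat p) (padicNorm_add_natCast_le_one hx' u)
    · simp
  lipschitz u w := by
    unfold carry
    split_ifs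
    · rw [← mul_sub, add_sub_add_left_eq_sub]
    · rw [sub_self, padicNorm.zero]
      exact padicNorm.nonneg _

theorem isDigitFactor_digitFactor {N : ℕ} (hN : N.Coprime p) (hx : x ∈ fracSet N)
    (hx' : padicNorm p x' ≤ 1) (v : ℕ) : IsDigitFactor p (digitFactor p x x' i₀ v) :=
  (isDigitFactor_unitProd_div hN hx v).mul (isDigitFactor_carry hx' v)

theorem padicNorm_digitFactor_le {v : ℕ} (hv : i₀ < v) (u : ℕ) :
    padicNorm p (digitFactor p x x' i₀ v u) ≤ padicNorm p (p * (x' + u)) := by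
  rw [digitFactor, carry, if_pos hv, padicNorm.mul, padicNorm.div, padicNorm_unitProd,
    padicNorm_unitProd, div_one, one_mul]

theorem padicNorm_pochQuot_le_one {N : ℕ} (hN : N.Coprime p) (hx : x ∈ fracSet N) (n : ℕ) :
    padicNorm p (pochQuot x n) ≤ 1 := by
  induction n using Nat.strong_induction_on generalizing x with
  | _ n ih =>
    rcases Nat.eq_zero_or_pos n with rfl | hn
    · simp
    obtain ⟨x', hx', i₀, h⟩ := exists_isDworkPrime hN hx
    have hx'1 := padicNorm_le_one_of_mem hN hx'
    rw [← Nat.mod_add_div n p, h.pochQuot_eq hx'1 _ (Nat.mod_lt _ hp.out.pos)]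
    exact padicNorm_mul_le_one ((isDigitFactor_digitFactor hN hx hx'1 _).le_one _)
      (ih _ (Nat.div_lt_self hn hp.out.one_lt) hx')

end DigitExpansion

/-! ### Dwork congruences for antisymmetric convolutions -/

/-- The coefficient `(a)ₙ (b)ₙ / n!²` of the hypergeometric series. -/
def hypA (a b : ℚ) (n : ℕ) : ℚ := pochQuot a n * pochQuot b n

section Convolution

variable {p : ℕ} [hp : Fact p.Prime] {N : ℕ}

/-- A pair of parameters together with its pair of Dwork primes. -/
structure IsDworkPair (p N : ℕ) (a b a' b' : ℚ) (i j : ℕ) : Prop where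
  a_mem : a ∈ fracSet N
  b_mem : b ∈ fracSet N
  a'_mem : a' ∈ fracSet N
  b'_mem : b' ∈ fracSet N
  prime_a : IsDworkPrime p a a' i
  prime_b : IsDworkPrime p b b' j

theorem exists_isDworkPair (hN : N.Coprime p) {a b : ℚ} (ha : a ∈ fracSet N) (hb : b ∈ fracSet N) :
    ∃ a' b' i j, IsDworkPair p N a b a' b' i j := by
  obtain ⟨a', ha', i, hi⟩ := exists_isDworkPrime hN ha
  obtain ⟨b', hb', j, hj⟩ := exists_isDworkPrime hN hb
  exact ⟨a', b', i, j, ha, hb, ha', hb', hi, hj⟩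

/-- The ratio of `hypA a b (v + p u)` to `hypA a' b' u`. -/
noncomputable def hypDigit (p : ℕ) (a b a' b' : ℚ) (i j v u : ℕ) : ℚ :=
  digitFactor p a a' i v u * digitFactor p b b' j v u

variable {a b a' b' : ℚ} {i₁ i₂ : ℕ}

theorem padicNorm_hypA_le_one (hN : N.Coprime p) (ha : a ∈ fracSet N) (hb : b ∈ fracSet N)
    (n : ℕ) : padicNorm p (hypA a b n) ≤ 1 :=
  padicNorm_mul_le_one (padicNorm_pochQuot_le_one hN ha n) (padicNorm_pochQuot_le_one hN hb n)

theorem IsDworkPair.isDigitFactor (hN : N.Coprime p) (h : IsDworkPair p N a b a' b' i₁ i₂)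
    (v : ℕ) : IsDigitFactor p (hypDigit p a b a' b' i₁ i₂ v) :=
  (isDigitFactor_digitFactor hN h.a_mem (padicNorm_le_one_of_mem hN h.a'_mem) v).mul
    (isDigitFactor_digitFactor hN h.b_mem (padicNorm_le_one_of_mem hN h.b'_mem) v)

theorem IsDworkPair.hypA_eq (hN : N.Coprime p) (h : IsDworkPair p N a b a' b' i₁ i₂)
    {v : ℕ} (hv : v < p) (u : ℕ) :
    hypA a b (v + p * u) = hypDigit p a b a' b' i₁ i₂ v u * hypA a' b' u := by
  rw [hypA, h.prime_a.pochQuot_eq (padicNorm_le_one_of_mem hN h.a'_mem) u hv,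
    h.prime_b.pochQuot_eq (padicNorm_le_one_of_mem hN h.b'_mem) u hv, hypDigit, hypA]
  ring

/-- For each of the parameters `α = a, b, 1`, a digit beyond the shift of `α` makes
the digit factor divisible by `p (α' + u)`. -/
theorem IsDworkPair.exists_prime (hN : N.Coprime p) (h : IsDworkPair p N a b a' b' i₁ i₂) {α : ℚ}
    (hα : α = a ∨ α = b ∨ α = 1) :
    ∃ α' i, IsDworkPrime p α α' i ∧ (α' = a' ∨ α' = b' ∨ α' = 1) ∧ α' ∈ fracSet N ∧
      ∀ v < p, i < v → ∀ u,
        padicNorm p (hypDigit p a b a' b' i₁ i₂ v u) ≤ padicNorm p (p * (α' + u)) := by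
  rcases hα with rfl | rfl | rfl
  · refine ⟨a', i₁, h.prime_a, .inl rfl, h.a'_mem, fun v _ hi u => ?_⟩
    exact (padicNorm_mul_le (padicNorm_digitFactor_le hi u)
      ((isDigitFactor_digitFactor hN h.b_mem (padicNorm_le_one_of_mem hN h.b'_mem) v).le_one
        u)).trans_eq (mul_one _)
  · refine ⟨b', i₂, h.prime_b, .inr (.inl rfl), h.b'_mem, fun v _ hi u => ?_⟩
    exact (padicNorm_mul_le
      ((isDigitFactor_digitFactor hN h.a_mem (padicNorm_le_one_of_mem hN h.a'_mem) v).le_one u)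
      (padicNorm_digitFactor_le hi u)).trans_eq (one_mul _)
  · exact ⟨1, p - 1, isDworkPrime_one, .inr (.inr rfl), one_mem_fracSet N,
      fun v hv hi u => by omega⟩

/-- `φ` is antisymmetric under `j ↦ K - j` on `{0, …, K}`, and Lipschitz there with constant
`ε`. -/
structure IsAntisymmLipschitz (p K : ℕ) (ε : ℚ) (φ : ℕ → ℚ) : Prop where
  nonneg : 0 ≤ ε
  antisymm : ∀ j ≤ K, φ (K - j) = -φ j
  lipschitz : ∀ j ≤ K, ∀ k ≤ K, padicNorm p (φ j - φ k) ≤ ε * padicNorm p ((j : ℚ) - k)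

theorem padicNorm_two (hp2 : p ≠ 2) : padicNorm p (2 : ℚ) = 1 := by
  have := (padicNorm.nat_eq_one_iff (p := p) 2).2 fun h =>
    hp2 ((Nat.prime_dvd_prime_iff_eq hp.out Nat.prime_two).1 h)
  exact_mod_cast this

theorem padicNorm_natCast_sub_le_one (j k : ℕ) : padicNorm p ((j : ℚ) - k) ≤ 1 :=
  padicNorm_sub_le (padicNorm.of_nat j) (padicNorm.of_nat k)

/-- The Lipschitz constant bounds the values, because `2 φ j = φ j - φ (K - j)`. -/
theorem IsAntisymmLipschitz.le (hp2 : p ≠ 2) {K : ℕ} {ε : ℚ} {φ : ℕ → ℚ}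
    (h : IsAntisymmLipschitz p K ε φ) {j : ℕ} (hj : j ≤ K) : padicNorm p (φ j) ≤ ε := by
  have h1 := h.lipschitz j hj (K - j) (Nat.sub_le _ _)
  rw [h.antisymm j hj, sub_neg_eq_add, ← two_mul, padicNorm.mul, padicNorm_two hp2, one_mul] at h1
  exact h1.trans (mul_le_of_le_one_right h.nonneg (padicNorm_natCast_sub_le_one _ _))

theorem padicNorm_mul_mul_sub_le {x y c x' y' c' δ ε : ℚ} (hx' : padicNorm p x' ≤ 1)
    (hy : padicNorm p y ≤ 1) (hy' : padicNorm p y' ≤ 1) (hc : padicNorm p c ≤ ε)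
    (hxx : padicNorm p (x - x') ≤ δ) (hyy : padicNorm p (y - y') ≤ δ)
    (hcc : padicNorm p (c - c') ≤ ε * δ) :
    padicNorm p (x * y * c - x' * y' * c') ≤ ε * δ := by
  have e : x * y * c - x' * y' * c' =
      (x - x') * (y * c) + (x' * ((y - y') * c) + x' * y' * (c - c')) := by ring
  rw [e]
  refine padicNorm_add_le ?_ (padicNorm_add_le ?_ ?_)
  · have := padicNorm_mul_le hxx (padicNorm_mul_le hy hc)
    linarith
  · have := padicNorm_mul_le hx' (padicNorm_mul_le hyy hc)
    linarith
  · have := padicNorm_mul_le (padicNorm_mul_le hx' hy') hcc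
    linarith

/-- The weights produced by a pair `w, w'` of last digits are again antisymmetric, with a Lipschitz
constant smaller by a factor `p`. -/
theorem isAntisymmLipschitz_digitPair (hp2 : p ≠ 2) (hN : N.Coprime p)
    (h : IsDworkPair p N a b a' b' i₁ i₂) {K w w' M : ℕ} {ε : ℚ} {φ : ℕ → ℚ}
    (hφ : IsAntisymmLipschitz p K ε φ) (hK : K = w + w' + p * M) :
    IsAntisymmLipschitz p M (ε * padicNorm p p) fun i =>
      hypDigit p a b a' b' i₁ i₂ w i * hypDigit p a b a' b' i₁ i₂ w' (M - i) * φ (w + p * i) +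
      hypDigit p a b a' b' i₁ i₂ w' i * hypDigit p a b a' b' i₁ i₂ w (M - i) * φ (w' + p * i) where
  nonneg := mul_nonneg hφ.nonneg (padicNorm.nonneg _)
  antisymm i hi := by
    have hpi : p * (M - i) + p * i = p * M := by rw [← mul_add, Nat.sub_add_cancel hi]
    have e1 : w + p * (M - i) = K - (w' + p * i) := by omega
    have e2 : w' + p * (M - i) = K - (w + p * i) := by omega
    rw [e1, e2, hφ.antisymm _ (by omega), hφ.antisymm _ (by omega), Nat.sub_sub_self hi]
    ring
  lipschitz i hi k hk := by
    set r := hypDigit p a b a' b' i₁ i₂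
    have hd := fun v => h.isDigitFactor hN v
    have main : ∀ v v', K = v + v' + p * M →
        padicNorm p (r v i * r v' (M - i) * φ (v + p * i) - r v k * r v' (M - k) * φ (v + p * k)) ≤
          ε * padicNorm p (p * ((i : ℚ) - k)) := by
      intro v v' hv
      have hpi : p * i ≤ p * M := Nat.mul_le_mul_left _ hi
      have hpk : p * k ≤ p * M := Nat.mul_le_mul_left _ hk
      refine padicNorm_mul_mul_sub_le ((hd _).le_one _) ((hd _).le_one _) ((hd _).le_one _)
        (hφ.le hp2 (by omega)) ((hd _).lipschitz _ _) (((hd _).lipschitz _ _).trans (le_of_eq ?_))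
        ((hφ.lipschitz _ (by omega) _ (by omega)).trans (le_of_eq ?_))
      · rw [Nat.cast_sub hi, Nat.cast_sub hk, padicNorm.mul, padicNorm.mul, sub_sub_sub_cancel_left,
          padicNorm_sub_comm]
      · congr 2
        push_cast
        ring
    have e : ∀ A B C D : ℚ, A + B - (C + D) = (A - C) + (B - D) := fun A B C D => by ring
    rw [e, mul_assoc ε, ← padicNorm.mul]
    exact padicNorm_add_le (main w w' hK) (main w' w (by omega))

/-- Splitting the indices `j ≤ K` with `j / p > u` according to their residue modulo `p`. -/
theorem sum_Ioc_filter_div {K i u : ℕ} (hu : u = i / p) (f : ℕ → ℚ) :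
    ∑ j ∈ (Finset.Ioc i K).filter (fun j => ¬ j / p = u), f j =
      ∑ w ∈ (Finset.range p).filter (· ≤ K), ∑ k ∈ Finset.Ioc u ((K - w) / p), f (w + p * k) := by
  have hp0 := hp.out.pos
  rw [← Finset.sum_fiberwise_of_maps_to (g := fun j => j % p)
    (t := (Finset.range p).filter (· ≤ K))]
  · refine Finset.sum_congr rfl fun w hw => ?_
    simp only [Finset.mem_filter, Finset.mem_range] at hw
    refine Finset.sum_nbij' (fun j => j / p) (fun k => w + p * k) ?_ ?_ ?_ ?_ ?_
    · intro j hj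
      simp only [Finset.mem_filter, Finset.mem_Ioc] at hj ⊢
      obtain ⟨⟨⟨h1, h2⟩, h3⟩, h4⟩ := hj
      have h5 : i / p ≤ j / p := Nat.div_le_div_right h1.le
      refine ⟨by omega, ?_⟩
      rw [Nat.le_div_iff_mul_le hp0]
      have := Nat.mod_add_div j p
      rw [mul_comm]
      omega
    · intro k hk
      simp only [Finset.mem_filter, Finset.mem_Ioc] at hk ⊢
      have h1 : (w + p * k) / p = k := by
        rw [Nat.add_mul_div_left _ _ hp0, Nat.div_eq_of_lt hw.1, zero_add]
      have h2 : (w + p * k) % p = w := by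
        rw [Nat.add_mul_mod_self_left, Nat.mod_eq_of_lt hw.1]
      have h3 := (Nat.le_div_iff_mul_le hp0).1 hk.2
      rw [mul_comm] at h3
      refine ⟨⟨⟨?_, by omega⟩, by omega⟩, h2⟩
      have h4 := Nat.mod_add_div i p
      have h5 := Nat.mod_lt i hp0
      have h6 : p * (u + 1) ≤ p * k := Nat.mul_le_mul_left _ hk.1
      rw [mul_add, mul_one] at h6
      subst hu
      omega
    · intro j hj
      simp only [Finset.mem_filter] at hj
      rw [← hj.2, Nat.mod_add_div]
    · intro k _
      rw [Nat.add_mul_div_left _ _ hp0, Nat.div_eq_of_lt hw.1, zero_add]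
    · intro j hj
      simp only [Finset.mem_filter] at hj
      rw [← hj.2, Nat.mod_add_div]
  · intro j hj
    simp only [Finset.mem_filter, Finset.mem_Ioc, Finset.mem_range] at hj ⊢
    exact ⟨Nat.mod_lt _ hp0, (Nat.mod_le _ _).trans hj.1.2⟩

/-- The tails of an antisymmetric convolution of hypergeometric coefficients are divisible by
`α + i`, where `i` is the point of truncation and `α` one of the parameters `a, b, 1`.
The proof pairs the last digits `w` and `w'` of `j` and `K - j`; each pair gives a convolution of
the same shape for the Dwork primes, whose Lipschitz constant has gained a factor `p`. -/
theorem padicNorm_sum_antisymm_le (hp2 : p ≠ 2) (hN : N.Coprime p) (s : ℕ) :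
    ∀ {a b α : ℚ}, a ∈ fracSet N → b ∈ fracSet N → (α = a ∨ α = b ∨ α = 1) →
    ∀ {K i : ℕ} {ε : ℚ} {φ : ℕ → ℚ}, IsAntisymmLipschitz p K ε φ →
      padicNorm p ((p : ℚ) ^ s) ≤ padicNorm p (α + i) →
      padicNorm p (∑ j ∈ Finset.Ioc i K, hypA a b j * hypA a b (K - j) * φ j) ≤
        ε * padicNorm p (α + i) := by
  have hp0 := hp.out.pos
  have hpn : 0 < padicNorm p (p : ℚ) := by
    rw [padicNorm.padicNorm_p_of_prime]
    exact inv_pos.2 (by exact_mod_cast hp0)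
  induction s with
  | zero =>
    intro a b α ha hb _ K i ε φ hφ hs
    rw [pow_zero, padicNorm.one] at hs
    refine (padicNorm.sum_le' (t := ε) (fun j hj => ?_) hφ.nonneg).trans
      (le_mul_of_one_le_right hφ.nonneg hs)
    simpa using padicNorm_mul_le (padicNorm_mul_le (padicNorm_hypA_le_one hN ha hb j)
      (padicNorm_hypA_le_one hN ha hb (K - j))) (hφ.le hp2 (Finset.mem_Ioc.1 hj).2)
  | succ s ih =>
    intro a b α ha hb hα K i ε φ hφ hs
    by_cases h1 : 1 ≤ padicNorm p (α + i)
    · refine (padicNorm.sum_le' (t := ε) (fun j hj => ?_) hφ.nonneg).trans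
        (le_mul_of_one_le_right hφ.nonneg h1)
      simpa using padicNorm_mul_le (padicNorm_mul_le (padicNorm_hypA_le_one hN ha hb j)
        (padicNorm_hypA_le_one hN ha hb (K - j))) (hφ.le hp2 (Finset.mem_Ioc.1 hj).2)
    obtain ⟨a', b', i₁, i₂, h⟩ := exists_isDworkPair hN ha hb
    obtain ⟨α', i₀, hp', hα', hmem, hdiv⟩ := h.exists_prime hN hα
    have hv := Nat.mod_lt i hp0
    have hdecomp := Nat.mod_add_div i p
    set v := i % p with hvdef
    set u := i / p with hudef
    -- the digit of `i` is the one at which `α + i` is divisible by `p`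
    have hvi : v = i₀ := by
      by_contra hne
      apply h1
      rw [← hdecomp, hp'.padicNorm_eq_one (padicNorm_le_one_of_mem hN hmem) hv hne]
    have hαi : α + (i : ℚ) = p * (α' + u) := by
      rw [← hp'.add_eq_mul, ← hvi, hdecomp]
    have hs' : padicNorm p ((p : ℚ) ^ s) ≤ padicNorm p (α' + u) := by
      rw [hαi, pow_succ', padicNorm.mul, padicNorm.mul] at hs
      exact le_of_mul_le_mul_left hs hpn
    rw [← Finset.sum_filter_add_sum_filter_not _ (fun j => j / p = u)]
    refine padicNorm_add_le ?_ ?_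
    · refine padicNorm.sum_le' (fun j hj => ?_) (mul_nonneg hφ.nonneg (padicNorm.nonneg _))
      simp only [Finset.mem_filter, Finset.mem_Ioc] at hj
      have hj1 := Nat.mod_add_div j p
      rw [hj.2] at hj1
      have hjp := Nat.mod_lt j hp0
      have hAj : padicNorm p (hypA a b j) ≤ padicNorm p (α + i) := by
        rw [← hj1, h.hypA_eq hN hjp, hαi]
        simpa using padicNorm_mul_le (hdiv (j % p) hjp (by omega) u)
          (padicNorm_hypA_le_one hN h.a'_mem h.b'_mem u)
      have := padicNorm_mul_le (padicNorm_mul_le hAj (padicNorm_hypA_le_one hN ha hb (K - j)))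
        (hφ.le hp2 hj.1.2)
      linarith
    · set f : ℕ → ℚ := fun j => hypA a b j * hypA a b (K - j) * φ j with hf
      rw [sum_Ioc_filter_div hudef f]
      set W := (Finset.range p).filter (· ≤ K) with hW
      set g : ℕ → ℚ := fun w => ∑ k ∈ Finset.Ioc u ((K - w) / p), f (w + p * k) with hg
      have hWK : ∀ w ∈ W, (K - w) % p ∈ W ∧ (K - (K - w) % p) % p = w ∧
          (K - (K - w) % p) / p = (K - w) / p ∧ K = w + (K - w) % p + p * ((K - w) / p) := by
        intro w hw
        simp only [hW, Finset.mem_filter, Finset.mem_range] at hw ⊢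
        have e1 := Nat.mod_add_div (K - w) p
        have e2 := Nat.mod_lt (K - w) hp0
        have e3 : K - (K - w) % p = w + p * ((K - w) / p) := by omega
        refine ⟨⟨e2, by omega⟩, ?_, ?_, by omega⟩
        · rw [e3, Nat.add_mul_mod_self_left, Nat.mod_eq_of_lt hw.1]
        · rw [e3, Nat.add_mul_div_left _ _ hp0, Nat.div_eq_of_lt hw.1, zero_add]
      have hsymm : ∑ w ∈ W, g w = ∑ w ∈ W, g ((K - w) % p) := by
        refine Finset.sum_nbij' (fun w => (K - w) % p) (fun w => (K - w) % p) ?_ ?_ ?_ ?_ ?_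
        · exact fun w hw => (hWK w hw).1
        · exact fun w hw => (hWK w hw).1
        · exact fun w hw => (hWK w hw).2.1
        · exact fun w hw => (hWK w hw).2.1
        · exact fun w hw => by rw [(hWK w hw).2.1]
      have hpair : ∀ w ∈ W, padicNorm p (g w + g ((K - w) % p)) ≤ ε * padicNorm p (α + i) := by
        intro w hw
        obtain ⟨hw1, hw2, hw3, hw4⟩ := hWK w hw
        have hwp : w < p := Finset.mem_range.1 (Finset.mem_filter.1 hw).1
        have hwp' : (K - w) % p < p := Nat.mod_lt _ hp0
        simp only [hg]
        rw [hw3]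
        generalize (K - w) / p = M at *
        generalize (K - w) % p = w' at *
        have := ih h.a'_mem h.b'_mem hα' (i := u)
          (isAntisymmLipschitz_digitPair hp2 hN h hφ hw4) hs'
        rw [mul_assoc, ← padicNorm.mul, ← hαi] at this
        rw [← Finset.sum_add_distrib]
        convert this using 2
        refine Finset.sum_congr rfl fun k hk => ?_
        have hkM := (Finset.mem_Ioc.1 hk).2
        have hpi : p * (M - k) + p * k = p * M := by rw [← mul_add, Nat.sub_add_cancel hkM]
        have e1 : K - (w + p * k) = w' + p * (M - k) := by omega
        have e2 : K - (w' + p * k) = w + p * (M - k) := by omega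
        simp only [hf]
        rw [e1, e2, h.hypA_eq hN hwp, h.hypA_eq hN hwp, h.hypA_eq hN hwp', h.hypA_eq hN hwp']
        ring
      have htwo : 2 * ∑ w ∈ W, g w = ∑ w ∈ W, (g w + g ((K - w) % p)) := by
        rw [Finset.sum_add_distrib, ← hsymm, two_mul]
      have := congrArg (padicNorm p) htwo
      rw [padicNorm.mul, padicNorm_two hp2, one_mul] at this
      rw [this]
      exact padicNorm.sum_le' hpair (mul_nonneg hφ.nonneg (padicNorm.nonneg _))

end Convolution

/-! ### The logarithmic solution modulo `p` -/

/-- The sum of the reciprocals of `x, x + 1, …, x + n - 1`. -/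
def harm (x : ℚ) (n : ℕ) : ℚ := ∑ i ∈ Finset.range n, 1 / (x + i)

/-- The logarithmic derivative of `(a + ε)ₙ (b + ε)ₙ / (1 + ε)ₙ²` at `ε = 0`. -/
def hypB (a b : ℚ) (n : ℕ) : ℚ := harm a n + harm b n - 2 * harm 1 n

section Logarithmic

variable {p : ℕ} [hp : Fact p.Prime] {N : ℕ} {a b a' b' : ℚ} {i₁ i₂ : ℕ}

/-- Modulo `p`, the multiple `p H(v + p u)` of a harmonic sum is the harmonic sum of the Dwork prime,
with one more term if the incomplete block contains the multiple of `p`. -/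
theorem IsDworkPrime.exists_harm_eq {x x' : ℚ} {i₀ : ℕ} (h : IsDworkPrime p x x' i₀)
    (hx' : padicNorm p x' ≤ 1) {v : ℕ} (hv : v ≤ p) (u : ℕ) :
    ∃ e : ℚ, padicNorm p e ≤ 1 ∧ p * harm x (v + p * u) =
      harm x' u + (if i₀ < v then 1 / (x' + u) else 0) + p * e := by
  have hp0 : (p : ℚ) ≠ 0 := by exact_mod_cast hp.out.ne_zero
  have block : ∀ u v, v ≤ p → ∃ e : ℚ, padicNorm p e ≤ 1 ∧
      p * ∑ i ∈ Finset.range v, 1 / (x + (p * u + i : ℕ)) =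
        (if i₀ < v then 1 / (x' + u) else 0) + p * e := by
    intro u v
    induction v with
    | zero => exact fun _ => ⟨0, by simp⟩
    | succ v ih =>
      intro hv
      obtain ⟨e, he, h1⟩ := ih (by omega)
      rw [Finset.sum_range_succ, mul_add, h1, add_comm (p * u)]
      rcases eq_or_ne v i₀ with rfl | hne
      · refine ⟨e, he, ?_⟩
        rw [h.add_eq_mul, if_neg (lt_irrefl _), if_pos (Nat.lt_succ_self _), one_div, mul_inv,
          mul_inv_cancel_left₀ hp0, one_div]
        ring
      · refine ⟨e + 1 / (x + (v + p * u : ℕ)), padicNorm_add_le he ?_, ?_⟩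
        · rw [padicNorm.div, h.padicNorm_eq_one hx' (by omega) hne]
          simp
        · have : (i₀ < v + 1) ↔ (i₀ < v) := by omega
          simp only [this]
          ring
  have full : ∃ e : ℚ, padicNorm p e ≤ 1 ∧ p * harm x (p * u) = harm x' u + p * e := by
    induction u with
    | zero => exact ⟨0, by simp [harm]⟩
    | succ u ih =>
      obtain ⟨e, he, h1⟩ := ih
      obtain ⟨e', he', h2⟩ := block u p le_rfl
      refine ⟨e + e', padicNorm_add_le he he', ?_⟩
      rw [if_pos h.lt] at h2
      unfold harm at h1 ⊢
      rw [mul_add p u 1, mul_one, Finset.sum_range_add, mul_add, h1, h2, Finset.sum_range_succ]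
      ring
  obtain ⟨e, he, h1⟩ := full
  obtain ⟨e', he', h2⟩ := block u v hv
  refine ⟨e + e', padicNorm_add_le he he', ?_⟩
  unfold harm at h1 ⊢
  rw [add_comm v, Finset.sum_range_add, mul_add, h1, h2]
  ring

theorem harm_mul_carry {x' : ℚ} (hx' : 0 < x') (i₀ v u : ℕ) :
    padicNorm p ((if i₀ < v then 1 / (x' + u) else 0) * carry p x' i₀ v u) ≤ padicNorm p p := by
  unfold carry
  split_ifs
  · have : x' + u ≠ 0 := by positivity
    rw [show 1 / (x' + u) * (p * (x' + u)) = (p : ℚ) by field_simp]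
  · simp

theorem digitFactor_mul_le {x x' : ℚ} (hx' : 0 < x') (i₀ v u : ℕ) :
    padicNorm p (digitFactor p x x' i₀ v u * (if i₀ < v then 1 / (x' + u) else 0)) ≤
      padicNorm p p := by
  rw [digitFactor, mul_assoc, padicNorm.mul, padicNorm.div, padicNorm_unitProd,
    padicNorm_unitProd, div_one, one_mul, mul_comm]
  exact harm_mul_carry hx' i₀ v u

/-- `p B(v + p u) ≡ B'(u)` modulo `p`, after multiplication by `A(v + p u)`. -/
theorem IsDworkPair.hypA_mul_hypB (hN : N.Coprime p) (h : IsDworkPair p N a b a' b' i₁ i₂)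
    {v : ℕ} (hv : v < p) (u : ℕ) :
    padicNorm p (hypA a b (v + p * u) * (hypB a' b' u - p * hypB a b (v + p * u))) ≤
      padicNorm p p := by
  obtain ⟨e₁, he₁, h₁⟩ := h.prime_a.exists_harm_eq (padicNorm_le_one_of_mem hN h.a'_mem) hv.le u
  obtain ⟨e₂, he₂, h₂⟩ := h.prime_b.exists_harm_eq (padicNorm_le_one_of_mem hN h.b'_mem) hv.le u
  obtain ⟨e₃, he₃, h₃⟩ := (isDworkPrime_one (p := p)).exists_harm_eq (by simp) hv.le u
  rw [if_neg (by omega)] at h₃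
  set c₁ : ℚ := if i₁ < v then 1 / (a' + u) else 0 with hc₁
  set c₂ : ℚ := if i₂ < v then 1 / (b' + u) else 0 with hc₂
  have hA := h.hypA_eq hN hv u
  set r₁ := digitFactor p a a' i₁ v u with hr₁
  set r₂ := digitFactor p b b' i₂ v u with hr₂
  have hA0 := padicNorm_hypA_le_one hN h.a'_mem h.b'_mem u
  have hA1 := padicNorm_hypA_le_one hN h.a_mem h.b_mem (v + p * u)
  have e : hypA a b (v + p * u) * (hypB a' b' u - p * hypB a b (v + p * u)) =
      -((r₁ * c₁) * (r₂ * hypA a' b' u) + ((r₂ * c₂) * (r₁ * hypA a' b' u) +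
        p * (hypA a b (v + p * u) * ((e₁ + e₂) - (e₃ + e₃))))) := by
    have hA' : hypA a b (v + p * u) = r₁ * r₂ * hypA a' b' u := hA
    unfold hypB
    rw [hA']
    linear_combination (-(r₁ * r₂ * hypA a' b' u)) * (h₁ + h₂ - 2 * h₃)
  have hr₁1 : padicNorm p r₁ ≤ 1 :=
    (isDigitFactor_digitFactor hN h.a_mem (padicNorm_le_one_of_mem hN h.a'_mem) v).le_one u
  have hr₂1 : padicNorm p r₂ ≤ 1 :=
    (isDigitFactor_digitFactor hN h.b_mem (padicNorm_le_one_of_mem hN h.b'_mem) v).le_one u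
  rw [e, padicNorm.neg]
  refine padicNorm_add_le ?_ (padicNorm_add_le ?_ ?_)
  · simpa only [mul_one] using padicNorm_mul_le (digitFactor_mul_le (x := a) h.a'_mem.1 i₁ v u)
      (padicNorm_mul_le_one hr₂1 hA0)
  · simpa only [mul_one] using padicNorm_mul_le (digitFactor_mul_le (x := b) h.b'_mem.1 i₂ v u)
      (padicNorm_mul_le_one hr₁1 hA0)
  · simpa only [mul_one] using padicNorm_mul_le (le_refl (padicNorm p p))
      (padicNorm_mul_le_one hA1 (padicNorm_sub_le (padicNorm_add_le he₁ he₂)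
        (padicNorm_add_le he₃ he₃)))

theorem padicNorm_pow_le_of_ne_zero {x : ℚ} (hx : x ≠ 0) :
    ∃ s : ℕ, padicNorm p ((p : ℚ) ^ s) ≤ padicNorm p x := by
  obtain ⟨z, hz⟩ := padicNorm.values_discrete (p := p) hx
  have hp1 : (1 : ℚ) < p := by exact_mod_cast hp.out.one_lt
  refine ⟨z.toNat, ?_⟩
  have : padicNorm p ((p : ℚ) ^ z.toNat) = (p : ℚ) ^ (-(z.toNat : ℤ)) := by
    rw [zpow_neg, zpow_natCast, ← inv_pow, ← padicNorm.padicNorm_p_of_prime]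
    generalize z.toNat = n
    induction n with
    | zero => simp
    | succ n ih => rw [pow_succ, pow_succ, padicNorm.mul, ih]
  rw [this, hz]
  refine zpow_le_zpow_right₀ hp1.le ?_
  have := Int.self_le_toNat z
  omega

/-- Summation by parts against the partial sums of `1 / (α + i)`. -/
theorem sum_harm_mul (α : ℚ) (K : ℕ) (f : ℕ → ℚ) :
    ∑ j ∈ Finset.range (K + 1), harm α j * f j =
      ∑ i ∈ Finset.range K, 1 / (α + i) * ∑ j ∈ Finset.Ioc i K, f j := by
  unfold harm
  simp_rw [Finset.sum_mul, Finset.mul_sum]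
  rw [Finset.sum_sigma', Finset.sum_sigma']
  refine Finset.sum_nbij' (fun x => ⟨x.2, x.1⟩) (fun x => ⟨x.2, x.1⟩) ?_ ?_ ?_ ?_ ?_ <;>
    simp <;> intros <;> omega

/-- Weighting an antisymmetric convolution by harmonic sums loses nothing: after summation by
parts, the denominator `α + i` cancels against the divisibility of the tail. -/
theorem padicNorm_sum_harm_le (hp2 : p ≠ 2) (hN : N.Coprime p) {α : ℚ} (ha : a ∈ fracSet N)
    (hb : b ∈ fracSet N) (hα : α = a ∨ α = b ∨ α = 1) {K : ℕ} {ε : ℚ} {φ : ℕ → ℚ}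
    (hφ : IsAntisymmLipschitz p K ε φ) :
    padicNorm p (∑ j ∈ Finset.range (K + 1), harm α j * (hypA a b j * hypA a b (K - j) * φ j)) ≤
      ε := by
  have hα0 : 0 < α := by
    rcases hα with rfl | rfl | rfl
    exacts [ha.1, hb.1, one_pos]
  rw [sum_harm_mul]
  refine padicNorm.sum_le' (fun i _ => ?_) hφ.nonneg
  have hne : α + i ≠ 0 := by positivity
  obtain ⟨s, hs⟩ := padicNorm_pow_le_of_ne_zero (p := p) hne
  have h := padicNorm_sum_antisymm_le hp2 hN s ha hb hα hφ hs
  have hpos : 0 < padicNorm p (α + i) :=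
    lt_of_le_of_ne (padicNorm.nonneg _) (padicNorm.nonzero hne).symm
  rw [padicNorm.mul, padicNorm.div, padicNorm.one, one_div, inv_mul_le_iff₀ hpos]
  linarith

/-- The congruence behind the Frobenius structure: the coefficient of `z ^ (v + p K)` in
`F(z) G'(z ^ p) - p F'(z ^ p) G(z)` is divisible by `p`. -/
theorem IsDworkPair.sum_congr (hp2 : p ≠ 2) (hN : N.Coprime p)
    (h : IsDworkPair p N a b a' b' i₁ i₂) {v : ℕ} (hv : v < p) (K : ℕ) :
    padicNorm p (∑ j ∈ Finset.range (K + 1), hypA a b (v + p * j) * hypA a' b' (K - j) *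
      (hypB a' b' (K - j) - p * hypB a b (v + p * j))) ≤ padicNorm p p := by
  set r := hypDigit p a b a' b' i₁ i₂ v with hr
  have hd := h.isDigitFactor hN v
  set φ : ℕ → ℚ := fun j => r (K - j) - r j with hφdef
  have hφ : IsAntisymmLipschitz p K (padicNorm p p) φ := by
    refine ⟨padicNorm.nonneg _, fun j hj => ?_, fun j hj k hk => ?_⟩
    · simp only [hφdef, Nat.sub_sub_self hj, neg_sub]
    · have e : φ j - φ k = (r (K - j) - r (K - k)) - (r j - r k) := by simp only [hφdef]; ring
      rw [e, ← padicNorm.mul]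
      refine padicNorm_sub_le ((hd.lipschitz _ _).trans (le_of_eq ?_)) (hd.lipschitz _ _)
      rw [Nat.cast_sub hj, Nat.cast_sub hk, padicNorm.mul, padicNorm.mul, sub_sub_sub_cancel_left,
        padicNorm_sub_comm]
  set f : ℕ → ℚ := fun j => hypA a' b' j * hypA a' b' (K - j) * φ j with hf
  have e1 : ∑ j ∈ Finset.range (K + 1), hypA a b (v + p * j) * hypA a' b' (K - j) *
      (hypB a' b' (K - j) - p * hypB a b (v + p * j)) =
      ∑ j ∈ Finset.range (K + 1), hypA a' b' (K - j) * (hypA a b (v + p * j) *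
        (hypB a' b' j - p * hypB a b (v + p * j))) +
      ∑ j ∈ Finset.range (K + 1), hypA a b (v + p * j) * hypA a' b' (K - j) *
        (hypB a' b' (K - j) - hypB a' b' j) := by
    rw [← Finset.sum_add_distrib]
    exact Finset.sum_congr rfl fun j _ => by ring
  have e2 : ∑ j ∈ Finset.range (K + 1), hypA a b (v + p * j) * hypA a' b' (K - j) *
        (hypB a' b' (K - j) - hypB a' b' j) =
      ∑ j ∈ Finset.range (K + 1), hypB a' b' j * f j := by
    -- the reflection `j ↦ K - j` makes the weights antisymmetric
    have e3 : ∑ j ∈ Finset.range (K + 1), r (K - j) * hypA a' b' (K - j) * hypA a' b' j *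
          hypB a' b' j =
        ∑ j ∈ Finset.range (K + 1), r j * hypA a' b' j * hypA a' b' (K - j) *
          hypB a' b' (K - j) := by
      rw [← Finset.sum_range_reflect]
      refine Finset.sum_congr rfl fun j hj => ?_
      have hj' : j ≤ K := by simpa [Nat.lt_succ_iff] using hj
      simp only [Nat.add_sub_cancel, Nat.sub_sub_self hj']
    have e4 : ∀ j, hypB a' b' j * f j = r (K - j) * hypA a' b' (K - j) * hypA a' b' j *
          hypB a' b' j - r j * hypA a' b' j * hypA a' b' (K - j) * hypB a' b' j := by
      intro j
      simp only [hf, hφdef]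
      ring
    simp_rw [e4]
    rw [Finset.sum_sub_distrib, e3, ← Finset.sum_sub_distrib]
    refine Finset.sum_congr rfl fun j _ => ?_
    rw [h.hypA_eq hN hv]
    ring
  have e5 : ∑ j ∈ Finset.range (K + 1), hypB a' b' j * f j =
      (∑ j ∈ Finset.range (K + 1), harm a' j * f j + ∑ j ∈ Finset.range (K + 1), harm b' j * f j) -
      2 * ∑ j ∈ Finset.range (K + 1), harm 1 j * f j := by
    rw [← Finset.sum_add_distrib, Finset.mul_sum, ← Finset.sum_sub_distrib]
    exact Finset.sum_congr rfl fun j _ => by unfold hypB; ring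
  rw [e1, e2, e5]
  refine padicNorm_add_le (padicNorm.sum_le' (fun j _ => ?_) (padicNorm.nonneg _))
    (padicNorm_sub_le (padicNorm_add_le ?_ ?_) ?_)
  · simpa only [one_mul] using padicNorm_mul_le
      (padicNorm_hypA_le_one hN h.a'_mem h.b'_mem (K - j)) (h.hypA_mul_hypB hN hv j)
  · exact padicNorm_sum_harm_le hp2 hN h.a'_mem h.b'_mem (.inl rfl) hφ
  · exact padicNorm_sum_harm_le hp2 hN h.a'_mem h.b'_mem (.inr (.inl rfl)) hφ
  · rw [padicNorm.mul, padicNorm_two hp2, one_mul]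
    exact padicNorm_sum_harm_le hp2 hN h.a'_mem h.b'_mem (.inr (.inr rfl)) hφ

end Logarithmic

/-! ### Gauss bounds for power series -/

section Gauss

variable {p : ℕ} [hp : Fact p.Prime]

theorem padicNorm_pow (x : ℚ) (n : ℕ) : padicNorm p (x ^ n) = padicNorm p x ^ n := by
  induction n with
  | zero => simp
  | succ n ih => rw [pow_succ, pow_succ, padicNorm.mul, ih]

/-- The power series `f` satisfies `|fₙ| ^ e ≤ ε c ^ n` for all `n ≤ M`. The exponent `e` makes
room for radii that are `e`-th roots of rational numbers. -/
def GaussBound (p e : ℕ) (ε c : ℚ) (M : ℕ) (f : ℚ⟦X⟧) : Prop :=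
  ∀ n ≤ M, padicNorm p (coeff n f) ^ e ≤ ε * c ^ n

/-- The power series `f` satisfies `|fₙ| ^ e < c ^ n` for all `n ≤ M`. -/
def StrictGaussBound (p e : ℕ) (c : ℚ) (M : ℕ) (f : ℚ⟦X⟧) : Prop :=
  ∀ n ≤ M, padicNorm p (coeff n f) ^ e < c ^ n

variable {e M : ℕ} {ε ε' c : ℚ} {f g : ℚ⟦X⟧}

theorem padicNorm_add_pow_le {x y t : ℚ} (hx : padicNorm p x ^ e ≤ t) (hy : padicNorm p y ^ e ≤ t) :
    padicNorm p (x + y) ^ e ≤ t := by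
  have h := pow_le_pow_left₀ (padicNorm.nonneg _)
    (padicNorm.nonarchimedean (p := p) (q := x) (r := y)) e
  rcases max_choice (padicNorm p x) (padicNorm p y) with h1 | h1 <;> rw [h1] at h
  exacts [h.trans hx, h.trans hy]

theorem padicNorm_sum_pow_le [NeZero e] {ι : Type*} {s : Finset ι} {F : ι → ℚ} {t : ℚ}
    (hF : ∀ i ∈ s, padicNorm p (F i) ^ e ≤ t) (ht : 0 ≤ t) :
    padicNorm p (∑ i ∈ s, F i) ^ e ≤ t := by
  classical
  induction s using Finset.induction_on with
  | empty => simpa [NeZero.ne e] using ht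
  | insert a s ha ih =>
    rw [Finset.sum_insert ha]
    rw [Finset.forall_mem_insert] at hF
    exact padicNorm_add_pow_le hF.1 (ih hF.2)

theorem padicNorm_add_pow_lt {x y t : ℚ} (hx : padicNorm p x ^ e < t) (hy : padicNorm p y ^ e < t) :
    padicNorm p (x + y) ^ e < t := by
  have h := pow_le_pow_left₀ (padicNorm.nonneg _)
    (padicNorm.nonarchimedean (p := p) (q := x) (r := y)) e
  rcases max_choice (padicNorm p x) (padicNorm p y) with h1 | h1 <;> rw [h1] at h
  exacts [h.trans_lt hx, h.trans_lt hy]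

theorem padicNorm_sum_pow_lt [NeZero e] {ι : Type*} {s : Finset ι} {F : ι → ℚ} {t : ℚ}
    (hF : ∀ i ∈ s, padicNorm p (F i) ^ e < t) (ht : 0 < t) :
    padicNorm p (∑ i ∈ s, F i) ^ e < t := by
  classical
  induction s using Finset.induction_on with
  | empty => simpa [NeZero.ne e] using ht
  | insert a s ha ih =>
    rw [Finset.sum_insert ha]
    rw [Finset.forall_mem_insert] at hF
    exact padicNorm_add_pow_lt hF.1 (ih hF.2)

theorem GaussBound.mul [NeZero e] (hε : 0 ≤ ε) (hε' : 0 ≤ ε') (hc : 0 ≤ c)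
    (hf : GaussBound p e ε c M f) (hg : GaussBound p e ε' c M g) :
    GaussBound p e (ε * ε') c M (f * g) := by
  intro n hn
  rw [coeff_mul]
  refine padicNorm_sum_pow_le (fun x hx => ?_) (by positivity)
  have hx' := Finset.HasAntidiagonal.mem_antidiagonal.1 hx
  rw [padicNorm.mul, mul_pow]
  calc _ ≤ (ε * c ^ x.1) * (ε' * c ^ x.2) :=
        mul_le_mul (hf _ (by omega)) (hg _ (by omega)) (pow_nonneg (padicNorm.nonneg _) _)
          (by positivity)
    _ = _ := by rw [← hx', pow_add]; ring

theorem GaussBound.one [NeZero e] (hc : 0 ≤ c) : GaussBound p e 1 c M 1 := by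
  intro n _
  rw [coeff_one]
  split_ifs with h
  · simp [h]
  · simpa [NeZero.ne e] using pow_nonneg hc n

theorem GaussBound.pow [NeZero e] (hε : 0 ≤ ε) (hc : 0 ≤ c) (hf : GaussBound p e ε c M f)
    (k : ℕ) : GaussBound p e (ε ^ k) c M (f ^ k) := by
  induction k with
  | zero => simpa using GaussBound.one hc
  | succ k ih =>
    rw [pow_succ, pow_succ]
    exact ih.mul (pow_nonneg hε k) hε hc hf

theorem GaussBound.add (hf : GaussBound p e ε c M f) (hg : GaussBound p e ε c M g) :
    GaussBound p e ε c M (f + g) := fun n hn => by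
  rw [map_add]
  exact padicNorm_add_pow_le (hf n hn) (hg n hn)

theorem GaussBound.neg (hf : GaussBound p e ε c M f) : GaussBound p e ε c M (-f) := fun n hn => by
  rw [map_neg, padicNorm.neg]
  exact hf n hn

theorem GaussBound.sub (hf : GaussBound p e ε c M f) (hg : GaussBound p e ε c M g) :
    GaussBound p e ε c M (f - g) := by
  rw [sub_eq_add_neg]
  exact hf.add hg.neg

theorem StrictGaussBound.add (hf : StrictGaussBound p e c M f) (hg : StrictGaussBound p e c M g) :
    StrictGaussBound p e c M (f + g) := fun n hn => by
  rw [map_add]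
  exact padicNorm_add_pow_lt (hf n hn) (hg n hn)

theorem StrictGaussBound.neg (hf : StrictGaussBound p e c M f) :
    StrictGaussBound p e c M (-f) := fun n hn => by
  rw [map_neg, padicNorm.neg]
  exact hf n hn

theorem StrictGaussBound.sub (hf : StrictGaussBound p e c M f) (hg : StrictGaussBound p e c M g) :
    StrictGaussBound p e c M (f - g) := by
  rw [sub_eq_add_neg]
  exact hf.add hg.neg

theorem StrictGaussBound.mul [NeZero e] (hc : 0 < c) (hf : StrictGaussBound p e c M f)
    (hg : GaussBound p e 1 c M g) : StrictGaussBound p e c M (f * g) := by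
  intro n hn
  rw [coeff_mul]
  refine padicNorm_sum_pow_lt (fun x hx => ?_) (by positivity)
  have hx' := Finset.HasAntidiagonal.mem_antidiagonal.1 hx
  rw [padicNorm.mul, mul_pow]
  have h2 := hg x.2 (by omega)
  rw [one_mul] at h2
  calc _ ≤ padicNorm p (coeff x.1 f) ^ e * c ^ x.2 :=
        mul_le_mul_of_nonneg_left h2 (pow_nonneg (padicNorm.nonneg _) _)
    _ < c ^ x.1 * c ^ x.2 := mul_lt_mul_of_pos_right (hf _ (by omega)) (by positivity)
    _ = _ := by rw [← hx', pow_add]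

theorem GaussBound.inv [NeZero e] (hc : 0 ≤ c) (hf : GaussBound p e 1 c M f)
    (h0 : constantCoeff f = 1) : GaussBound p e 1 c M f⁻¹ := by
  intro n
  induction n using Nat.strong_induction_on with
  | _ n ih =>
    intro hn
    rw [coeff_inv, h0]
    split_ifs with hn0
    · simp [hn0]
    rw [inv_one, neg_mul, one_mul, padicNorm.neg]
    refine padicNorm_sum_pow_le (fun x hx => ?_) (by positivity)
    have hx' := Finset.HasAntidiagonal.mem_antidiagonal.1 hx
    split_ifs with h
    · rw [padicNorm.mul, mul_pow]
      calc _ ≤ (1 * c ^ x.1) * (1 * c ^ x.2) :=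
            mul_le_mul (hf _ (by omega)) (ih _ h (by omega)) (pow_nonneg (padicNorm.nonneg _) _)
              (by positivity)
        _ = _ := by rw [← hx', pow_add]; ring
    · simpa [NeZero.ne e] using pow_nonneg hc n

/-- The ring of power series with Gauss bound `1`. -/
def gaussSubring (p e : ℕ) [Fact p.Prime] [NeZero e] {c : ℚ} (hc : 0 ≤ c) (M : ℕ) :
    Subring ℚ⟦X⟧ where
  carrier := {f | GaussBound p e 1 c M f}
  mul_mem' hf hg := by simpa using GaussBound.mul zero_le_one zero_le_one hc hf hg
  one_mem' := GaussBound.one hc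
  add_mem' hf hg := GaussBound.add hf hg
  zero_mem' n _ := by simpa [NeZero.ne e] using pow_nonneg hc n
  neg_mem' hf := GaussBound.neg hf

theorem GaussBound.exists_add_pow_prime [NeZero e] (hc : 0 ≤ c) (hf : GaussBound p e 1 c M f)
    (hg : GaussBound p e 1 c M g) :
    ∃ r, GaussBound p e 1 c M r ∧ (f + g) ^ p = f ^ p + g ^ p + p * r := by
  obtain ⟨r, hr⟩ := exists_add_pow_prime_eq hp.out (⟨f, hf⟩ : gaussSubring p e hc M) ⟨g, hg⟩
  refine ⟨f * g * r, ?_, ?_⟩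
  · exact (gaussSubring p e hc M).mul_mem ((gaussSubring p e hc M).mul_mem hf hg) r.2
  · have := congrArg Subtype.val hr
    push_cast at this
    rw [this]
    ring

theorem GaussBound.exists_pow_sub_pow [NeZero e] (hc : 0 ≤ c) (hf : GaussBound p e 1 c M f)
    (hg : GaussBound p e 1 c M g) (n : ℕ) :
    ∃ r, GaussBound p e 1 c M r ∧ f ^ n - g ^ n = (f - g) * r := by
  obtain ⟨r, hr⟩ := sub_dvd_pow_sub_pow (⟨f, hf⟩ : gaussSubring p e hc M) ⟨g, hg⟩ n
  refine ⟨r, r.2, ?_⟩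
  simpa using congrArg Subtype.val hr

theorem StrictGaussBound.of_prime_mul [NeZero e] (hc : 0 < c) (hf : GaussBound p e 1 c M f) :
    StrictGaussBound p e c M (p * f) := by
  intro n hn
  have h1 : coeff n ((p : ℚ⟦X⟧) * f) = p * coeff n f := by
    rw [← nsmul_eq_mul, map_nsmul, nsmul_eq_mul]
  rw [h1, padicNorm.mul, mul_pow]
  have h2 : padicNorm p (p : ℚ) ^ e < 1 :=
    pow_lt_one₀ (padicNorm.nonneg _) padicNorm_prime_lt_one (NeZero.ne e)
  have h3 := hf n hn
  rw [one_mul] at h3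
  calc _ ≤ padicNorm p (p : ℚ) ^ e * c ^ n :=
        mul_le_mul_of_nonneg_left h3 (pow_nonneg (padicNorm.nonneg _) _)
    _ < 1 * c ^ n := mul_lt_mul_of_pos_right h2 (by positivity)
    _ = _ := one_mul _

/-- The reduction of the Gauss ring modulo the strict Gauss bound has injective Frobenius. -/
theorem StrictGaussBound.of_pow [NeZero e] (hc : 0 < c) {n₀ : ℕ}
    (hf : GaussBound p e 1 c (p * n₀) f) (h : StrictGaussBound p e c (p * n₀) (f ^ p)) :
    StrictGaussBound p e c n₀ f := by
  classical
  by_contra hcon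
  unfold StrictGaussBound at hcon
  push Not at hcon
  have hp1 := hp.out.one_le
  set n := Nat.find hcon with hn
  obtain ⟨hn0, hnc⟩ := Nat.find_spec hcon
  have hle : p * n ≤ p * n₀ := Nat.mul_le_mul_left _ hn0
  have hmin : ∀ m < n, padicNorm p (coeff m f) ^ e < c ^ m := by
    intro m hm
    have := Nat.find_min hcon hm
    push Not at this
    exact this (by omega)
  -- the part of `f` below the first coefficient that violates the strict bound
  set g : ℚ⟦X⟧ := ((trunc n f : Polynomial ℚ) : ℚ⟦X⟧) with hg
  have hgs : StrictGaussBound p e c (p * n₀) g := by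
    intro m _
    rw [hg, Polynomial.coeff_coe, coeff_trunc]
    split_ifs with hm
    · exact hmin m hm
    · simpa [NeZero.ne e] using pow_pos hc m
  have hgb : GaussBound p e 1 c (p * n₀) g := fun m hm => by simpa using (hgs m hm).le
  obtain ⟨k, hk⟩ : (X : ℚ⟦X⟧) ^ n ∣ f - g := by
    rw [X_pow_dvd_iff]
    intro m hm
    rw [map_sub, hg, Polynomial.coeff_coe, coeff_trunc, if_pos hm, sub_self]
  obtain ⟨r, hr, hfr⟩ := GaussBound.exists_pow_sub_pow hc.le hf (hf.sub hgb) p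
  have hs : StrictGaussBound p e c (p * n₀) ((f - g) ^ p) := by
    have e1 : (f - g) ^ p = f ^ p - g * r := by
      rw [sub_sub_cancel] at hfr
      rw [← hfr]; ring
    rw [e1]
    exact h.sub (hgs.mul hc hr)
  have h1 := hs _ hle
  rw [hk, mul_pow, ← pow_mul, mul_comm n p, coeff_X_pow_mul', if_pos le_rfl, Nat.sub_self,
    coeff_zero_eq_constantCoeff_apply, map_pow] at h1
  have h2 : constantCoeff k = coeff n f := by
    have h3 := congrArg (coeff n) hk
    rw [coeff_X_pow_mul', if_pos le_rfl, Nat.sub_self, map_sub, hg, Polynomial.coeff_coe,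
      coeff_trunc, if_neg (lt_irrefl _), sub_zero, coeff_zero_eq_constantCoeff_apply] at h3
    exact h3.symm
  rw [h2, padicNorm_pow, ← pow_mul, mul_comm p e, pow_mul, mul_comm p n, pow_mul] at h1
  exact absurd h1 (not_lt.2 (pow_le_pow_left₀ (by positivity) hnc p))

end Gauss

/-! ### Integral power series and Frobenius -/

section Frobenius

variable {p : ℕ} [hp : Fact p.Prime]

theorem padicNorm_pow_prime_sub_le {x : ℚ} (hx : padicNorm p x ≤ 1) :
    padicNorm p (x ^ p - x) ≤ padicNorm p p := by
  have hden : padicNorm p (x.den : ℚ) = 1 := by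
    by_contra hne
    have hlt : padicNorm p (x.den : ℚ) < 1 := lt_of_le_of_ne (padicNorm.of_nat _) hne
    have hnum : padicNorm p (x.num : ℚ) < 1 := by
      rw [← Rat.mul_den_eq_num x, padicNorm.mul]
      calc _ ≤ 1 * padicNorm p (x.den : ℚ) := mul_le_mul_of_nonneg_right hx (padicNorm.nonneg _)
        _ < 1 := by rwa [one_mul]
    rw [padicNorm.int_lt_one_iff] at hnum
    rw [padicNorm.nat_lt_one_iff] at hlt
    have h1 := Nat.dvd_gcd (Int.natCast_dvd.1 hnum) hlt
    rw [x.reduced] at h1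
    exact hp.out.one_lt.ne' (Nat.dvd_one.1 h1)
  have hd0 : (x.den : ℚ) ≠ 0 := by exact_mod_cast x.den_nz
  have e : x ^ p - x = ((x.num ^ p * x.den - x.num * (x.den : ℤ) ^ p : ℤ) : ℚ) / x.den ^ (p + 1) := by
    rw [eq_div_iff (pow_ne_zero _ hd0)]
    push_cast
    rw [← Rat.mul_den_eq_num x]
    ring
  have hdvd : (p : ℤ) ∣ x.num ^ p * x.den - x.num * (x.den : ℤ) ^ p := by
    rw [← ZMod.intCast_zmod_eq_zero_iff_dvd]
    push_cast
    rw [ZMod.pow_card, ZMod.pow_card, sub_self]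
  rw [e, padicNorm.div, padicNorm_pow, hden, one_pow, div_one]
  exact padicNorm_le_of_lt_one ((padicNorm.int_lt_one_iff _).2 hdvd)

theorem padicNorm_coeff_prime_mul_le {f : ℚ⟦X⟧} {n : ℕ} (h : padicNorm p (coeff n f) ≤ 1) :
    padicNorm p (coeff n ((p : ℚ⟦X⟧) * f)) ≤ padicNorm p p := by
  rw [← nsmul_eq_mul, map_nsmul, nsmul_eq_mul]
  simpa only [mul_one] using padicNorm_mul_le (le_refl (padicNorm p p)) h

/-- `f(z) ^ p ≡ f(z ^ p)` modulo `p` for `p`-integral power series. -/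
theorem padicNorm_coeff_pow_sub_expand_le (n : ℕ) {f : ℚ⟦X⟧} (hf : GaussBound p 1 1 1 n f) :
    padicNorm p (coeff n (f ^ p - expand p hp.out.ne_zero f)) ≤ padicNorm p p := by
  induction n using Nat.strong_induction_on generalizing f with
  | _ n ih =>
    set k : ℚ⟦X⟧ := mk fun m => coeff (m + 1) f with hk
    have hfk : f = X * k + C (constantCoeff f) := eq_X_mul_shift_add_const f
    have hC : GaussBound p 1 1 1 n (C (constantCoeff f)) := by
      intro m hm
      rw [coeff_C]
      split_ifs with h0
      · simpa using hf 0 (Nat.zero_le _)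
      · simp
    have hXk : GaussBound p 1 1 1 n (X * k) := by
      have : X * k = f - C (constantCoeff f) := by rw [eq_sub_iff_add_eq, ← hfk]
      rw [this]
      exact hf.sub hC
    obtain ⟨r, hr, hpow⟩ := GaussBound.exists_add_pow_prime zero_le_one hXk hC
    have e : f ^ p - expand p hp.out.ne_zero f =
        X ^ p * (k ^ p - expand p hp.out.ne_zero k) +
          (C (constantCoeff f ^ p - constantCoeff f) + (p : ℚ⟦X⟧) * r) := by
      conv_lhs => rw [hfk]
      rw [hpow, map_add, map_mul, expand_X, expand_C, map_sub, map_pow, mul_pow]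
      ring
    rw [e, map_add, map_add]
    refine padicNorm_add_le ?_ (padicNorm_add_le ?_ (padicNorm_coeff_prime_mul_le
      (by simpa using hr n le_rfl)))
    · rw [coeff_X_pow_mul']
      split_ifs with hpn
      · have hp0 := hp.out.pos
        refine ih (n - p) (by omega) fun m hm => ?_
        rw [hk, coeff_mk]
        simpa using hf (m + 1) (by omega)
      · simp
    · rw [coeff_C]
      split_ifs with h0
      · exact padicNorm_pow_prime_sub_le (by simpa using hf 0 (Nat.zero_le _))
      · rw [padicNorm.zero]
        exact padicNorm.nonneg _

theorem coeff_mul_padicNorm_le {f g : ℚ⟦X⟧} {n : ℕ} {δ : ℚ} (hδ : 0 ≤ δ)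
    (hf : ∀ m ≤ n, padicNorm p (coeff m f) ≤ 1)
    (hg : ∀ m ≤ n, padicNorm p (coeff m g) ≤ δ) : padicNorm p (coeff n (f * g)) ≤ δ := by
  rw [coeff_mul]
  refine padicNorm.sum_le' (fun x hx => ?_) hδ
  have hx' := Finset.HasAntidiagonal.mem_antidiagonal.1 hx
  simpa using padicNorm_mul_le (hf x.1 (by omega)) (hg x.2 (by omega))

/-- If `g(z ^ p) ≡ f(z) ^ p` modulo `p` multiplicatively, then `gₘ ≡ fₘ` modulo `p` as long as
`f` is integral up to order `p m`. -/
theorem padicNorm_coeff_sub_le_of_expand_eq {f g E : ℚ⟦X⟧}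
    (h : expand p hp.out.ne_zero g = f ^ p * E)
    (hE : ∀ n, padicNorm p (coeff n (E - 1)) ≤ padicNorm p p) {m : ℕ}
    (hf : GaussBound p 1 1 1 (p * m) f) :
    padicNorm p (coeff m g - coeff m f) ≤ padicNorm p p := by
  have e : expand p hp.out.ne_zero (g - f) =
      (f ^ p - expand p hp.out.ne_zero f) + f ^ p * (E - 1) := by
    rw [map_sub, h]; ring
  have h1 := congrArg (coeff (p * m)) e
  rw [coeff_expand_mul, map_sub, map_add] at h1
  rw [h1]
  refine padicNorm_add_le (padicNorm_coeff_pow_sub_expand_le _ hf)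
    (coeff_mul_padicNorm_le (padicNorm.nonneg _) (fun n hn => ?_) fun n _ => hE n)
  have := hf.pow zero_le_one zero_le_one p n hn
  simpa using this

/-- The integrality half of the Dieudonné–Dwork lemma. -/
theorem padicNorm_coeff_le_one_of_expand_eq {f E : ℚ⟦X⟧} (h0 : constantCoeff f = 1)
    (h : expand p hp.out.ne_zero f = f ^ p * E)
    (hE : ∀ n, padicNorm p (coeff n (E - 1)) ≤ padicNorm p p) (n : ℕ) :
    padicNorm p (coeff n f) ≤ 1 := by
  induction n using Nat.strong_induction_on with
  | _ n ih =>
    rcases Nat.eq_zero_or_pos n with rfl | hn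
    · simp [h0]
    set V : ℚ⟦X⟧ := ((trunc n f : Polynomial ℚ) : ℚ⟦X⟧) with hV
    have hVc : ∀ m, coeff m V = if m < n then coeff m f else 0 := fun m => by
      rw [hV, Polynomial.coeff_coe, coeff_trunc]
    have hVb : GaussBound p 1 1 1 n V := by
      intro m _
      rw [hVc]
      split_ifs with hm
      · simpa using ih m hm
      · simp
    have hV0 : constantCoeff V = 1 := by
      rw [← coeff_zero_eq_constantCoeff_apply, hVc, if_pos hn, coeff_zero_eq_constantCoeff_apply, h0]
    obtain ⟨k, hk⟩ : (X : ℚ⟦X⟧) ^ n ∣ f - V := by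
      rw [X_pow_dvd_iff]
      intro m hm
      rw [map_sub, hVc, if_pos hm, sub_self]
    have hk0 : constantCoeff k = coeff n f := by
      have h3 := congrArg (coeff n) hk
      rw [coeff_X_pow_mul', if_pos le_rfl, Nat.sub_self, map_sub, hVc,
        if_neg (lt_irrefl _), sub_zero, coeff_zero_eq_constantCoeff_apply] at h3
      exact h3.symm
    have hE0 : constantCoeff E = 1 := by
      have := congrArg constantCoeff h
      rw [constantCoeff_expand, map_mul, map_pow, h0, one_pow, one_mul] at this
      exact this.symm
    -- the coefficient of `z ^ n` in `f ^ p E` differs from that of `V ^ p E` by `p fₙ`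
    have hsum := (Commute.all f V).mul_geom_sum₂ p
    have e1 : f ^ p * E = V ^ p * E +
        X ^ n * (k * (∑ i ∈ Finset.range p, f ^ i * V ^ (p - 1 - i)) * E) := by
      rw [← sub_eq_iff_eq_add', ← sub_mul, ← hsum, hk]
      ring
    have e2 : coeff n (expand p hp.out.ne_zero f) = coeff n (expand p hp.out.ne_zero V) := by
      rw [coeff_expand, coeff_expand]
      split_ifs with hd
      · rw [hVc, if_pos (Nat.div_lt_self hn hp.out.one_lt)]
      · rfl
    have e3 : (p : ℚ) * coeff n f =
        -coeff n ((V ^ p - expand p hp.out.ne_zero V) + V ^ p * (E - 1)) := by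
      have e4 := congrArg (coeff n) h
      rw [e2, e1, map_add, coeff_X_pow_mul', if_pos le_rfl, Nat.sub_self,
        coeff_zero_eq_constantCoeff_apply, map_mul constantCoeff, map_mul constantCoeff, hk0, hE0,
        map_sum] at e4
      simp only [map_mul constantCoeff, map_pow, h0, hV0, one_pow, mul_one, Finset.sum_const,
        Finset.card_range, nsmul_eq_mul] at e4
      have e5 : (V ^ p - expand p hp.out.ne_zero V) + V ^ p * (E - 1) =
        V ^ p * E - expand p hp.out.ne_zero V := by ring
      rw [e5, map_sub, e4]
      ring
    have h1 : padicNorm p ((p : ℚ) * coeff n f) ≤ padicNorm p p := by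
      rw [e3, padicNorm.neg, map_add]
      refine padicNorm_add_le (padicNorm_coeff_pow_sub_expand_le _ hVb)
        (coeff_mul_padicNorm_le (padicNorm.nonneg _) (fun m hm => ?_) fun m _ => hE m)
      simpa using hVb.pow zero_le_one zero_le_one p m hm
    rw [padicNorm.mul] at h1
    refine le_of_mul_le_mul_left (h1.trans_eq (mul_one _).symm) ?_
    rw [padicNorm.padicNorm_p_of_prime]
    exact inv_pos.2 (by exact_mod_cast hp.out.pos)

/-- If `g(z ^ p) = f(z) ^ p E` with `E ≡ 1` modulo `p`, and `g` is strictly small on the disc of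
the `p`-th power of a radius, then `f` cannot attain the Gauss bound of that radius. -/
theorem strictGaussBound_of_expand_eq {e : ℕ} [NeZero e] {c : ℚ} (hc : 1 ≤ c) {n₀ : ℕ}
    {f g E : ℚ⟦X⟧} (h : expand p hp.out.ne_zero g = f ^ p * E)
    (hE : ∀ n, padicNorm p (coeff n (E - 1)) ≤ padicNorm p p)
    (hf : GaussBound p e 1 c (p * n₀) f)
    (hg : ∀ m ≤ n₀, padicNorm p (coeff m (g - 1)) ^ e < c ^ (p * m)) :
    StrictGaussBound p e c n₀ (f - 1) := by
  have hc0 : 0 < c := by linarith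
  have h1 : GaussBound p e 1 c (p * n₀) 1 := GaussBound.one hc0.le
  refine StrictGaussBound.of_pow hc0 (hf.sub h1) ?_
  obtain ⟨r, hr, hpow⟩ := GaussBound.exists_add_pow_prime hc0.le (hf.sub h1) h1
  have hEs : StrictGaussBound p e c (p * n₀) (E - 1) := by
    intro n _
    calc _ < (1 : ℚ) := pow_lt_one₀ (padicNorm.nonneg _)
            ((hE n).trans_lt padicNorm_prime_lt_one) (NeZero.ne e)
      _ ≤ c ^ n := one_le_pow₀ hc
  have hgs : StrictGaussBound p e c (p * n₀) (expand p hp.out.ne_zero (g - 1)) := by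
    intro n hn
    rw [coeff_expand]
    split_ifs with hd
    · obtain ⟨m, rfl⟩ := hd
      rw [Nat.mul_div_cancel_left _ hp.out.pos]
      exact hg m (Nat.le_of_mul_le_mul_left hn hp.out.pos)
    · simpa [NeZero.ne e] using pow_pos hc0 n
  have hfp : GaussBound p e 1 c (p * n₀) (f ^ p) := by
    simpa using hf.pow zero_le_one hc0.le p
  have e1 : (f - 1) ^ p = expand p hp.out.ne_zero (g - 1) - (E - 1) * f ^ p -
      (p : ℚ⟦X⟧) * r := by
    rw [sub_add_cancel, one_pow] at hpow
    rw [map_sub, h, map_one]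
    linear_combination -hpow
  rw [e1]
  exact (hgs.sub (hEs.mul hc0 hfp)).sub (StrictGaussBound.of_prime_mul hc0 hr)

end Frobenius

/-! ### Exponentials of power series -/

theorem coeff_subst_eq_sum {g : ℚ⟦X⟧} (hg : constantCoeff g = 0) (f : ℚ⟦X⟧) (n : ℕ) :
    coeff n (f.subst g) = ∑ m ∈ Finset.range (n + 1), coeff m f * coeff n (g ^ m) := by
  rw [coeff_subst' (HasSubst.of_constantCoeff_zero' hg)]
  rw [finsum_eq_sum_of_support_subset (s := Finset.range (n + 1))]
  · simp only [smul_eq_mul]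
  · intro m hm
    simp only [Finset.coe_range, Set.mem_Iio]
    by_contra hlt
    apply hm
    have hX : (X : ℚ⟦X⟧) ^ m ∣ g ^ m := pow_dvd_pow_of_dvd (X_dvd_iff.2 hg) m
    simp only
    rw [X_pow_dvd_iff.1 hX n (by omega), smul_zero]

/-- The exponential of a power series without constant term. -/
noncomputable def expSeries (D : ℚ⟦X⟧) : ℚ⟦X⟧ := (exp ℚ).subst D

theorem constantCoeff_expSeries {D : ℚ⟦X⟧} (hD : constantCoeff D = 0) :
    constantCoeff (expSeries D) = 1 := by
  rw [← coeff_zero_eq_constantCoeff_apply, expSeries, coeff_subst_eq_sum hD]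
  simp [coeff_exp]

theorem derivative_expSeries {D : ℚ⟦X⟧} (hD : constantCoeff D = 0) :
    derivative ℚ (expSeries D) = expSeries D * derivative ℚ D := by
  rw [expSeries, derivative_subst (HasSubst.of_constantCoeff_zero' hD), derivative_exp]

theorem expSeries_mul_neg {D : ℚ⟦X⟧} (hD : constantCoeff D = 0) :
    expSeries D * expSeries (-D) = 1 := by
  have hD' : constantCoeff (-D) = 0 := by rw [map_neg, hD, neg_zero]
  refine derivative.ext ?_ ?_
  · rw [Derivation.leibniz, derivative_expSeries hD, derivative_expSeries hD', map_neg,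
      derivative_one]
    simp only [smul_eq_mul]
    ring
  · rw [map_mul, constantCoeff_expSeries hD, constantCoeff_expSeries hD', map_one, one_mul]

theorem expSeries_add {D D' : ℚ⟦X⟧} (hD : constantCoeff D = 0) (hD' : constantCoeff D' = 0) :
    expSeries (D + D') = expSeries D * expSeries D' := by
  have hs : constantCoeff (D + D') = 0 := by rw [map_add, hD, hD', add_zero]
  have hs' : constantCoeff (-(D + D')) = 0 := by rw [map_neg, hs, neg_zero]
  have h1 : expSeries D * expSeries D' * expSeries (-(D + D')) = 1 := by
    refine derivative.ext ?_ ?_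
    · rw [Derivation.leibniz, Derivation.leibniz, derivative_expSeries hD,
        derivative_expSeries hD', derivative_expSeries hs', map_neg, map_add, derivative_one]
      simp only [smul_eq_mul]
      ring
    · rw [map_mul, map_mul, constantCoeff_expSeries hD, constantCoeff_expSeries hD',
        constantCoeff_expSeries hs', map_one, one_mul, one_mul]
  have h2 := expSeries_mul_neg hs
  calc expSeries (D + D') = expSeries (D + D') *
        (expSeries D * expSeries D' * expSeries (-(D + D'))) := by rw [h1, mul_one]
    _ = expSeries D * expSeries D' * (expSeries (D + D') * expSeries (-(D + D'))) := by ring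
    _ = _ := by rw [h2, mul_one]

theorem expSeries_nsmul {D : ℚ⟦X⟧} (hD : constantCoeff D = 0) (n : ℕ) :
    expSeries (n * D) = expSeries D ^ n := by
  induction n with
  | zero =>
    have h := expSeries_add hD (show constantCoeff (0 : ℚ⟦X⟧) = 0 by simp)
    rw [add_zero] at h
    have h1 : expSeries (-D) * (expSeries D * expSeries 0) = expSeries (-D) * expSeries D := by
      rw [← h]
    rw [← mul_assoc, mul_comm (expSeries (-D)), expSeries_mul_neg hD, one_mul] at h1
    simpa using h1
  | succ n ih =>
    rw [Nat.cast_succ, add_mul, one_mul, expSeries_add (by simp [hD]) hD, ih, pow_succ]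

theorem expand_expSeries {D : ℚ⟦X⟧} (hD : constantCoeff D = 0) {p : ℕ} (hp : p ≠ 0) :
    expand p hp (expSeries D) = expSeries (expand p hp D) := by
  rw [expand_apply, expand_apply, expSeries, expSeries,
    subst_comp_subst_apply (HasSubst.of_constantCoeff_zero' hD) (HasSubst.X_pow hp)]

section ExpBounds

variable {p : ℕ} [hp : Fact p.Prime]

theorem padicNorm_inv_factorial_le (hp2 : p ≠ 2) {k : ℕ} (hk : k ≠ 0) :
    padicNorm p (1 / k.factorial) ^ 2 * p ≤ (p : ℚ) ^ k := by
  have hp1 : (1 : ℚ) ≤ p := by exact_mod_cast hp.out.one_le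
  have hp0 : (p : ℚ) ≠ 0 := by exact_mod_cast hp.out.ne_zero
  have h1 := sub_one_mul_padicValNat_factorial_lt_of_ne_zero p hk
  have h3 : 2 ≤ p - 1 := by
    have := hp.out.two_le
    omega
  have h2 : 2 * padicValNat p k.factorial + 1 ≤ k := by
    have := Nat.mul_le_mul_right (padicValNat p k.factorial) h3
    omega
  have hk0 : (k.factorial : ℚ) ≠ 0 := by exact_mod_cast k.factorial_ne_zero
  rw [padicNorm.div, padicNorm.one, padicNorm.eq_zpow_of_nonzero hk0, padicValRat.of_nat, one_div,
    ← zpow_neg, neg_neg, zpow_natCast, ← pow_mul, ← pow_succ]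
  refine pow_le_pow_right₀ hp1 (by omega)

/-- A Gauss bound for `D` below the radius of convergence of the exponential passes to
`exp D - 1`. -/
theorem GaussBound.expSeries_sub_one (hp2 : p ≠ 2) {D : ℚ⟦X⟧} (hD : constantCoeff D = 0)
    {ε c : ℚ} {M : ℕ} (hε : 0 ≤ ε) (hεp : ε * p ≤ 1) (hc : 0 ≤ c) (h : GaussBound p 2 ε c M D) :
    GaussBound p 2 ε c M (expSeries D - 1) := by
  intro n hn
  have hp0 : (0 : ℚ) < p := by exact_mod_cast hp.out.pos
  have e : coeff n (expSeries D - 1) =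
      ∑ k ∈ (Finset.range (n + 1)).erase 0, coeff k (exp ℚ) * coeff n (D ^ k) := by
    rw [map_sub, expSeries, coeff_subst_eq_sum hD,
      ← Finset.add_sum_erase _ _ (Finset.mem_range.2 (Nat.succ_pos n))]
    simp [coeff_exp]
  rw [e]
  refine padicNorm_sum_pow_le (fun k hk => ?_) (by positivity)
  have hk0 := Finset.ne_of_mem_erase hk
  have h1 := h.pow hε hc k n hn
  have h2 := padicNorm_inv_factorial_le hp2 hk0
  rw [padicNorm.mul, mul_pow, coeff_exp]
  have h3 : (algebraMap ℚ ℚ) (1 / (k.factorial : ℚ)) = 1 / k.factorial := rfl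
  rw [h3]
  obtain ⟨j, rfl⟩ := Nat.exists_eq_succ_of_ne_zero hk0
  rw [Nat.succ_eq_add_one, pow_succ (p : ℚ)] at h2
  have h4 := le_of_mul_le_mul_right h2 hp0
  calc _ ≤ (p : ℚ) ^ j * (ε ^ (j + 1) * c ^ n) :=
        mul_le_mul h4 h1 (by positivity) (by positivity)
    _ = (ε * p) ^ j * (ε * c ^ n) := by rw [mul_pow, pow_succ]; ring
    _ ≤ 1 * (ε * c ^ n) :=
        mul_le_mul_of_nonneg_right (pow_le_one₀ (by positivity) hεp) (by positivity)
    _ = _ := one_mul _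

end ExpBounds

/-! ### The hypergeometric mirror map -/

/-- The hypergeometric series `₂F₁(a, b; 1; z)`. -/
noncomputable def hypF (a b : ℚ) : ℚ⟦X⟧ := mk (hypA a b)

/-- The series `G` such that `F log z + G` is the logarithmic solution of the hypergeometric
equation at `z = 0`. -/
noncomputable def hypG (a b : ℚ) : ℚ⟦X⟧ := mk fun n => hypA a b n * hypB a b n

/-- The quotient `G / F`. -/
noncomputable def hypD (a b : ℚ) : ℚ⟦X⟧ := hypG a b * (hypF a b)⁻¹

/-- The mirror map divided by its argument: `z U(z) = exp (log z + G / F)`. -/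
noncomputable def hypU (a b : ℚ) : ℚ⟦X⟧ := expSeries (hypD a b)

theorem constantCoeff_hypF (a b : ℚ) : constantCoeff (hypF a b) = 1 := by
  rw [← coeff_zero_eq_constantCoeff_apply, hypF, coeff_mk]
  simp [hypA]

theorem constantCoeff_hypG (a b : ℚ) : constantCoeff (hypG a b) = 0 := by
  rw [← coeff_zero_eq_constantCoeff_apply, hypG, coeff_mk]
  simp [hypB, harm]

theorem constantCoeff_hypD (a b : ℚ) : constantCoeff (hypD a b) = 0 := by
  rw [hypD, map_mul, constantCoeff_hypG, zero_mul]

theorem constantCoeff_hypU (a b : ℚ) : constantCoeff (hypU a b) = 1 :=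
  constantCoeff_expSeries (constantCoeff_hypD a b)

theorem hypF_mul_inv (a b : ℚ) : hypF a b * (hypF a b)⁻¹ = 1 :=
  PowerSeries.mul_inv_cancel _ (by rw [constantCoeff_hypF]; exact one_ne_zero)

theorem hypF_mul_hypD (a b : ℚ) : hypF a b * hypD a b = hypG a b := by
  rw [hypD, mul_left_comm, hypF_mul_inv, mul_one]

section Frobenius

variable {p : ℕ} [hp : Fact p.Prime] {N : ℕ} {a b a' b' : ℚ} {i₁ i₂ : ℕ}

theorem coeff_mul_expand (f g : ℚ⟦X⟧) {v : ℕ} (hv : v < p) (K : ℕ) :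
    coeff (v + p * K) (f * expand p hp.out.ne_zero g) =
      ∑ j ∈ Finset.range (K + 1), coeff (v + p * j) f * coeff (K - j) g := by
  have hp0 := hp.out.pos
  rw [coeff_mul]
  symm
  refine Finset.sum_of_injOn (fun j => (v + p * j, p * (K - j))) ?_ ?_ ?_ ?_
  · intro j _ k _ h
    have h1 : v + p * j = v + p * k := (Prod.mk.inj h).1
    exact Nat.eq_of_mul_eq_mul_left hp0 (by omega)
  · intro j hj
    have hj' : j ≤ K := by simpa [Nat.lt_succ_iff] using hj
    have : p * (K - j) + p * j = p * K := by rw [← mul_add, Nat.sub_add_cancel hj']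
    simp only [Finset.mem_coe, Finset.HasAntidiagonal.mem_antidiagonal]
    omega
  · rintro ⟨m, n⟩ hmn hnot
    rw [Finset.HasAntidiagonal.mem_antidiagonal] at hmn
    simp only at hmn
    by_cases hd : p ∣ n
    · exfalso
      apply hnot
      obtain ⟨k, rfl⟩ := hd
      have hkK : k ≤ K := by
        by_contra hlt
        have h1 : p * (K + 1) ≤ p * k := Nat.mul_le_mul_left _ (by omega)
        rw [mul_add, mul_one] at h1
        omega
      have : p * (K - k) + p * k = p * K := by rw [← mul_add, Nat.sub_add_cancel hkK]
      refine ⟨K - k, by simp, ?_⟩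
      simp only [Nat.sub_sub_self hkK, Prod.mk.injEq, and_true]
      omega
    · simp only
      rw [coeff_expand_of_not_dvd _ _ _ hd, mul_zero]
  · intro j _
    simp only
    rw [coeff_expand_mul]

/-- `F(z) G'(z ^ p) - p F'(z ^ p) G(z) ≡ 0` modulo `p`. -/
theorem IsDworkPair.padicNorm_coeff_cross_le (hp2 : p ≠ 2) (hN : N.Coprime p)
    (h : IsDworkPair p N a b a' b' i₁ i₂) (n : ℕ) :
    padicNorm p (coeff n (hypF a b * expand p hp.out.ne_zero (hypG a' b') -
      p * (hypG a b * expand p hp.out.ne_zero (hypF a' b')))) ≤ padicNorm p p := by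
  rw [← Nat.mod_add_div n p]
  have hv := Nat.mod_lt n hp.out.pos
  refine le_of_eq_of_le ?_ (h.sum_congr hp2 hN hv (n / p))
  congr 1
  rw [map_sub, ← nsmul_eq_mul, map_nsmul, nsmul_eq_mul, coeff_mul_expand _ _ hv,
    coeff_mul_expand _ _ hv, Finset.mul_sum, ← Finset.sum_sub_distrib]
  refine Finset.sum_congr rfl fun j _ => ?_
  simp only [hypF, hypG, coeff_mk]
  ring

theorem gaussBound_hypF (hN : N.Coprime p) (ha : a ∈ fracSet N) (hb : b ∈ fracSet N) (M : ℕ) :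
    GaussBound p 1 1 1 M (hypF a b) := by
  intro n _
  rw [hypF, coeff_mk]
  simpa using padicNorm_hypA_le_one hN ha hb n

/-- `D'(z ^ p) ≡ p D(z)` modulo `p`. -/
theorem IsDworkPair.padicNorm_coeff_hypD_le (hp2 : p ≠ 2) (hN : N.Coprime p)
    (h : IsDworkPair p N a b a' b' i₁ i₂) (n : ℕ) :
    padicNorm p (coeff n (expand p hp.out.ne_zero (hypD a' b') - p * hypD a b)) ≤
      padicNorm p p := by
  set ex := expand (R := ℚ) p hp.out.ne_zero with hex
  have hinv : ex (hypF a' b') * ex (hypF a' b')⁻¹ = 1 := by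
    rw [← map_mul, hypF_mul_inv, map_one]
  have e : ex (hypD a' b') - (p : ℚ⟦X⟧) * hypD a b = (hypF a b)⁻¹ * ex (hypF a' b')⁻¹ *
      (hypF a b * ex (hypG a' b') - (p : ℚ⟦X⟧) * (hypG a b * ex (hypF a' b'))) := by
    have h1 := hypF_mul_inv a b
    rw [hypD, hypD, map_mul]
    linear_combination ((p : ℚ⟦X⟧) * hypG a b * (hypF a b)⁻¹) * hinv -
      (ex (hypG a' b') * ex (hypF a' b')⁻¹) * h1
  rw [e]
  have b1 := fun M => (gaussBound_hypF hN h.a_mem h.b_mem M).inv zero_le_one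
    (constantCoeff_hypF a b)
  have b2 := fun M => (gaussBound_hypF hN h.a'_mem h.b'_mem M).inv zero_le_one
    (constantCoeff_hypF a' b')
  have b3 : ∀ M, GaussBound p 1 1 1 M (ex (hypF a' b')⁻¹) := by
    intro M m _
    rw [hex, coeff_expand]
    split_ifs
    · simpa using b2 _ (m / p) le_rfl
    · simp
  refine coeff_mul_padicNorm_le (padicNorm.nonneg _) (fun m hm => ?_)
    fun m _ => h.padicNorm_coeff_cross_le hp2 hN m
  simpa using (b1 n).mul zero_le_one zero_le_one zero_le_one (b3 n) m hm

/-- Frobenius structure of the mirror map: `U'(z ^ p) = U(z) ^ p E` with `E ≡ 1` modulo `p`. -/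
theorem IsDworkPair.exists_frobenius (hp2 : p ≠ 2) (hN : N.Coprime p)
    (h : IsDworkPair p N a b a' b' i₁ i₂) :
    ∃ E, expand p hp.out.ne_zero (hypU a' b') = hypU a b ^ p * E ∧
      ∀ n, padicNorm p (coeff n (E - 1)) ≤ padicNorm p p := by
  set Δ := expand p hp.out.ne_zero (hypD a' b') - p * hypD a b with hΔ
  have hp0 : (0 : ℚ) < p := by exact_mod_cast hp.out.pos
  have hp1 : (1 : ℚ) ≤ p := by exact_mod_cast hp.out.one_le
  have hD := constantCoeff_hypD a b
  have hpD : constantCoeff ((p : ℚ⟦X⟧) * hypD a b) = 0 := by simp [hD]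
  have hΔ0 : constantCoeff Δ = 0 := by
    rw [hΔ, map_sub, constantCoeff_expand, constantCoeff_hypD, hpD, sub_zero]
  refine ⟨expSeries Δ, ?_, fun n => ?_⟩
  · rw [hypU, hypU, expand_expSeries (constantCoeff_hypD a' b'), ← expSeries_nsmul hD,
      ← expSeries_add hpD hΔ0, hΔ, add_sub_cancel]
  · have h1 : GaussBound p 2 (padicNorm p p ^ 2) 1 n Δ := by
      intro m _
      rw [one_pow, mul_one]
      exact pow_le_pow_left₀ (padicNorm.nonneg _) (h.padicNorm_coeff_hypD_le hp2 hN m) 2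
    have h2 := h1.expSeries_sub_one hp2 hΔ0 (sq_nonneg _) (by
      rw [padicNorm.padicNorm_p_of_prime, sq, mul_assoc, inv_mul_cancel₀ hp0.ne', mul_one]
      exact inv_le_one_of_one_le₀ hp1) zero_le_one n le_rfl
    rw [one_pow, mul_one] at h2
    exact (pow_le_pow_iff_left₀ (padicNorm.nonneg _) (padicNorm.nonneg _) two_ne_zero).1 h2

/-- The coefficients of `G / F` grow at most logarithmically; only the bound
`|Dₙ|² ≤ p ^ (n - 1)` is needed. -/
theorem padicNorm_coeff_hypD_sq_le (hp2 : p ≠ 2) (hN : N.Coprime p) (n : ℕ) :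
    ∀ {a b : ℚ}, a ∈ fracSet N → b ∈ fracSet N →
      padicNorm p (coeff n (hypD a b)) ^ 2 ≤ padicNorm p p * (p : ℚ) ^ n := by
  have hp1 : (1 : ℚ) ≤ p := by exact_mod_cast hp.out.one_le
  have hp0 : (0 : ℚ) < p := by linarith
  induction n using Nat.strong_induction_on with
  | _ n ih =>
    intro a b ha hb
    have hpp := padicNorm.padicNorm_p_of_prime (p := p)
    rcases Nat.eq_zero_or_pos n with rfl | hn
    · rw [coeff_zero_eq_constantCoeff_apply, constantCoeff_hypD, padicNorm.zero, hpp]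
      positivity
    obtain ⟨a', b', i₁, i₂, h⟩ := exists_isDworkPair hN ha hb
    have h1 := h.padicNorm_coeff_hypD_le hp2 hN n
    obtain ⟨l, rfl⟩ : ∃ l, n = l + 1 := ⟨n - 1, by omega⟩
    have hrhs : padicNorm p p * (p : ℚ) ^ (l + 1) = (p : ℚ) ^ l := by
      rw [hpp, pow_succ]
      field_simp
    rw [hrhs]
    have h2 : ∀ t : ℚ, 1 ≤ t → padicNorm p (coeff (l + 1) (expand p hp.out.ne_zero (hypD a' b'))) * p
        ≤ t → padicNorm p (coeff (l + 1) (hypD a b)) ≤ t := by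
      intro t ht ht'
      have e : (p : ℚ) * coeff (l + 1) (hypD a b) =
          coeff (l + 1) (expand p hp.out.ne_zero (hypD a' b')) -
          coeff (l + 1) (expand p hp.out.ne_zero (hypD a' b') - (p : ℚ⟦X⟧) * hypD a b) := by
        rw [map_sub, ← nsmul_eq_mul p (hypD a b), map_nsmul, nsmul_eq_mul, sub_sub_cancel]
      have h3 := padicNorm_sub_le (t := t / p) ((le_div_iff₀ hp0).2 ht')
        (h1.trans (by rw [hpp, inv_eq_one_div]; gcongr))
      rw [← e, padicNorm.mul, hpp, inv_mul_eq_div] at h3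
      exact (div_le_div_iff_of_pos_right hp0).1 h3
    by_cases hd : p ∣ l + 1
    · obtain ⟨m, hm⟩ := hd
      have hm0 : m ≠ 0 := by rintro rfl; omega
      have hml : m < l + 1 := by
        rw [hm]
        exact lt_mul_of_one_lt_left (Nat.pos_of_ne_zero hm0) hp.out.one_lt
      have h3 := ih m hml h.a'_mem h.b'_mem
      rw [coeff_expand, if_pos ⟨m, hm⟩, hm, Nat.mul_div_cancel_left _ hp.out.pos] at h2
      have hp3 : 3 ≤ p := by
        have := hp.out.two_le
        omega
      have h4 : m + 1 ≤ l := by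
        have : 3 * m ≤ p * m := Nat.mul_le_mul_right _ hp3
        omega
      by_cases ht : 1 ≤ padicNorm p (coeff m (hypD a' b')) * p
      · have h5 := h2 _ ht le_rfl
        rw [hm]
        calc _ ≤ (padicNorm p (coeff m (hypD a' b')) * p) ^ 2 :=
              pow_le_pow_left₀ (padicNorm.nonneg _) h5 2
          _ ≤ (padicNorm p p * (p : ℚ) ^ m) * p ^ 2 := by
              rw [mul_pow]
              exact mul_le_mul_of_nonneg_right h3 (by positivity)
          _ = (p : ℚ) ^ (m + 1) := by
              rw [hpp, pow_succ _ m]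
              field_simp
          _ ≤ _ := pow_le_pow_right₀ hp1 h4
      · have h5 := h2 1 le_rfl (not_le.1 ht).le
        rw [hm]
        calc _ ≤ (1 : ℚ) := pow_le_one₀ (padicNorm.nonneg _) h5
          _ ≤ _ := one_le_pow₀ hp1
    · have h5 := h2 1 le_rfl (by
        rw [coeff_expand_of_not_dvd _ _ _ hd, padicNorm.zero, zero_mul]
        exact zero_le_one)
      calc _ ≤ (1 : ℚ) := pow_le_one₀ (padicNorm.nonneg _) h5
        _ ≤ _ := one_le_pow₀ hp1

theorem padicNorm_coeff_hypU_sq_le (hp2 : p ≠ 2) (hN : N.Coprime p) (ha : a ∈ fracSet N)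
    (hb : b ∈ fracSet N) (n : ℕ) :
    padicNorm p (coeff n (hypU a b - 1)) ^ 2 ≤ padicNorm p p * (p : ℚ) ^ n := by
  have hp0 : (0 : ℚ) < p := by exact_mod_cast hp.out.pos
  have hpp := padicNorm.padicNorm_p_of_prime (p := p)
  refine GaussBound.expSeries_sub_one (M := n) hp2 (constantCoeff_hypD a b) (padicNorm.nonneg _)
    (by rw [hpp, inv_mul_cancel₀ hp0.ne']) hp0.le (fun m _ => ?_) n le_rfl
  exact padicNorm_coeff_hypD_sq_le hp2 hN m ha hb

/-- The mirror map is `p`-integral if the Dwork primes of the parameters give the same mirror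
map. -/
theorem IsDworkPair.padicNorm_coeff_hypU_le_one (hp2 : p ≠ 2) (hN : N.Coprime p)
    (h : IsDworkPair p N a b a' b' i₁ i₂) (heq : hypU a' b' = hypU a b) (n : ℕ) :
    padicNorm p (coeff n (hypU a b)) ≤ 1 := by
  obtain ⟨E, hE, hE'⟩ := h.exists_frobenius hp2 hN
  rw [heq] at hE
  exact padicNorm_coeff_le_one_of_expand_eq (constantCoeff_hypU a b) hE hE' n

end Frobenius

/-! ### Low order coefficients of the mirror map -/

section LowOrder

theorem coeff_one_mul_eq (f g : ℚ⟦X⟧) :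
    coeff 1 (f * g) = coeff 0 f * coeff 1 g + coeff 1 f * coeff 0 g := by
  rw [coeff_mul, Finset.Nat.sum_antidiagonal_eq_sum_range_succ_mk]
  simp [Finset.sum_range_succ]

theorem coeff_two_mul_eq (f g : ℚ⟦X⟧) :
    coeff 2 (f * g) = coeff 0 f * coeff 2 g + coeff 1 f * coeff 1 g + coeff 2 f * coeff 0 g := by
  rw [coeff_mul, Finset.Nat.sum_antidiagonal_eq_sum_range_succ_mk]
  simp [Finset.sum_range_succ]

variable {a b : ℚ}

theorem coeff_one_hypD (ha : 0 < a) (hb : 0 < b) : coeff 1 (hypD a b) = a + b - 2 * (a * b) := by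
  have h1 := congrArg (coeff 1) (hypF_mul_hypD a b)
  have hD0 : coeff 0 (hypD a b) = 0 := by
    rw [coeff_zero_eq_constantCoeff_apply, constantCoeff_hypD]
  rw [coeff_one_mul_eq, hD0] at h1
  simp only [hypF, hypG, coeff_mk, hypA, hypB, harm, pochQuot, Finset.prod_range_one,
    Finset.sum_range_one, Finset.prod_range_zero] at h1
  rw [mul_one, one_mul, mul_zero, add_zero] at h1
  rw [h1]
  push_cast
  field_simp
  ring

theorem coeff_two_hypD (ha : 0 < a) (hb : 0 < b) :
    coeff 2 (hypD a b) = (a * (a + 1) * (b * (b + 1))) / 4 *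
      (1 / a + 1 / (a + 1) + (1 / b + 1 / (b + 1)) - 3) - a * b * coeff 1 (hypD a b) := by
  have h1 := congrArg (coeff 2) (hypF_mul_hypD a b)
  have hD0 : coeff 0 (hypD a b) = 0 := by
    rw [coeff_zero_eq_constantCoeff_apply, constantCoeff_hypD]
  rw [coeff_two_mul_eq, hD0] at h1
  simp only [hypF, hypG, coeff_mk, hypA, hypB, harm, pochQuot, Finset.prod_range_succ,
    Finset.sum_range_succ, Finset.prod_range_zero, Finset.sum_range_zero] at h1
  push_cast at h1
  have ha1 : a + 1 ≠ 0 := by positivity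
  have hb1 : b + 1 ≠ 0 := by positivity
  linear_combination h1

theorem coeff_one_hypU (ha : 0 < a) (hb : 0 < b) : coeff 1 (hypU a b) = a + b - 2 * (a * b) := by
  rw [hypU, expSeries, coeff_subst_eq_sum (constantCoeff_hypD a b), ← coeff_one_hypD ha hb]
  simp [Finset.sum_range_succ, coeff_exp, coeff_one]

/-- The first two coefficients of the mirror map determine `(1 - a - b)²`, the squared angle at
`z = 1`. -/
theorem coeff_two_hypU (ha : 0 < a) (hb : 0 < b) :
    16 * coeff 2 (hypU a b) - 13 * coeff 1 (hypU a b) ^ 2 - 2 * coeff 1 (hypU a b) =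
      2 * (a + b) - (a + b) ^ 2 := by
  have hD0 : coeff 0 (hypD a b) = 0 := by
    rw [coeff_zero_eq_constantCoeff_apply, constantCoeff_hypD]
  have h2 : coeff 2 (hypU a b) = coeff 2 (hypD a b) + coeff 1 (hypD a b) ^ 2 / 2 := by
    rw [hypU, expSeries, coeff_subst_eq_sum (constantCoeff_hypD a b)]
    simp only [Finset.sum_range_succ, Finset.sum_range_zero, pow_zero, pow_one, sq,
      coeff_two_mul_eq, hD0, coeff_exp, coeff_one, Nat.factorial]
    norm_num
    ring
  have ha1 : a + 1 ≠ 0 := by positivity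
  have hb1 : b + 1 ≠ 0 := by positivity
  rw [h2, coeff_two_hypD ha hb, coeff_one_hypU ha hb, coeff_one_hypD ha hb]
  field_simp
  ring

end LowOrder

/-! ### The hypergeometric differential equation -/

theorem theta_eq (f : ℚ⟦X⟧) : theta f = X * derivative ℚ f := rfl

theorem coeff_theta (n : ℕ) (f : ℚ⟦X⟧) : coeff n (theta f) = n * coeff n f := by
  cases n with
  | zero => simp [theta_eq]
  | succ n =>
    rw [theta_eq, coeff_succ_X_mul, coeff_derivative]
    push_cast
    ring

theorem constantCoeff_theta (f : ℚ⟦X⟧) : constantCoeff (theta f) = 0 := by simp [theta_eq]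

theorem theta_add (f g : ℚ⟦X⟧) : theta (f + g) = theta f + theta g := by
  simp only [theta_eq, map_add, mul_add]

theorem theta_sub (f g : ℚ⟦X⟧) : theta (f - g) = theta f - theta g := by
  simp only [theta_eq, map_sub, mul_sub]

theorem theta_mul (f g : ℚ⟦X⟧) : theta (f * g) = theta f * g + f * theta g := by
  simp only [theta_eq, Derivation.leibniz, smul_eq_mul]
  ring

theorem theta_C (r : ℚ) : theta (C r) = 0 := by simp [theta_eq]

theorem theta_one : theta 1 = 0 := by simp [theta_eq]

theorem theta_X : theta X = X := by simp [theta_eq]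

theorem pochQuot_succ_mul (x : ℚ) (n : ℕ) :
    (n + 1) * pochQuot x (n + 1) = (x + n) * pochQuot x n := by
  have : (n : ℚ) + 1 ≠ 0 := by positivity
  rw [pochQuot_succ]
  field_simp

theorem hypA_succ (a b : ℚ) (n : ℕ) :
    ((n : ℚ) + 1) ^ 2 * hypA a b (n + 1) = (a + n) * (b + n) * hypA a b n := by
  have h1 := pochQuot_succ_mul a n
  have h2 := pochQuot_succ_mul b n
  unfold hypA
  linear_combination ((n + 1) * pochQuot b (n + 1)) * h1 + ((a + n) * pochQuot a n) * h2

theorem hypF_ode (a b : ℚ) :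
    (1 - X) * theta (theta (hypF a b)) =
      X * (C (a + b) * theta (hypF a b) + C (a * b) * hypF a b) := by
  ext n
  rw [sub_mul, one_mul]
  cases n with
  | zero => simp [constantCoeff_theta]
  | succ n =>
    rw [map_sub, coeff_succ_X_mul, coeff_succ_X_mul, map_add, coeff_C_mul, coeff_C_mul,
      coeff_theta, coeff_theta, coeff_theta, coeff_theta, hypF, coeff_mk, coeff_mk]
    have := hypA_succ a b n
    push_cast
    linear_combination this

theorem hypG_ode (a b : ℚ) (ha : 0 < a) (hb : 0 < b) :
    (1 - X) * theta (theta (hypG a b)) =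
      X * (C (a + b) * theta (hypG a b) + C (a * b) * hypG a b) +
        (X * C (a + b) * hypF a b - C 2 * (1 - X) * theta (hypF a b)) := by
  ext n
  have e : C 2 * (1 - X) * theta (hypF a b) =
      C 2 * theta (hypF a b) - X * (C 2 * theta (hypF a b)) := by ring
  rw [e, sub_mul, one_mul, mul_assoc X]
  obtain ⟨s, hs⟩ : ∃ s, s = a + b := ⟨_, rfl⟩
  rw [← hs]
  cases n with
  | zero => simp [constantCoeff_theta]
  | succ n =>
    simp only [map_sub, map_add, coeff_succ_X_mul, coeff_C_mul, coeff_theta]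
    rw [hypF, hypG]
    simp only [coeff_mk]
    have h1 := hypA_succ a b n
    have hB : hypB a b (n + 1) = hypB a b n + (1 / (a + n) + 1 / (b + n) - 2 / (1 + n)) := by
      simp only [hypB, harm, Finset.sum_range_succ]
      ring
    have han : a + n ≠ 0 := by positivity
    have hbn : b + n ≠ 0 := by positivity
    have hn : (1 : ℚ) + n ≠ 0 := by positivity
    have h2 : (a + n) * (b + n) * (1 / (a + n) + 1 / (b + n) - 2 / (1 + n)) =
        (a + n) + (b + n) - 2 * (a + n) * (b + n) / (1 + n) := by
      field_simp
      ring
    have h3 : 2 * (a + n) * (b + n) / (1 + n) * hypA a b n = 2 * (n + 1) * hypA a b (n + 1) := by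
      field_simp
      linear_combination -h1
    rw [hB, hs]
    push_cast
    linear_combination (hypB a b n + (1 / (a + n) + 1 / (b + n) - 2 / (1 + n))) * h1 +
      hypA a b n * h2 - h3

/-- A solution of the (inhomogeneous) hypergeometric equation is determined by its constant
term. -/
theorem eq_of_hypergeometric_ode {s r : ℚ} {R Y Z : ℚ⟦X⟧}
    (hY : (1 - X) * theta (theta Y) = X * (C s * theta Y + C r * Y) + R)
    (hZ : (1 - X) * theta (theta Z) = X * (C s * theta Z + C r * Z) + R)
    (h0 : constantCoeff Y = constantCoeff Z) : Y = Z := by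
  rw [← sub_eq_zero]
  set E := Y - Z with hE
  have h : (1 - X) * theta (theta E) = X * (C s * theta E + C r * E) := by
    rw [hE, theta_sub, theta_sub]
    linear_combination hY - hZ
  ext n
  rw [map_zero]
  induction n with
  | zero => rw [coeff_zero_eq_constantCoeff_apply, hE, map_sub, h0, sub_self]
  | succ n ih =>
    have h1 := congrArg (coeff (n + 1)) h
    rw [sub_mul, one_mul, map_sub, coeff_succ_X_mul, coeff_succ_X_mul, map_add, coeff_C_mul,
      coeff_C_mul, coeff_theta, coeff_theta, coeff_theta, coeff_theta, ih] at h1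
    have hn : (n : ℚ) + 1 ≠ 0 := by positivity
    simpa [hn] using h1

/-! ### The reflection `(a, b) ↦ (1 - a, 1 - b)` -/

theorem hypF_comm (a b : ℚ) : hypF a b = hypF b a := by
  ext n
  simp only [hypF, coeff_mk, hypA]
  ring

theorem hypG_comm (a b : ℚ) : hypG a b = hypG b a := by
  ext n
  simp only [hypG, coeff_mk, hypA, hypB]
  ring

theorem hypU_comm (a b : ℚ) : hypU a b = hypU b a := by
  rw [hypU, hypU, hypD, hypD, hypF_comm, hypG_comm]

/-- The binomial series `(1 - z) ^ (-x)` satisfies a first order differential equation. -/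
theorem theta_binomial (x : ℚ) :
    (1 - X) * theta (mk (pochQuot x)) = X * (C x * mk (pochQuot x)) := by
  ext n
  rw [sub_mul, one_mul]
  cases n with
  | zero => simp [constantCoeff_theta]
  | succ n =>
    rw [map_sub, coeff_succ_X_mul, coeff_succ_X_mul, coeff_C_mul, coeff_theta, coeff_theta,
      coeff_mk, coeff_mk]
    have := pochQuot_succ_mul x n
    push_cast
    linear_combination this

theorem one_sub_X_ne_zero : (1 - X : ℚ⟦X⟧) ≠ 0 := by
  intro h
  have := congrArg constantCoeff h
  simp at this

/-- Euler's transformation: both Frobenius solutions for `(1 - a, 1 - b)` arise from those for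
`(a, b)` on multiplying by the same power of `1 - z`; hence the mirror maps agree. -/
theorem hypU_reflect {a b : ℚ} (ha : 0 < a) (ha' : a < 1) (hb : 0 < b) (hb' : b < 1) :
    hypU (1 - a) (1 - b) = hypU a b := by
  set P : ℚ⟦X⟧ := mk (pochQuot (1 - a - b)) with hP
  have hv := one_sub_X_ne_zero
  have h1 : (1 - X) * theta P = X * (C (1 - a - b) * P) := theta_binomial _
  have h2 : (1 - X) * theta (theta P) =
      X * theta P + X * (C (1 - a - b) * P) + X * (C (1 - a - b) * theta P) := by
    have := congrArg theta h1
    rw [theta_mul, theta_sub, theta_one, theta_X, theta_mul, theta_X, theta_mul, theta_C] at this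
    linear_combination this
  have hP0 : constantCoeff P = 1 := by
    rw [← coeff_zero_eq_constantCoeff_apply, hP, coeff_mk, pochQuot_zero]
  -- the product rule for the hypergeometric operator applied to `P Y`
  have key : ∀ Y R : ℚ⟦X⟧, (1 - X) * theta (theta Y) =
      X * (C (a + b) * theta Y + C (a * b) * Y) + R →
      (1 - X) * theta (theta (P * Y)) = X * (C (1 - a + (1 - b)) * theta (P * Y) +
        C ((1 - a) * (1 - b)) * (P * Y)) + P * R := by
    intro Y R hY
    apply mul_left_cancel₀ hv
    simp only [theta_mul, theta_add]
    simp only [map_add, map_sub, map_mul, map_one] at h1 h2 hY ⊢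
    linear_combination ((1 - X) * P) * hY + ((1 - X) * Y) * h2 +
      (2 * (1 - X) * theta Y - (2 - C a - C b) * X * Y + X * (1 - C a - C b) * Y + X * Y) * h1
  have hF : P * hypF a b = hypF (1 - a) (1 - b) := by
    refine eq_of_hypergeometric_ode (R := 0) ?_ (by rw [add_zero]; exact hypF_ode _ _)
      (by rw [map_mul, hP0, constantCoeff_hypF, constantCoeff_hypF, one_mul])
    simpa using key (hypF a b) 0 (by rw [add_zero]; exact hypF_ode a b)
  have hG : P * hypG a b = hypG (1 - a) (1 - b) := by
    refine eq_of_hypergeometric_ode (key _ _ (hypG_ode a b ha hb)) ?_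
      (by rw [map_mul, constantCoeff_hypG, constantCoeff_hypG, mul_zero])
    rw [hypG_ode (1 - a) (1 - b) (by linarith) (by linarith), ← hF, theta_mul]
    simp only [map_add, map_sub, map_mul, map_one] at h1 ⊢
    have hC2 : (C (2 : ℚ) : ℚ⟦X⟧) = 2 := map_ofNat _ 2
    rw [hC2]
    linear_combination (-2 * hypF a b) * h1
  have hD : hypD (1 - a) (1 - b) = hypD a b := by
    have e1 := hypF_mul_hypD (1 - a) (1 - b)
    have e2 := hypF_mul_hypD a b
    have hne : hypF (1 - a) (1 - b) ≠ 0 := by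
      intro h
      have := constantCoeff_hypF (1 - a) (1 - b)
      rw [h] at this
      simp at this
    apply mul_left_cancel₀ hne
    rw [e1, ← hG, ← e2, ← hF]
    ring
  rw [hypU, hypU, hD]

/-! ### The Halphen system in the coordinate `z` -/

/-- The Wronskian of the two Frobenius solutions, divided by that of `1` and `log z`. -/
noncomputable def hypW (a b : ℚ) : ℚ⟦X⟧ :=
  hypF a b ^ 2 + (hypF a b * theta (hypG a b) - hypG a b * theta (hypF a b))

/-- The logarithmic derivative of the Hauptmodul `z` with respect to `q`, as a series in `z`. -/
noncomputable def hypT (a b : ℚ) : ℚ⟦X⟧ := hypF a b ^ 2 * (hypW a b)⁻¹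

section Halphen

variable {a b : ℚ}

theorem constantCoeff_hypW (a b : ℚ) : constantCoeff (hypW a b) = 1 := by
  simp [hypW, constantCoeff_theta, constantCoeff_hypF, constantCoeff_hypG]

theorem hypW_mul_inv (a b : ℚ) : hypW a b * (hypW a b)⁻¹ = 1 :=
  PowerSeries.mul_inv_cancel _ (by rw [constantCoeff_hypW]; exact one_ne_zero)

theorem hypT_mul_hypW (a b : ℚ) : hypT a b * hypW a b = hypF a b ^ 2 := by
  rw [hypT, mul_assoc, mul_comm _ (hypW a b), hypW_mul_inv, mul_one]

theorem constantCoeff_hypT (a b : ℚ) : constantCoeff (hypT a b) = 1 := by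
  have := congrArg constantCoeff (hypT_mul_hypW a b)
  simpa [constantCoeff_hypW, constantCoeff_hypF] using this

theorem theta_hypW (ha : 0 < a) (hb : 0 < b) :
    (1 - X) * theta (hypW a b) = X * (C (a + b) * hypW a b) := by
  have h1 := hypF_ode a b
  have h2 := hypG_ode a b ha hb
  have hC2 : (C (2 : ℚ) : ℚ⟦X⟧) = 2 := map_ofNat _ 2
  rw [hC2] at h2
  rw [hypW, sq]
  simp only [theta_mul, theta_add, theta_sub]
  linear_combination hypF a b * h2 - hypG a b * h1

/-- The mirror map is inverse to the flow of `T`: `T θ (z U) = z U`. -/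
theorem hypT_mul_theta (a b : ℚ) :
    hypT a b * theta (X * hypU a b) = X * hypU a b := by
  have h1 : theta (hypU a b) = hypU a b * theta (hypD a b) := by
    rw [theta_eq, hypU, derivative_expSeries (constantCoeff_hypD a b), theta_eq]
    ring
  have h2 : hypF a b ^ 2 * (1 + theta (hypD a b)) = hypW a b := by
    have e := congrArg theta (hypF_mul_hypD a b)
    rw [theta_mul] at e
    rw [hypW]
    linear_combination hypF a b * e - theta (hypF a b) * hypF_mul_hypD a b
  have h3 : hypT a b * (1 + theta (hypD a b)) = 1 := by
    rw [hypT, mul_right_comm, h2, hypW_mul_inv]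
  rw [theta_mul, theta_X, h1]
  linear_combination (X * hypU a b) * h3

/-- The solution of the Halphen system as a triple of power series in `z`, for the derivation
`T z d/dz`, which is `q d/dq` in the coordinate `z`. -/
theorem exists_halphen_z (ha : 0 < a) (hb : 0 < b) (hb' : b < 1) :
    ∃ s₁ s₂ s₃ : ℚ⟦X⟧,
      (hypT a b * theta s₁ = (a - 1) • (s₁ * s₂ + s₁ * s₃ - s₂ * s₃) +
        (b + (1 - a) - 1) • s₁ ^ 2) ∧
      (hypT a b * theta s₂ = (b - 1) • (s₂ * s₁ + s₂ * s₃ - s₁ * s₃) +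
        (a + (1 - a) - 1) • s₂ ^ 2) ∧
      (hypT a b * theta s₃ = (1 - a - 1) • (s₃ * s₁ + s₃ * s₂ - s₁ * s₂) +
        (a + b - 1) • s₃ ^ 2) ∧
      constantCoeff s₁ = 0 ∧ constantCoeff s₂ = -1 ∧ constantCoeff s₃ = 0 ∧
      (s₃ - s₂) * X = s₃ - s₁ := by
  have hvi : (1 - X : ℚ⟦X⟧) * (1 - X)⁻¹ = 1 := PowerSeries.mul_inv_cancel _ (by simp)
  obtain ⟨ζ, hζ⟩ : ∃ ζ : ℚ⟦X⟧, ζ = X * (1 - X)⁻¹ := ⟨_, rfl⟩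
  obtain ⟨g, hg⟩ : ∃ g, g = theta (hypF a b) * (hypF a b)⁻¹ := ⟨_, rfl⟩
  set T := hypT a b with hT
  have hvζ : (1 - X) * ζ = X := by rw [hζ, mul_left_comm, hvi, mul_one]
  have hgF : g * hypF a b = theta (hypF a b) := by
    rw [hg, mul_assoc, mul_comm _ (hypF a b), hypF_mul_inv, mul_one]
  have hFne : hypF a b ≠ 0 := by
    intro h
    have := constantCoeff_hypF a b
    rw [h] at this
    simp at this
  have hWne : hypW a b ≠ 0 := by
    intro h
    have := constantCoeff_hypW a b
    rw [h] at this
    simp at this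
  have hv := one_sub_X_ne_zero
  have hθζ : theta ζ = ζ + ζ ^ 2 := by
    have := congrArg theta hvζ
    rw [theta_mul, theta_sub, theta_one, theta_X] at this
    apply mul_left_cancel₀ hv
    linear_combination this - (1 + ζ) * hvζ
  have hθg : theta g = ζ * (C (a + b) * g + C (a * b)) - g ^ 2 := by
    have e1 := congrArg theta hgF
    rw [theta_mul] at e1
    have e2 := hypF_ode a b
    apply mul_left_cancel₀ (mul_ne_zero hv hFne)
    linear_combination (1 - X) * e1 + e2 + ((1 - X) * g - X * C (a + b)) * hgF -
      (C (a + b) * g + C (a * b)) * hypF a b * hvζ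
  have hθT : theta T = T * (2 * g - C (a + b) * ζ) := by
    have e1 := congrArg theta (hypT_mul_hypW a b)
    rw [sq, theta_mul, theta_mul] at e1
    have e2 := theta_hypW (a := a) (b := b) ha hb
    have e3 := hypT_mul_hypW a b
    apply mul_left_cancel₀ (mul_ne_zero hv hWne)
    linear_combination (1 - X) * e1 - T * e2 - 2 * (1 - X) * hypF a b * hgF -
      2 * (1 - X) * g * e3 + C (a + b) * T * hypW a b * hvζ
  have hκ : (C (b - 1)⁻¹ : ℚ⟦X⟧) * (C b - 1) = 1 := by
    rw [← map_one C, ← map_sub, ← map_mul, inv_mul_cancel₀ (by linarith)]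
  set κ : ℚ⟦X⟧ := C (b - 1)⁻¹ with hκdef
  -- `s₁ = T (θ F / F - (a + b - 1) z / (1 - z)) / (b - 1)`, with `z / (1 - z)` denoted by `ζ`
  obtain ⟨h, hh⟩ : ∃ h, h = g - (C a + C b - 1) * ζ := ⟨_, rfl⟩
  have hθκ : theta κ = 0 := theta_C _
  have hθh : theta h = ζ * (C (a + b) * g + C (a * b)) - g ^ 2 -
      (C a + C b - 1) * (ζ + ζ ^ 2) := by
    rw [hh, theta_sub, theta_mul, theta_sub, theta_add, theta_C, theta_C, theta_one, hθg, hθζ]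
    ring
  have hθs : theta (κ * T * h) = κ * (theta T * h + T * theta h) := by
    rw [theta_mul, theta_mul, hθκ]; ring
  have main : T * theta (κ * T * h) =
      (C b - 1) * (κ * T * h) ^ 2 + (C a - 1) * T ^ 2 * ζ := by
    rw [hθs, hθT, hθh, hh]
    simp only [map_add, map_mul]
    linear_combination ((C a - 1) * T ^ 2 * ζ - κ * T ^ 2 * (g - (C a + C b - 1) * ζ) ^ 2) * hκ
  have hsT : 2 * (C b - 1) * (κ * T * h) = 2 * T * h := by linear_combination 2 * T * h * hκ
  refine ⟨κ * T * h, κ * T * h - T, κ * T * h + T * ζ, ?_, ?_, ?_, ?_, ?_, ?_, ?_⟩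
  · rw [main]
    simp only [smul_eq_C_mul, map_sub, map_add, map_one]
    ring
  · rw [theta_sub, mul_sub, main, hθT]
    generalize κ * T * h = s at *
    simp only [smul_eq_C_mul, map_sub, map_add, map_one]
    rw [hh] at hsT
    linear_combination T * hsT
  · rw [theta_add, mul_add, main, theta_mul, hθT, hθζ]
    generalize κ * T * h = s at *
    simp only [smul_eq_C_mul, map_sub, map_add, map_one]
    rw [hh] at hsT
    linear_combination (-T * ζ) * hsT
  · have hζ0 : constantCoeff ζ = 0 := by simp [hζ]
    have hg0 : constantCoeff g = 0 := by rw [hg, map_mul, constantCoeff_theta, zero_mul]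
    simp [hh, hζ0, hg0]
  · have hζ0 : constantCoeff ζ = 0 := by simp [hζ]
    have hg0 : constantCoeff g = 0 := by rw [hg, map_mul, constantCoeff_theta, zero_mul]
    simp [hh, hζ0, hg0, hT, constantCoeff_hypT]
  · have hζ0 : constantCoeff ζ = 0 := by simp [hζ]
    have hg0 : constantCoeff g = 0 := by rw [hg, map_mul, constantCoeff_theta, zero_mul]
    simp [hh, hζ0, hg0]
  · linear_combination (-T) * hvζ

end Halphen

/-! ### Unboundedness from a failure of the Frobenius congruences -/

/-- A bounded sequence exceeding `1` somewhere has an index at which `f n ^ (1 / n)` is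
maximal. -/
theorem exists_max_root {f : ℕ → ℚ} (hf : ∀ n, 0 ≤ f n) (h0 : f 0 ≤ 1) {B : ℚ}
    (hB : ∀ n, f n ≤ B) {n₁ : ℕ} (hn₁ : 1 < f n₁) :
    ∃ n₀ ≠ 0, ∀ n, f n ^ n₀ ≤ f n₀ ^ n := by
  have hn₁0 : n₁ ≠ 0 := by rintro rfl; linarith
  have hn₁pos : (0 : ℝ) < n₁ := by exact_mod_cast Nat.pos_of_ne_zero hn₁0
  set g : ℕ → ℝ := fun n => Real.log (f n) / n with hg
  have hL : 0 < g n₁ := div_pos (Real.log_pos (by exact_mod_cast hn₁)) hn₁pos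
  have hB1 : 1 < B := hn₁.trans_le (hB n₁)
  have hlogB : ∀ n, Real.log (f n) ≤ Real.log B := by
    intro n
    rcases (hf n).eq_or_lt with h | h
    · rw [← h]
      simpa using Real.log_nonneg (by exact_mod_cast hB1.le)
    · exact Real.log_le_log (by exact_mod_cast h) (by exact_mod_cast hB n)
  obtain ⟨M, hM⟩ := exists_nat_gt (Real.log B / g n₁)
  have hfar : ∀ n, M ≤ n → n ≠ 0 → g n ≤ g n₁ := by
    intro n hn hn0
    have hnpos : (0 : ℝ) < n := by exact_mod_cast Nat.pos_of_ne_zero hn0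
    have hMn : (M : ℝ) ≤ n := by exact_mod_cast hn
    rw [div_lt_iff₀ hL] at hM
    rw [hg]
    simp only
    rw [div_le_iff₀ hnpos]
    calc _ ≤ Real.log B := hlogB n
      _ ≤ M * g n₁ := hM.le
      _ ≤ n * g n₁ := mul_le_mul_of_nonneg_right hMn hL.le
      _ = _ := mul_comm _ _
  obtain ⟨n₀, hn₀, hmax⟩ := (Finset.Icc 1 (max M n₁)).exists_max_image g
    ⟨n₁, Finset.mem_Icc.2 ⟨Nat.pos_of_ne_zero hn₁0, le_max_right _ _⟩⟩
  have hn₀1 : 1 ≤ n₀ := (Finset.mem_Icc.1 hn₀).1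
  have h1 : g n₁ ≤ g n₀ :=
    hmax _ (Finset.mem_Icc.2 ⟨Nat.pos_of_ne_zero hn₁0, le_max_right _ _⟩)
  have hall : ∀ n ≠ 0, g n ≤ g n₀ := by
    intro n hn
    by_cases hle : n ≤ max M n₁
    · exact hmax _ (Finset.mem_Icc.2 ⟨Nat.pos_of_ne_zero hn, hle⟩)
    · exact (hfar n (by omega) hn).trans h1
  have hn₀pos : (0 : ℝ) < n₀ := by exact_mod_cast hn₀1
  have hf0 : 0 < f n₀ := by
    rcases (hf n₀).eq_or_lt with h | h
    · have : g n₀ = 0 := by simp [hg, ← h]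
      linarith
    · exact h
  refine ⟨n₀, by omega, fun n => ?_⟩
  rcases eq_or_ne n 0 with rfl | hn
  · simpa using pow_le_one₀ (hf 0) h0
  rcases (hf n).eq_or_lt with h | h
  · rw [← h, zero_pow (by omega)]
    positivity
  have hnpos : (0 : ℝ) < n := by exact_mod_cast Nat.pos_of_ne_zero hn
  have h2 := hall n hn
  simp only [hg] at h2
  rw [div_le_div_iff₀ hnpos hn₀pos] at h2
  have h3 : ((f n : ℝ)) ^ n₀ ≤ (f n₀ : ℝ) ^ n := by
    rw [← Real.log_le_log_iff (pow_pos (by exact_mod_cast h) _) (pow_pos (by exact_mod_cast hf0) _),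
      Real.log_pow, Real.log_pow]
    linarith
  exact_mod_cast h3

section Transfer

variable {p : ℕ} [hp : Fact p.Prime] {e M : ℕ} [NeZero e] {c : ℚ} {U z w : ℚ⟦X⟧}

theorem coeff_pow_of_mul_eq_X (hzw : z * w = X) (hw0 : constantCoeff w = 1) {m n : ℕ}
    (hmn : m ≤ n) : coeff n (z ^ m) = coeff (n - m) (w⁻¹ ^ m) := by
  have hz : z = X * w⁻¹ := by
    rw [← hzw, mul_assoc, PowerSeries.mul_inv_cancel _ (by rw [hw0]; exact one_ne_zero), mul_one]
  rw [hz, mul_pow, coeff_X_pow_mul', if_pos hmn]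

theorem constantCoeff_eq_zero_of_mul_eq_X (hzw : z * w = X) (hw0 : constantCoeff w = 1) :
    constantCoeff z = 0 := by
  have := congrArg constantCoeff hzw
  simpa [hw0] using this

/-- A Gauss bound for `w = U(z)` passes to `U`. -/
theorem GaussBound.of_subst (hzw : z * w = X) (hw : w = U.subst z)
    (hw0 : constantCoeff w = 1) (hc : 0 ≤ c) (h : GaussBound p e 1 c M w) :
    GaussBound p e 1 c M U := by
  have hinv := h.inv hc hw0
  have hpow := fun m => hinv.pow zero_le_one hc m
  intro n
  induction n using Nat.strong_induction_on with
  | _ n ih =>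
    intro hn
    have h1 := congrArg (coeff n) hw
    rw [coeff_subst_eq_sum (constantCoeff_eq_zero_of_mul_eq_X hzw hw0), Finset.sum_range_succ,
      coeff_pow_of_mul_eq_X hzw hw0 le_rfl, Nat.sub_self, coeff_zero_eq_constantCoeff_apply,
      map_pow, PowerSeries.constantCoeff_inv, hw0, inv_one, one_pow, mul_one] at h1
    have h2 : coeff n U = coeff n w + -∑ m ∈ Finset.range n, coeff m U * coeff n (z ^ m) := by
      rw [h1]; ring
    rw [h2]
    refine padicNorm_add_pow_le (h n hn) ?_
    rw [padicNorm.neg]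
    refine padicNorm_sum_pow_le (fun m hm => ?_) (by positivity)
    have hm' := Finset.mem_range.1 hm
    have h3 := ih m hm' (by omega)
    have h4 := hpow m (n - m) (by omega)
    rw [one_pow, one_mul] at h4
    rw [coeff_pow_of_mul_eq_X hzw hw0 hm'.le, padicNorm.mul, mul_pow]
    calc _ ≤ (1 * c ^ m) * c ^ (n - m) :=
          mul_le_mul h3 h4 (pow_nonneg (padicNorm.nonneg _) _) (by positivity)
      _ = 1 * c ^ n := by rw [mul_assoc, ← pow_add, Nat.add_sub_cancel' hm'.le]

/-- A strict Gauss bound for `U - 1` passes to `w = U(z)`. -/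
theorem StrictGaussBound.subst (hzw : z * w = X) (hw : w = U.subst z)
    (hw0 : constantCoeff w = 1) (hc : 0 < c) (h : GaussBound p e 1 c M w)
    (hU : StrictGaussBound p e c M (U - 1)) {n : ℕ} (hn0 : n ≠ 0) (hn : n ≤ M) :
    padicNorm p (coeff n w) ^ e < c ^ n := by
  have hinv := h.inv hc.le hw0
  have hpow := fun m => hinv.pow zero_le_one hc.le m
  have h1 := congrArg (coeff n) hw
  rw [coeff_subst_eq_sum (constantCoeff_eq_zero_of_mul_eq_X hzw hw0)] at h1
  rw [h1]
  refine padicNorm_sum_pow_lt (fun m hm => ?_) (by positivity)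
  have hm' : m ≤ n := by simpa [Nat.lt_succ_iff] using hm
  rcases eq_or_ne m 0 with rfl | hm0
  · rw [pow_zero, coeff_one, if_neg hn0, mul_zero, padicNorm.zero, zero_pow (NeZero.ne e)]
    positivity
  have h3 := hU m (by omega)
  rw [map_sub, coeff_one, if_neg hm0, sub_zero] at h3
  have h4 := hpow m (n - m) (by omega)
  rw [one_pow, one_mul] at h4
  rw [coeff_pow_of_mul_eq_X hzw hw0 hm', padicNorm.mul, mul_pow]
  calc _ ≤ padicNorm p (coeff m U) ^ e * c ^ (n - m) :=
        mul_le_mul_of_nonneg_left h4 (pow_nonneg (padicNorm.nonneg _) _)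
    _ < c ^ m * c ^ (n - m) := mul_lt_mul_of_pos_right h3 (by positivity)
    _ = c ^ n := by rw [← pow_add, Nat.add_sub_cancel' hm']

end Transfer

section Unbounded

variable {p : ℕ} [hp : Fact p.Prime] {N : ℕ} {a b a' b' : ℚ} {i₁ i₂ : ℕ} {z w : ℚ⟦X⟧}

theorem constantCoeff_subst_hypU (hz : constantCoeff z = 0) :
    constantCoeff ((hypU a b).subst z) = 1 := by
  rw [← coeff_zero_eq_constantCoeff_apply ((hypU a b).subst z), coeff_subst_eq_sum hz,
    Finset.sum_range_one, pow_zero, coeff_zero_eq_constantCoeff_apply, constantCoeff_hypU]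
  simp

/-- If `q / z(q)` has bounded denominators at `p`, its first coefficients are `p`-integral. On
the largest disc on which `q / z(q)` satisfies a Gauss bound, that bound would otherwise be
attained, which the Frobenius structure forbids. -/
theorem IsDworkPair.gaussBound_of_bounded (hp2 : p ≠ 2) (hN : N.Coprime p)
    (h : IsDworkPair p N a b a' b' i₁ i₂) (hz0 : constantCoeff z = 0)
    (hz : z * (hypU a b).subst z = X) {K : ℚ} (hK : K ≠ 0)
    (hbd : ∀ n, padicNorm p (K * coeff n ((hypU a b).subst z)) ≤ 1) :
    GaussBound p 1 1 1 (p * 2) (hypU a b) := by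
  obtain ⟨w, hw⟩ : ∃ w, w = (hypU a b).subst z := ⟨_, rfl⟩
  rw [← hw] at hz hbd
  have hw0 : constantCoeff w = 1 := by rw [hw]; exact constantCoeff_subst_hypU hz0
  refine GaussBound.of_subst hz hw hw0 zero_le_one ?_
  by_contra hcon
  unfold GaussBound at hcon
  push Not at hcon
  obtain ⟨n₁, hn₁, hlt⟩ := hcon
  rw [one_pow, mul_one, pow_one] at hlt
  have hKpos : 0 < padicNorm p K := lt_of_le_of_ne (padicNorm.nonneg _) (padicNorm.nonzero hK).symm
  obtain ⟨n₀, hn₀, hmax⟩ := exists_max_root (f := fun n => padicNorm p (coeff n w))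
    (fun n => padicNorm.nonneg _) (by simp [hw0]) (B := (padicNorm p K)⁻¹) (fun n => by
      have := hbd n
      rw [padicNorm.mul] at this
      rw [inv_eq_one_div, le_div_iff₀ hKpos]
      linarith) hlt
  have : NeZero n₀ := ⟨hn₀⟩
  set c := padicNorm p (coeff n₀ w) with hc
  have hp1 : (1 : ℚ) < p := by exact_mod_cast hp.out.one_lt
  have hpn : (1 : ℚ) < (p : ℚ) ^ n₀ := one_lt_pow₀ hp1 hn₀
  have hcn₁ : (p : ℚ) ^ n₀ ≤ c ^ n₁ :=
    (pow_le_pow_left₀ (by linarith) (one_lt_padicNorm hlt) n₀).trans (hmax n₁)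
  have hc1 : 1 < c := by
    by_contra hle
    have := pow_le_one₀ (n := n₁) (padicNorm.nonneg (p := p) (coeff n₀ w)) (not_lt.1 hle)
    linarith
  have hc0 : 0 < c := by linarith
  have hc2p : (p : ℚ) ^ n₀ ≤ c ^ (2 * p) :=
    hcn₁.trans (pow_le_pow_right₀ hc1.le (by omega))
  have hwb : ∀ M, GaussBound p n₀ 1 c M w := fun M n _ => by
    rw [one_mul]; exact hmax n
  obtain ⟨E, hE, hE'⟩ := h.exists_frobenius hp2 hN
  have hstrict := strictGaussBound_of_expand_eq (n₀ := n₀) hc1.le hE hE'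
    ((hwb _).of_subst hz hw hw0 hc0.le) fun m _ => by
      rcases Nat.eq_zero_or_pos m with rfl | hm
      · simp [constantCoeff_hypU, hn₀]
      obtain ⟨l, rfl⟩ : ∃ l, m = l + 1 := ⟨m - 1, by omega⟩
      have h1 := padicNorm_coeff_hypU_sq_le hp2 hN h.a'_mem h.b'_mem (l + 1)
      have h2 : padicNorm p p * (p : ℚ) ^ (l + 1) = (p : ℚ) ^ l := by
        rw [padicNorm.padicNorm_p_of_prime, pow_succ]
        field_simp
      rw [h2] at h1
      refine lt_of_pow_lt_pow_left₀ 2 (by positivity) ?_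
      calc _ = (padicNorm p (coeff (l + 1) (hypU a' b' - 1)) ^ 2) ^ n₀ := by
              rw [← pow_mul, ← pow_mul, mul_comm]
        _ ≤ ((p : ℚ) ^ l) ^ n₀ := pow_le_pow_left₀ (sq_nonneg _) h1 n₀
        _ = ((p : ℚ) ^ n₀) ^ l := by rw [← pow_mul, ← pow_mul, mul_comm]
        _ ≤ (c ^ (2 * p)) ^ l := pow_le_pow_left₀ (by positivity) hc2p l
        _ < (c ^ (2 * p)) ^ (l + 1) :=
            pow_lt_pow_right₀ (one_lt_pow₀ hc1 (by have := hp.out.pos; omega)) (Nat.lt_succ_self l)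
        _ = _ := by rw [← pow_mul, ← pow_mul]; ring_nf
  exact lt_irrefl _ (StrictGaussBound.subst hz hw hw0 hc0 (hwb _) hstrict hn₀ le_rfl)

/-- If `U` is `p`-integral, so is `q / z(q)`. -/
theorem padicNorm_coeff_subst_le_one (hz0 : constantCoeff z = 0)
    (hz : z * (hypU a b).subst z = X) (hU : ∀ n, padicNorm p (coeff n (hypU a b)) ≤ 1) (n : ℕ) :
    padicNorm p (coeff n ((hypU a b).subst z)) ≤ 1 := by
  obtain ⟨w, hw⟩ : ∃ w, w = (hypU a b).subst z := ⟨_, rfl⟩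
  rw [← hw] at hz ⊢
  have hw0 : constantCoeff w = 1 := by rw [hw]; exact constantCoeff_subst_hypU hz0
  induction n using Nat.strong_induction_on with
  | _ n ih =>
    rcases Nat.eq_zero_or_pos n with rfl | hn
    · simp [hw0]
    -- the coefficients of `w` up to order `n - 1` determine `z` up to order `n`
    have hinv : GaussBound p 1 1 1 (n - 1) w⁻¹ :=
      GaussBound.inv zero_le_one (fun m hm => by simpa using ih m (by omega)) hw0
    rw [hw, coeff_subst_eq_sum hz0]
    refine padicNorm.sum_le' (fun m hm => padicNorm_mul_le_one (hU m) ?_) zero_le_one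
    have hm' : m ≤ n := by simpa [Nat.lt_succ_iff] using hm
    rcases Nat.eq_zero_or_pos m with rfl | hm0
    · rw [pow_zero, coeff_one]
      split_ifs <;> simp
    rw [coeff_pow_of_mul_eq_X hz hw0 hm']
    simpa using hinv.pow zero_le_one zero_le_one m (n - m) (by omega)

end Unbounded

/-! ### Solutions of the Halphen system -/

/-- The mirror map `z U(z)` has a compositional inverse `z(q)`. -/
theorem exists_mirror_inverse (a b : ℚ) :
    ∃ z : ℚ⟦X⟧, constantCoeff z = 0 ∧ z * (hypU a b).subst z = X := by
  have h0 : constantCoeff (X * hypU a b) = 0 := by simp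
  have h1 : coeff 1 (X * hypU a b) = 1 := by
    rw [show (1 : ℕ) = 0 + 1 from rfl, coeff_succ_X_mul, coeff_zero_eq_constantCoeff_apply,
      constantCoeff_hypU]
  have hu : IsUnit (coeff 1 (X * hypU a b)) := by rw [h1]; exact isUnit_one
  have hs := HasSubst.substInvOfIsUnit (X * hypU a b) hu
  refine ⟨substInvOfIsUnit (X * hypU a b) hu, constantCoeff_substInvOfIsUnit _ hu, ?_⟩
  have := subst_substInvOfIsUnit_right (X * hypU a b) h0 hu
  rwa [subst_mul hs, subst_X hs] at this

section Halphen

variable {a b : ℚ} {z : ℚ⟦X⟧}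

/-- In the coordinate `z`, the derivation `q d/dq` becomes `T z d/dz`. -/
theorem theta_subst (hz0 : constantCoeff z = 0) (hz : z * (hypU a b).subst z = X) (f : ℚ⟦X⟧) :
    theta (f.subst z) = (hypT a b * theta f).subst z := by
  have hs : HasSubst z := HasSubst.of_constantCoeff_zero' hz0
  set Q : ℚ⟦X⟧ := X * hypU a b with hQ
  have hQz : Q.subst z = X := by rw [hQ, subst_mul hs, subst_X hs, hz]
  have h1 := congrArg (derivative ℚ) hQz
  rw [derivative_subst hs, derivative_X] at h1
  have h2 := congrArg (subst z) (hypT_mul_theta a b)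
  rw [← hQ, hQz, theta_eq, subst_mul hs, subst_mul hs, subst_X hs] at h2
  have hne : (derivative ℚ Q).subst z ≠ 0 := left_ne_zero_of_mul_eq_one h1
  have h3 : X * derivative ℚ z = z * (hypT a b).subst z := by
    apply mul_left_cancel₀ hne
    linear_combination X * h1 - h2
  rw [theta_eq, derivative_subst hs, theta_eq, subst_mul hs, subst_mul hs, subst_X hs]
  linear_combination (derivative ℚ f).subst z * h3

/-- The Halphen system has a solution with `J = 1 / z(q)`. -/
theorem exists_halphen (ha : 0 < a) (hb : 0 < b) (hb' : b < 1) (hz0 : constantCoeff z = 0)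
    (hz : z * (hypU a b).subst z = X) :
    ∃ t₁ t₂ t₃, HalphenSystem a b (1 - a) t₁ t₂ t₃ ∧ coeff 0 t₁ = 0 ∧ coeff 0 t₂ = -1 ∧
      coeff 0 t₃ = 0 ∧ (t₃ - t₂) * X = (hypU a b).subst z * (t₃ - t₁) := by
  obtain ⟨s₁, s₂, s₃, e₁, e₂, e₃, c₁, c₂, c₃, e₄⟩ := exists_halphen_z ha hb hb'
  have hs : HasSubst z := HasSubst.of_constantCoeff_zero' hz0
  have hconst : ∀ f : ℚ⟦X⟧, coeff 0 (f.subst z) = constantCoeff f := by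
    intro f
    rw [coeff_subst_eq_sum hz0]
    simp
  have hσ : ∀ f : ℚ⟦X⟧, f.subst z = substAlgHom (R := ℚ) hs f := fun f => by
    rw [coe_substAlgHom]
  refine ⟨s₁.subst z, s₂.subst z, s₃.subst z, ⟨?_, ?_, ?_⟩, by rw [hconst, c₁],
    by rw [hconst, c₂], by rw [hconst, c₃], ?_⟩
  · rw [theta_subst hz0 hz, e₁]
    simp only [hσ, map_add, map_sub, map_mul, map_smul, map_pow]
  · rw [theta_subst hz0 hz, e₂]
    simp only [hσ, map_add, map_sub, map_mul, map_smul, map_pow]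
  · rw [theta_subst hz0 hz, e₃]
    simp only [hσ, map_add, map_sub, map_mul, map_smul, map_pow]
  · have h := congrArg (subst z) e₄
    rw [subst_mul hs, subst_sub hs, subst_sub hs, subst_X hs] at h
    linear_combination (hypU a b).subst z * h - (s₃.subst z - s₂.subst z) * hz

theorem theta_rescale (r : ℚ) (f : ℚ⟦X⟧) : theta (rescale r f) = rescale r (theta f) := by
  ext n
  rw [coeff_theta, coeff_rescale, coeff_rescale, coeff_theta]
  ring

theorem rescale_C (r x : ℚ) : rescale r (C x) = C x := by
  ext n
  rw [coeff_rescale, coeff_C]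
  split_ifs with h <;> simp [h]

theorem HalphenSystem.rescale {c : ℚ} {t₁ t₂ t₃ : ℚ⟦X⟧} (h : HalphenSystem a b c t₁ t₂ t₃)
    (r : ℚ) : HalphenSystem a b c (rescale r t₁) (rescale r t₂) (rescale r t₃) := by
  obtain ⟨h₁, h₂, h₃⟩ := h
  refine ⟨?_, ?_, ?_⟩
  · rw [theta_rescale, h₁]
    simp only [smul_eq_C_mul, map_add, map_mul, map_sub, map_pow, rescale_C]
  · rw [theta_rescale, h₂]
    simp only [smul_eq_C_mul, map_add, map_mul, map_sub, map_pow, rescale_C]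
  · rw [theta_rescale, h₃]
    simp only [smul_eq_C_mul, map_add, map_mul, map_sub, map_pow, rescale_C]

/-- The solutions in every scale `r` of `q`. -/
theorem exists_halphen_scaled (ha : 0 < a) (hb : 0 < b) (hb' : b < 1) (hz0 : constantCoeff z = 0)
    (hz : z * (hypU a b).subst z = X) (r : ℚ) :
    ∃ t₁ t₂ t₃, HalphenSystem a b (1 - a) t₁ t₂ t₃ ∧ coeff 0 t₁ = 0 ∧ coeff 0 t₂ = -1 ∧
      coeff 0 t₃ = 0 ∧ coeff 1 (t₁ - t₃) = -r ∧
      (t₃ - t₂) * (C r * X) = rescale r ((hypU a b).subst z) * (t₃ - t₁) := by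
  obtain ⟨t₁, t₂, t₃, h, c₁, c₂, c₃, e⟩ := exists_halphen ha hb hb' hz0 hz
  refine ⟨rescale r t₁, rescale r t₂, rescale r t₃, h.rescale r, by rw [coeff_rescale, c₁]; simp,
    by rw [coeff_rescale, c₂]; simp, by rw [coeff_rescale, c₃]; simp, ?_, ?_⟩
  · have h1 := congrArg (coeff 1) e
    have hw0 := constantCoeff_subst_hypU (a := a) (b := b) hz0
    rw [coeff_one_mul_eq, coeff_one_mul_eq] at h1
    simp only [map_sub, c₁, c₂, c₃] at h1
    rw [coeff_zero_eq_constantCoeff_apply ((hypU a b).subst z), hw0] at h1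
    simp at h1
    rw [map_sub, coeff_rescale, coeff_rescale]
    linear_combination r * h1
  · have h1 := congrArg (rescale r) e
    rwa [map_mul, map_mul, map_sub, map_sub, rescale_X] at h1

theorem coeff_mul_of_X_pow_dvd {d f : ℚ⟦X⟧} {n : ℕ} (h : X ^ n ∣ d) :
    coeff n (d * f) = coeff n d * coeff 0 f := by
  obtain ⟨k, rfl⟩ := h
  rw [mul_assoc, coeff_X_pow_mul', coeff_X_pow_mul', if_pos le_rfl, if_pos le_rfl, Nat.sub_self]
  simp

theorem coeff_mul_sub_mul {f g f' g' : ℚ⟦X⟧} {n : ℕ} (hf : X ^ n ∣ f - f') (hg : X ^ n ∣ g - g') :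
    coeff n (f * g - f' * g') =
      coeff n (f - f') * coeff 0 g + coeff n (g - g') * coeff 0 f' := by
  have : f * g - f' * g' = (f - f') * g + (g - g') * f' := by ring
  rw [this, map_add, coeff_mul_of_X_pow_dvd hf, coeff_mul_of_X_pow_dvd hg]

/-- A solution of the Halphen system with initial values `(0, -1, 0)` is determined by the
coefficient of `q` in `t₁ - t₃`. -/
theorem HalphenSystem.unique {t₁ t₂ t₃ s₁ s₂ s₃ : ℚ⟦X⟧}
    (ht : HalphenSystem a b (1 - a) t₁ t₂ t₃) (hs : HalphenSystem a b (1 - a) s₁ s₂ s₃)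
    (ht₁ : coeff 0 t₁ = 0) (ht₂ : coeff 0 t₂ = -1) (ht₃ : coeff 0 t₃ = 0)
    (hs₁ : coeff 0 s₁ = 0) (hs₂ : coeff 0 s₂ = -1) (hs₃ : coeff 0 s₃ = 0)
    (h1 : coeff 1 (t₁ - t₃) = coeff 1 (s₁ - s₃)) : t₁ = s₁ ∧ t₂ = s₂ ∧ t₃ = s₃ := by
  have key : ∀ n, coeff n t₁ = coeff n s₁ ∧ coeff n t₂ = coeff n s₂ ∧ coeff n t₃ = coeff n s₃ := by
    intro n
    induction n using Nat.strong_induction_on with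
    | _ n ih =>
      rcases Nat.eq_zero_or_pos n with rfl | hn
      · rw [ht₁, ht₂, ht₃, hs₁, hs₂, hs₃]
        exact ⟨rfl, rfl, rfl⟩
      have d₁ : X ^ n ∣ t₁ - s₁ := X_pow_dvd_iff.2 fun m hm => by
        rw [map_sub, (ih m hm).1, sub_self]
      have d₂ : X ^ n ∣ t₂ - s₂ := X_pow_dvd_iff.2 fun m hm => by
        rw [map_sub, (ih m hm).2.1, sub_self]
      have d₃ : X ^ n ∣ t₃ - s₃ := X_pow_dvd_iff.2 fun m hm => by
        rw [map_sub, (ih m hm).2.2, sub_self]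
      have p₁₁ := coeff_mul_sub_mul d₁ d₁
      have p₂₂ := coeff_mul_sub_mul d₂ d₂
      have p₃₃ := coeff_mul_sub_mul d₃ d₃
      have p₁₂ := coeff_mul_sub_mul d₁ d₂
      have p₁₃ := coeff_mul_sub_mul d₁ d₃
      have p₂₃ := coeff_mul_sub_mul d₂ d₃
      simp only [map_sub, ht₁, ht₂, ht₃, hs₁, hs₂, hs₃] at p₁₁ p₂₂ p₃₃ p₁₂ p₁₃ p₂₃
      have q₁ := congrArg (coeff n) ht.1
      have q₂ := congrArg (coeff n) ht.2.1
      have q₃ := congrArg (coeff n) ht.2.2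
      have r₁ := congrArg (coeff n) hs.1
      have r₂ := congrArg (coeff n) hs.2.1
      have r₃ := congrArg (coeff n) hs.2.2
      simp only [coeff_theta, map_add, map_sub, map_smul, smul_eq_mul, sq] at q₁ q₂ q₃ r₁ r₂ r₃
      rw [mul_comm t₂ t₁] at q₂
      rw [mul_comm t₃ t₁, mul_comm t₃ t₂] at q₃
      rw [mul_comm s₂ s₁] at r₂
      rw [mul_comm s₃ s₁, mul_comm s₃ s₂] at r₃
      set x := coeff n t₁ - coeff n s₁ with hx
      set y := coeff n t₂ - coeff n s₂ with hy
      set u := coeff n t₃ - coeff n s₃ with hu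
      have E₁ : n * x = (a - 1) * (u - x) := by
        rw [hx]
        linear_combination q₁ - r₁ + (a - 1) * (p₁₂ + p₁₃ - p₂₃) + (b + (1 - a) - 1) * p₁₁
      have E₃ : n * u = a * (u - x) := by
        rw [hu]
        linear_combination q₃ - r₃ + (1 - a - 1) * (p₁₃ + p₂₃ - p₁₂) + (a + b - 1) * p₃₃
      have E₂ : n * y = (1 - b) * (x + u) := by
        rw [hy]
        linear_combination q₂ - r₂ + (b - 1) * (p₁₂ + p₂₃ - p₁₃) + (a + (1 - a) - 1) * p₂₂
      have hn0 : (n : ℚ) ≠ 0 := by exact_mod_cast hn.ne'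
      have hxu : x = u := by
        rcases eq_or_ne n 1 with rfl | hn1
        · rw [map_sub, map_sub] at h1
          rw [hx, hu]
          linear_combination h1
        · have h2 : ((n : ℚ) - 1) * (x - u) = 0 := by linear_combination E₁ - E₃
          have h3 : (n : ℚ) - 1 ≠ 0 := by
            rw [sub_ne_zero]
            exact_mod_cast hn1
          exact sub_eq_zero.1 ((mul_eq_zero.1 h2).resolve_left h3)
      rw [hxu, sub_self, mul_zero] at E₁ E₃
      have hu0 : u = 0 := (mul_eq_zero.1 E₁).resolve_left hn0
      rw [hxu, hu0, add_zero, mul_zero] at E₂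
      have hy0 : y = 0 := (mul_eq_zero.1 E₂).resolve_left hn0
      rw [hu0] at hxu
      exact ⟨sub_eq_zero.1 hxu, sub_eq_zero.1 hy0, sub_eq_zero.1 hu0⟩
  exact ⟨PowerSeries.ext fun n => (key n).1, PowerSeries.ext fun n => (key n).2.1,
    PowerSeries.ext fun n => (key n).2.2⟩

/-- The coefficient of `q` in `t₂` is a fixed multiple of that in `t₁ - t₃`. -/
theorem HalphenSystem.coeff_one {t₁ t₂ t₃ : ℚ⟦X⟧} (ht : HalphenSystem a b (1 - a) t₁ t₂ t₃)
    (ht₁ : coeff 0 t₁ = 0) (ht₂ : coeff 0 t₂ = -1) (ht₃ : coeff 0 t₃ = 0) :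
    coeff 1 t₂ = (1 - b) * (1 - 2 * a) * coeff 1 (t₁ - t₃) := by
  have q₁ := congrArg (coeff 1) ht.1
  have q₂ := congrArg (coeff 1) ht.2.1
  have q₃ := congrArg (coeff 1) ht.2.2
  simp only [coeff_theta, map_add, map_sub, map_smul, smul_eq_mul, sq, coeff_one_mul_eq, ht₁, ht₂,
    ht₃, Nat.cast_one, one_mul] at q₁ q₂ q₃
  rw [map_sub]
  linear_combination q₂ + (1 - b) * (q₁ + q₃)

theorem halphenSystem_const : HalphenSystem a b (1 - a) 0 (-1) 0 := by
  refine ⟨?_, ?_, ?_⟩ <;> simp [theta_eq]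

end Halphen

/-! ### Parameters fixed by the Dwork prime -/

section Parameters

variable {p : ℕ} [hp : Fact p.Prime] {N : ℕ} {a b a' b' : ℚ} {i j : ℕ} {z : ℚ⟦X⟧}

theorem eq_zero_of_padicNorm_le {D : ℕ} (hD : D.Coprime p) {x : ℚ} {k : ℤ} (hk : (D : ℚ) * x = k)
    (hlt : |k| < p) (hx : padicNorm p x ≤ padicNorm p p) : x = 0 := by
  have hD0 : (D : ℚ) ≠ 0 := by
    rintro h
    rw [Nat.cast_eq_zero] at h
    subst h
    exact hp.out.one_lt.ne' (by simpa using hD)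
  have h1 : padicNorm p (k : ℚ) < 1 := by
    rw [← hk, padicNorm.mul, padicNorm_natCast_eq_one_of_coprime hD, one_mul]
    exact hx.trans_lt padicNorm_prime_lt_one
  have h2 : k = 0 := Int.eq_zero_of_abs_lt_dvd (padicNorm.int_lt_one_iff k |>.1 h1) hlt
  rw [h2, Int.cast_zero] at hk
  exact (mul_eq_zero.1 hk).resolve_left hD0

/-- Boundedness at a large prime `p` forces the Dwork prime of `{a, b}` to be `{a, b}` or
`{1 - a, 1 - b}`: the first two coefficients of the mirror maps agree modulo `p`, hence they
agree. -/
theorem IsDworkPair.sum_mul_eq_of_bounded (hp2 : p ≠ 2) (hN : N.Coprime p) (hpN : N ^ 2 < p)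
    (h : IsDworkPair p N a b a' b' i j) (hz0 : constantCoeff z = 0)
    (hz : z * (hypU a b).subst z = X)
    (hbd : ∃ K : ℚ, K ≠ 0 ∧ ∀ n : ℕ, padicNorm p (K * coeff n ((hypU a b).subst z)) ≤ 1) :
    (a' + b' = a + b ∧ a' * b' = a * b) ∨
      (a' + b' = 2 - (a + b) ∧ a' * b' = (1 - a) * (1 - b)) := by
  obtain ⟨K, hK, hbd⟩ := hbd
  have hg := h.gaussBound_of_bounded hp2 hN hz0 hz hK hbd
  obtain ⟨E, hE, hE'⟩ := h.exists_frobenius hp2 hN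
  have c₁ := padicNorm_coeff_sub_le_of_expand_eq (m := 1) hE hE' fun n hn => hg n (by omega)
  have c₂ := padicNorm_coeff_sub_le_of_expand_eq (m := 2) hE hE' hg
  obtain ⟨ha0, ha1, k, hk⟩ := h.a_mem
  obtain ⟨hb0, hb1, l, hl⟩ := h.b_mem
  obtain ⟨ha0', ha1', k', hk'⟩ := h.a'_mem
  obtain ⟨hb0', hb1', l', hl'⟩ := h.b'_mem
  have e₁ := coeff_one_hypU ha0 hb0
  have e₁' := coeff_one_hypU ha0' hb0'
  have e₂ := coeff_two_hypU ha0 hb0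
  have e₂' := coeff_two_hypU ha0' hb0'
  obtain ⟨x, hx⟩ : ∃ x, x = coeff 1 (hypU a b) := ⟨_, rfl⟩
  obtain ⟨x', hx'⟩ : ∃ x, x = coeff 1 (hypU a' b') := ⟨_, rfl⟩
  obtain ⟨y, hy⟩ : ∃ x, x = coeff 2 (hypU a b) := ⟨_, rfl⟩
  obtain ⟨y', hy'⟩ : ∃ x, x = coeff 2 (hypU a' b') := ⟨_, rfl⟩
  rw [← hx] at c₁ e₁ e₂
  rw [← hx'] at c₁ e₁' e₂'
  rw [← hy] at c₂ e₂
  rw [← hy'] at c₂ e₂'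
  have hNp : (N ^ 2 : ℚ) < p := by exact_mod_cast hpN
  have hN2 : (N ^ 2).Coprime p := hN.pow_left 2
  have hN2' : (0 : ℚ) ≤ N ^ 2 := by positivity
  -- the two congruences, and the sizes of the quantities that they compare
  have small : ∀ {d : ℚ} {m : ℤ}, (N : ℚ) ^ 2 * d = m → |d| ≤ 1 →
      padicNorm p d ≤ padicNorm p p → d = 0 := by
    intro d m hm hd hnorm
    refine eq_zero_of_padicNorm_le hN2 (by push_cast; exact hm) ?_ hnorm
    have : |(m : ℚ)| < p := by
      rw [← hm, abs_mul, abs_of_nonneg hN2']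
      exact lt_of_le_of_lt (mul_le_of_le_one_right hN2' hd) hNp
    exact_mod_cast this
  have f₁ : x' - x = 0 := by
    refine small (m := N * k' + N * l' - 2 * (k' * l') - (N * k + N * l - 2 * (k * l))) ?_ ?_ c₁
    · rw [e₁, e₁']
      push_cast
      rw [← hk, ← hl, ← hk', ← hl']
      ring
    · rw [abs_le, e₁, e₁']
      have p₁ := mul_nonneg ha0.le (sub_nonneg.2 hb1)
      have p₂ := mul_nonneg hb0.le (sub_nonneg.2 ha1)
      have p₃ := mul_nonneg (sub_nonneg.2 ha1) (sub_nonneg.2 hb1)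
      have p₄ := mul_nonneg ha0.le hb0.le
      have p₁' := mul_nonneg ha0'.le (sub_nonneg.2 hb1')
      have p₂' := mul_nonneg hb0'.le (sub_nonneg.2 ha1')
      have p₃' := mul_nonneg (sub_nonneg.2 ha1') (sub_nonneg.2 hb1')
      have p₄' := mul_nonneg ha0'.le hb0'.le
      constructor <;> linarith
  have f₂ : (2 * (a' + b') - (a' + b') ^ 2) - (2 * (a + b) - (a + b) ^ 2) = 0 := by
    refine small (m := 2 * (N * k' + N * l') - (k' + l') ^ 2 - (2 * (N * k + N * l) - (k + l) ^ 2))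
      ?_ ?_ ?_
    · push_cast
      rw [← hk, ← hl, ← hk', ← hl']
      ring
    · have q : ∀ s : ℚ, 2 * s - s ^ 2 = 1 - (1 - s) ^ 2 := fun s => by ring
      have r : ∀ s : ℚ, 0 ≤ s → s ≤ 2 → 0 ≤ (1 - s) ^ 2 ∧ (1 - s) ^ 2 ≤ 1 := fun s h0 h2 =>
        ⟨sq_nonneg _, by nlinarith⟩
      have r₁ := r (a + b) (by linarith) (by linarith)
      have r₂ := r (a' + b') (by linarith) (by linarith)
      rw [abs_le, q, q]
      constructor <;> linarith
    · have hxx : x' = x := sub_eq_zero.1 f₁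
      have : (2 * (a' + b') - (a' + b') ^ 2) - (2 * (a + b) - (a + b) ^ 2) =
          ((16 : ℕ) : ℚ) * (y' - y) := by
        rw [← e₂, ← e₂', hxx]
        push_cast
        ring
      rw [this, padicNorm.mul]
      exact (mul_le_of_le_one_left (padicNorm.nonneg _) (padicNorm.of_nat 16)).trans c₂
  have f₃ : (a' + b' - (a + b)) * (2 - (a + b) - (a' + b')) = 0 := by linear_combination f₂
  rw [e₁, e₁'] at f₁
  rcases mul_eq_zero.1 f₃ with h1 | h1
  · exact Or.inl ⟨by linarith, by linarith⟩
  · exact Or.inr ⟨by linarith, by linarith⟩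

theorem exists_isDworkPrime_of_sub_eq {x x' : ℚ} (hx0 : 0 < x) (hx1 : x < 1) (hx0' : 0 < x')
    (hx1' : x' < 1) {k : ℤ} (hk : (p : ℚ) * x' - x = k) : ∃ i, IsDworkPrime p x x' i := by
  have hp0 : (0 : ℚ) < p := by exact_mod_cast hp.out.pos
  have h1 : (-1 : ℚ) < k := by rw [← hk]; linarith [mul_pos hp0 hx0']
  have h2 : (k : ℚ) < p := by rw [← hk]; linarith [mul_lt_of_lt_one_right hp0 hx1']
  have h3 : -1 < k := by exact_mod_cast h1
  have h4 : k < p := by exact_mod_cast h2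
  obtain ⟨i, rfl⟩ := Int.eq_ofNat_of_zero_le (show 0 ≤ k by omega)
  refine ⟨i, ?_, by omega⟩
  push_cast at hk
  linarith

/-- The constraints that boundedness at a large prime puts on the parameters. -/
theorem exists_int_of_bounded (hp2 : p ≠ 2) (hN : N.Coprime p) (hpN : N ^ 2 < p)
    (ha : a ∈ fracSet N) (hb : b ∈ fracSet N) (hz0 : constantCoeff z = 0)
    (hz : z * (hypU a b).subst z = X)
    (hbd : ∃ K : ℚ, K ≠ 0 ∧ ∀ n : ℕ, padicNorm p (K * coeff n ((hypU a b).subst z)) ≤ 1) :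
    (∃ ε k : ℤ, (ε = 1 ∨ ε = -1) ∧ ((p : ℚ) - ε) * (a + b) = k) ∧
    (∃ ε k : ℤ, (ε = 1 ∨ ε = -1) ∧ ((p : ℚ) - ε) * (a - b) = k) ∧
    ∃ (y : ℚ) (k : ℤ), (y = a ∨ y = b ∨ y = 1 - a ∨ y = 1 - b) ∧ (p : ℚ) * y - a = k := by
  obtain ⟨a', b', i, j, h⟩ := exists_isDworkPair hN ha hb
  have ea := h.prime_a.mul_eq
  have eb := h.prime_b.mul_eq
  -- `{a', b'}` is determined by its sum and product
  have pairs : (a' = a ∧ b' = b ∨ a' = b ∧ b' = a) ∨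
      (a' = 1 - a ∧ b' = 1 - b ∨ a' = 1 - b ∧ b' = 1 - a) := by
    rcases h.sum_mul_eq_of_bounded hp2 hN hpN hz0 hz hbd with ⟨hs, hm⟩ | ⟨hs, hm⟩
    · left
      have : (a' - a) * (a' - b) = 0 := by linear_combination a' * hs - hm
      rcases mul_eq_zero.1 this with h1 | h1
      · exact Or.inl ⟨by linarith, by linarith⟩
      · exact Or.inr ⟨by linarith, by linarith⟩
    · right
      have : (a' - (1 - a)) * (a' - (1 - b)) = 0 := by linear_combination a' * hs - hm
      rcases mul_eq_zero.1 this with h1 | h1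
      · exact Or.inl ⟨by linarith, by linarith⟩
      · exact Or.inr ⟨by linarith, by linarith⟩
  rcases pairs with (⟨rfl, rfl⟩ | ⟨rfl, rfl⟩) | (⟨rfl, rfl⟩ | ⟨rfl, rfl⟩)
  · refine ⟨⟨1, i + j, Or.inl rfl, ?_⟩, ⟨1, i - j, Or.inl rfl, ?_⟩, a', i, Or.inl rfl, ?_⟩ <;>
      push_cast <;> linarith
  · refine ⟨⟨1, i + j, Or.inl rfl, ?_⟩, ⟨-1, j - i, Or.inr rfl, ?_⟩, a', i,
      Or.inr (Or.inl rfl), ?_⟩ <;> push_cast <;> linarith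
  · refine ⟨⟨-1, 2 * p - i - j, Or.inr rfl, ?_⟩, ⟨-1, j - i, Or.inr rfl, ?_⟩, 1 - a, i,
      Or.inr (Or.inr (Or.inl rfl)), ?_⟩ <;> push_cast <;> linarith
  · refine ⟨⟨-1, 2 * p - i - j, Or.inr rfl, ?_⟩, ⟨1, i - j, Or.inl rfl, ?_⟩, 1 - b, i,
      Or.inr (Or.inr (Or.inr rfl)), ?_⟩ <;> push_cast <;> linarith

/-- If multiplication by `p` modulo `24` maps `{α, β}` to `{α, β}` or `{-α, -β}`, the mirror map
with parameters `α / 24, β / 24` is integral at `p`. -/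
theorem padicNorm_coeff_hypU_div_le_one (hp24 : 24 < p) {α β : ℕ} (hα0 : 0 < α) (hα : α < 24)
    (hβ0 : 0 < β) (hβ : β < 24)
    (hu : ∀ u : ZMod 24, u * u = 1 → (u * α = α ∧ u * β = β) ∨ (u * β = α ∧ u * α = β) ∨
      (u * α = -α ∧ u * β = -β) ∨ (u * β = -α ∧ u * α = -β)) (n : ℕ) :
    padicNorm p (coeff n (hypU (α / 24) (β / 24))) ≤ 1 := by
  have hN : Nat.Coprime 24 p := (Nat.coprime_of_lt_prime (by norm_num) hp24 hp.out).symm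
  have hunit : (p : ZMod 24) * p = 1 := by
    obtain ⟨v, hv⟩ := ((ZMod.isUnit_iff_coprime p 24).2 hN.symm).exists_right_inv
    have key : ∀ u v : ZMod 24, u * v = 1 → u * u = 1 := by decide
    exact key _ _ hv
  have mem : ∀ γ : ℕ, 0 < γ → γ < 24 →
      ((γ : ℚ) / 24 ∈ fracSet 24) ∧ (0 : ℚ) < γ / 24 ∧ (γ : ℚ) / 24 < 1 := by
    intro γ h0 h1
    have h0' : (0 : ℚ) < γ := by exact_mod_cast h0
    have h1' : (γ : ℚ) < 24 := by exact_mod_cast h1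
    have h2 : (γ : ℚ) / 24 < 1 := by rw [div_lt_one (by norm_num)]; exact h1'
    exact ⟨⟨by positivity, h2.le, γ, by push_cast; ring⟩, by positivity, h2⟩
  obtain ⟨ma, a0, a1⟩ := mem α hα0 hα
  obtain ⟨mb, b0, b1⟩ := mem β hβ0 hβ
  have refl : ∀ {x : ℚ}, x ∈ fracSet 24 → x < 1 → 1 - x ∈ fracSet 24 := by
    rintro x ⟨h0, -, k, hk⟩ h1
    have hk' : (k : ℚ) ≤ 24 := by rw [← hk]; push_cast; linarith
    refine ⟨by linarith, by linarith, 24 - k, ?_⟩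
    rw [Nat.cast_sub (by exact_mod_cast hk'), ← hk]
    push_cast
    ring
  have pos : ∀ γ δ : ℕ, (p : ZMod 24) * γ = δ → ∃ k : ℤ, (p : ℚ) * (γ / 24) - δ / 24 = k := by
    intro γ δ h
    obtain ⟨k, hk⟩ := (ZMod.intCast_zmod_eq_zero_iff_dvd ((p : ℤ) * γ - δ) 24).1
      (by push_cast; rw [h, sub_self])
    refine ⟨k, ?_⟩
    have : (p : ℚ) * γ - δ = 24 * k := by exact_mod_cast hk
    linear_combination this / 24
  have neg : ∀ γ δ : ℕ, (p : ZMod 24) * γ = -δ →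
      ∃ k : ℤ, (p : ℚ) * (1 - γ / 24) - δ / 24 = k := by
    intro γ δ h
    obtain ⟨k, hk⟩ := (ZMod.intCast_zmod_eq_zero_iff_dvd ((p : ℤ) * γ + δ) 24).1
      (by push_cast; rw [h, neg_add_cancel])
    refine ⟨p - k, ?_⟩
    have : (p : ℚ) * γ + δ = 24 * k := by exact_mod_cast hk
    push_cast
    linear_combination -this / 24
  have a1' : (0 : ℚ) < 1 - α / 24 := by linarith
  have b1' : (0 : ℚ) < 1 - β / 24 := by linarith
  have a0' : 1 - (α : ℚ) / 24 < 1 := by linarith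
  have b0' : 1 - (β : ℚ) / 24 < 1 := by linarith
  have hp2 : p ≠ 2 := by omega
  rcases hu _ hunit with ⟨h₁, h₂⟩ | ⟨h₁, h₂⟩ | ⟨h₁, h₂⟩ | ⟨h₁, h₂⟩
  · obtain ⟨k, hk⟩ := pos _ _ h₁
    obtain ⟨l, hl⟩ := pos _ _ h₂
    obtain ⟨i, hi⟩ := exists_isDworkPrime_of_sub_eq a0 a1 a0 a1 hk
    obtain ⟨j, hj⟩ := exists_isDworkPrime_of_sub_eq b0 b1 b0 b1 hl
    exact IsDworkPair.padicNorm_coeff_hypU_le_one hp2 hN ⟨ma, mb, ma, mb, hi, hj⟩ rfl n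
  · obtain ⟨k, hk⟩ := pos _ _ h₁
    obtain ⟨l, hl⟩ := pos _ _ h₂
    obtain ⟨i, hi⟩ := exists_isDworkPrime_of_sub_eq a0 a1 b0 b1 hk
    obtain ⟨j, hj⟩ := exists_isDworkPrime_of_sub_eq b0 b1 a0 a1 hl
    exact IsDworkPair.padicNorm_coeff_hypU_le_one hp2 hN ⟨ma, mb, mb, ma, hi, hj⟩
      (hypU_comm _ _) n
  · obtain ⟨k, hk⟩ := neg _ _ h₁
    obtain ⟨l, hl⟩ := neg _ _ h₂
    obtain ⟨i, hi⟩ := exists_isDworkPrime_of_sub_eq a0 a1 a1' a0' hk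
    obtain ⟨j, hj⟩ := exists_isDworkPrime_of_sub_eq b0 b1 b1' b0' hl
    exact IsDworkPair.padicNorm_coeff_hypU_le_one hp2 hN
      ⟨ma, mb, refl ma a1, refl mb b1, hi, hj⟩ (hypU_reflect a0 a1 b0 b1) n
  · obtain ⟨k, hk⟩ := neg _ _ h₁
    obtain ⟨l, hl⟩ := neg _ _ h₂
    obtain ⟨i, hi⟩ := exists_isDworkPrime_of_sub_eq a0 a1 b1' b0' hk
    obtain ⟨j, hj⟩ := exists_isDworkPrime_of_sub_eq b0 b1 a1' a0' hl
    exact IsDworkPair.padicNorm_coeff_hypU_le_one hp2 hN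
      ⟨ma, mb, refl mb b1, refl ma a1, hi, hj⟩
      ((hypU_comm _ _).trans (hypU_reflect a0 a1 b0 b1)) n

end Parameters

/-! ### The Hauptmodul -/

/-- Up to a unit at `p`, the coefficients of the Hauptmodul are those of `q / z(q)`. -/
theorem isPIntegral_hauptmodul_iff {p : ℕ} [hp : Fact p.Prime] {t₁ t₂ t₃ w : ℚ⟦X⟧} {r : ℚ}
    (hr : padicNorm p r = 1) (hne : t₁ ≠ t₃)
    (e : (t₃ - t₂) * (C r * X) = rescale r w * (t₃ - t₁)) :
    IsPIntegral p (hauptmodul t₁ t₂ t₃) ↔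
      ∃ K : ℚ, K ≠ 0 ∧ ∀ n : ℕ, padicNorm p (K * coeff n w) ≤ 1 := by
  set J := hauptmodul t₁ t₂ t₃ with hJ
  have hd : ((t₃ - t₁ : ℚ⟦X⟧) : LaurentSeries ℚ) ≠ 0 := by
    rw [Ne, map_eq_zero_iff _ HahnSeries.ofPowerSeries_injective]
    exact sub_ne_zero.2 hne.symm
  have h1 : J * ((C r * X : ℚ⟦X⟧) : LaurentSeries ℚ) =
      ((rescale r w : ℚ⟦X⟧) : LaurentSeries ℚ) := by
    have h2 : J * ((t₃ - t₁ : ℚ⟦X⟧) : LaurentSeries ℚ) = ((t₃ - t₂ : ℚ⟦X⟧) : LaurentSeries ℚ) :=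
      div_mul_cancel₀ _ hd
    have h3 := congrArg (fun f : ℚ⟦X⟧ => (f : LaurentSeries ℚ)) e
    simp only [PowerSeries.coe_mul] at h3
    apply mul_right_cancel₀ hd
    rw [← h3, ← h2, PowerSeries.coe_mul]
    ring
  have h2 : ∀ m : ℤ, J.coeff m * r = ((rescale r w : ℚ⟦X⟧) : LaurentSeries ℚ).coeff (m + 1) := by
    intro m
    rw [← h1, PowerSeries.coe_mul, PowerSeries.coe_C, PowerSeries.coe_X, ← mul_assoc,
      HahnSeries.coeff_mul_single_add, mul_one, mul_comm J, HahnSeries.C_mul_eq_smul,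
      HahnSeries.coeff_smul, smul_eq_mul, mul_comm]
  have hpos : ∀ n : ℕ, padicNorm p (J.coeff ((n : ℤ) - 1)) = padicNorm p (coeff n w) := by
    intro n
    have h3 := congrArg (padicNorm p) (h2 ((n : ℤ) - 1))
    have h4 : padicNorm p (r ^ n) = 1 := by rw [padicNorm_pow, hr, one_pow]
    rw [sub_add_cancel, PowerSeries.coeff_coe, if_neg (by omega), Int.natAbs_natCast,
      coeff_rescale, padicNorm.mul, padicNorm.mul, hr, h4, mul_one, one_mul] at h3
    exact h3
  have hneg : ∀ m : ℤ, m + 1 < 0 → padicNorm p (J.coeff m) = 0 := by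
    intro m hm
    have h3 := congrArg (padicNorm p) (h2 m)
    rwa [PowerSeries.coeff_coe, if_pos hm, padicNorm.mul, hr, mul_one, padicNorm.zero] at h3
  constructor
  · rintro ⟨K, hK, h⟩
    refine ⟨K, hK, fun n => ?_⟩
    have := h ((n : ℤ) - 1)
    rwa [padicNorm.mul, hpos, ← padicNorm.mul] at this
  · rintro ⟨K, hK, h⟩
    refine ⟨K, hK, fun m => ?_⟩
    rcases lt_or_ge (m + 1) 0 with hm | hm
    · rw [padicNorm.mul, hneg m hm, mul_zero]
      exact zero_le_one
    · obtain ⟨n, hn⟩ := Int.eq_ofNat_of_zero_le hm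
      obtain rfl : m = (n : ℤ) - 1 := by omega
      rw [padicNorm.mul, hpos, ← padicNorm.mul]
      exact h n

/-- A nonzero rational is a unit at all large primes. -/
theorem exists_padicNorm_eq_one {r : ℚ} (hr : r ≠ 0) :
    ∃ B : ℕ, ∀ p : ℕ, p.Prime → B < p → padicNorm p r = 1 := by
  refine ⟨max r.num.natAbs r.den, fun p hp hB => ?_⟩
  have : Fact p.Prime := ⟨hp⟩
  have h1 := padicNorm_natCast_eq_one_of_coprime (p := p) (N := r.den)
    (Nat.coprime_of_lt_prime r.den_pos.ne' (by omega) hp).symm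
  have h2 := padicNorm_natCast_eq_one_of_coprime (p := p) (N := r.num.natAbs)
    (Nat.coprime_of_lt_prime (by simpa using hr) (by omega) hp).symm
  have h3 : padicNorm p (r.num : ℚ) = 1 := by
    rcases Int.natAbs_eq r.num with h | h
    · rw [h, Int.cast_natCast, h2]
    · rw [h, Int.cast_neg, Int.cast_natCast, padicNorm.neg, h2]
  rw [← Rat.num_div_den r, padicNorm.div, h1, h3, div_one]

/-! ### Triangle groups of type `(m₁, m₂, ∞)` -/

theorem recip_top : recip ⊤ = 0 := if_pos rfl

theorem recip_natCast (k : ℕ) : recip k = 1 / k := by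
  rw [recip, if_neg (ENat.natCast_ne_top k), ENat.toNat_natCast]

theorem recip_ofNat (k : ℕ) [k.AtLeastTwo] : recip ofNat(k) = 1 / ofNat(k) := recip_natCast k

theorem recip_nonneg (m : ℕ∞) : 0 ≤ recip m := by
  induction m using ENat.recTopCoe with
  | top => rw [recip_top]
  | coe k => rw [recip_natCast]; positivity

theorem recip_lt {m₁ m₂ : ℕ∞} (h : 2 ≤ m₁) (hlt : m₁ < m₂) : recip m₂ < recip m₁ := by
  obtain ⟨k, rfl⟩ := ENat.ne_top_iff_exists.1 hlt.ne_top
  have hk : 2 ≤ k := by exact_mod_cast h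
  have hk' : (0 : ℚ) < k := by exact_mod_cast (by omega : 0 < k)
  rw [recip_natCast]
  induction m₂ using ENat.recTopCoe with
  | top => rw [recip_top]; positivity
  | coe l =>
    rw [recip_natCast]
    exact one_div_lt_one_div_of_lt hk' (by exact_mod_cast hlt)

theorem recip_le_half {m : ℕ∞} (h : 2 ≤ m) : recip m ≤ 1 / 2 := by
  rcases h.eq_or_lt with rfl | hlt
  · rw [recip_ofNat]
  · have := recip_lt le_rfl hlt
    rw [recip_ofNat] at this
    exact this.le

theorem exists_mul_recip (m : ℕ∞) : ∃ D : ℕ, 0 < D ∧ ∃ j : ℤ, D * recip m = j := by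
  induction m using ENat.recTopCoe with
  | top => exact ⟨1, one_pos, 0, by simp [recip_top]⟩
  | coe k =>
    rcases Nat.eq_zero_or_pos k with rfl | hk
    · exact ⟨1, one_pos, 0, by rw [recip_natCast]; simp⟩
    · have : (k : ℚ) ≠ 0 := by exact_mod_cast hk.ne'
      exact ⟨k, hk, 1, by rw [recip_natCast]; field_simp; norm_num⟩

section Types

variable {m₁ m₂ : ℕ∞}

theorem parC_eq (m₁ m₂ : ℕ∞) : parC m₁ m₂ = 1 - parA m₁ m₂ := by
  unfold parC parA; ring

theorem IsHyperbolicType.parA_mem (hm : IsHyperbolicType m₁ m₂) :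
    0 < parA m₁ m₂ ∧ parA m₁ m₂ < 1 := by
  have h₁ := recip_le_half hm.1
  have h₂ := recip_le_half (hm.1.trans hm.2.1)
  have h₃ := recip_nonneg m₁
  have h₄ := recip_nonneg m₂
  have h₅ := hm.2.2
  unfold parA
  constructor <;> linarith

theorem IsHyperbolicType.parB_mem (hm : IsHyperbolicType m₁ m₂) :
    0 < parB m₁ m₂ ∧ parB m₁ m₂ < 1 := by
  have h₃ := recip_nonneg m₁
  have h₄ := recip_nonneg m₂
  have h₅ := hm.2.2
  unfold parB
  constructor <;> linarith

theorem IsHyperbolicType.exists_mem_fracSet (hm : IsHyperbolicType m₁ m₂) :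
    ∃ N : ℕ, 0 < N ∧ parA m₁ m₂ ∈ fracSet N ∧ parB m₁ m₂ ∈ fracSet N := by
  obtain ⟨D, hD, j, hj⟩ := exists_mul_recip m₁
  obtain ⟨D', hD', j', hj'⟩ := exists_mul_recip m₂
  have nat : ∀ {x : ℚ} {k : ℤ}, 0 < x → ((2 * D * D' : ℕ) : ℚ) * x = k →
      ∃ l : ℕ, ((2 * D * D' : ℕ) : ℚ) * x = l := by
    intro x k hx hk
    have h0 : (0 : ℚ) ≤ k := by rw [← hk]; positivity
    obtain ⟨l, rfl⟩ := Int.eq_ofNat_of_zero_le (show 0 ≤ k by exact_mod_cast h0)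
    exact ⟨l, by rw [hk, Int.cast_natCast]⟩
  obtain ⟨a0, a1⟩ := hm.parA_mem
  obtain ⟨b0, b1⟩ := hm.parB_mem
  refine ⟨2 * D * D', by positivity, ⟨a0, a1.le, nat (k := D * D' - j * D' + D * j') a0 ?_⟩,
    b0, b1.le, nat (k := D * D' - j * D' - D * j') b0 ?_⟩
  · unfold parA
    push_cast
    rw [← hj, ← hj']
    ring
  · unfold parB
    push_cast
    rw [← hj, ← hj']
    ring

theorem linCoeff_ne_zero (h : m₁ < m₂) : linCoeff m₁ m₂ ≠ 0 := by
  obtain ⟨k, rfl⟩ := ENat.ne_top_iff_exists.1 h.ne_top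
  have hk : (0 : ℚ) ≤ k := Nat.cast_nonneg k
  induction m₂ using ENat.recTopCoe with
  | top =>
    rw [linCoeff, if_pos rfl, ENat.toNat_natCast]
    exact (by linarith : -((k : ℚ) + 1) < 0).ne
  | coe l =>
    have hkl : (k : ℚ) < l := by exact_mod_cast h
    rw [linCoeff, if_neg (ENat.natCast_ne_top l), ENat.toNat_natCast, ENat.toNat_natCast,
      show (k : ℚ) ^ 2 * l + (k : ℚ) ^ 2 - k * (l : ℚ) ^ 2 - (l : ℚ) ^ 2 =
        (k - l) * (k * l + k + l) by ring]
    have h2 : (0 : ℚ) < k * l + k + l := by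
      have := mul_nonneg hk (hk.trans hkl.le)
      linarith
    exact mul_ne_zero (sub_ne_zero.2 hkl.ne) h2.ne'

theorem IsHyperbolicType.exists_isHalphenSolution (hm : IsHyperbolicType m₁ m₂) :
    ∃ t₁ t₂ t₃, IsHalphenSolution m₁ m₂ t₁ t₂ t₃ := by
  obtain ⟨a0, a1⟩ := hm.parA_mem
  obtain ⟨b0, b1⟩ := hm.parB_mem
  obtain ⟨z, hz0, hz⟩ := exists_mirror_inverse (parA m₁ m₂) (parB m₁ m₂)
  -- the scale that gives the prescribed coefficient of `t₂`
  obtain ⟨r, hr0, hr⟩ : ∃ r : ℚ, r ≠ 0 ∧ (m₁ < m₂ →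
      (1 - parB m₁ m₂) * (1 - 2 * parA m₁ m₂) * -r = linCoeff m₁ m₂) := by
    by_cases h : m₁ < m₂
    · have h1 : (1 - parB m₁ m₂) * (1 - 2 * parA m₁ m₂) ≠ 0 := by
        refine mul_ne_zero (by linarith) ?_
        have := recip_lt hm.1 h
        have h2 : 1 - 2 * parA m₁ m₂ = recip m₁ - recip m₂ := by unfold parA; ring
        rw [h2]
        linarith
      refine ⟨-(linCoeff m₁ m₂ / ((1 - parB m₁ m₂) * (1 - 2 * parA m₁ m₂))),
        neg_ne_zero.2 (div_ne_zero (linCoeff_ne_zero h) h1), fun _ => ?_⟩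
      rw [neg_neg, mul_div_cancel₀ _ h1]
    · exact ⟨1, one_ne_zero, fun h' => absurd h' h⟩
  obtain ⟨t₁, t₂, t₃, h, c₁, c₂, c₃, e₁, -⟩ := exists_halphen_scaled a0 b0 b1 hz0 hz r
  refine ⟨t₁, t₂, t₃, ⟨by rw [parC_eq]; exact h, c₁, c₂, c₃, fun hlt => ?_, ?_⟩⟩
  · rw [h.coeff_one c₁ c₂ c₃, e₁, hr hlt]
  · rintro rfl
    rw [sub_self, map_zero] at e₁
    exact hr0 (by linarith)

/-- The Hauptmodul of a solution is `1 / z(r q)` for some `r ≠ 0`, where `z` inverts the mirror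
map. -/
theorem IsHalphenSolution.exists_scale (hm : IsHyperbolicType m₁ m₂) {t₁ t₂ t₃ z : ℚ⟦X⟧}
    (ht : IsHalphenSolution m₁ m₂ t₁ t₂ t₃) (hz0 : constantCoeff z = 0)
    (hz : z * (hypU (parA m₁ m₂) (parB m₁ m₂)).subst z = X) :
    ∃ r : ℚ, r ≠ 0 ∧ (t₃ - t₂) * (C r * X) =
      rescale r ((hypU (parA m₁ m₂) (parB m₁ m₂)).subst z) * (t₃ - t₁) := by
  obtain ⟨a0, a1⟩ := hm.parA_mem
  obtain ⟨b0, b1⟩ := hm.parB_mem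
  have hs := ht.system
  rw [parC_eq] at hs
  refine ⟨-coeff 1 (t₁ - t₃), fun h0 => ht.nonconst ?_, ?_⟩
  · obtain ⟨rfl, -, rfl⟩ := hs.unique halphenSystem_const ht.t₁_zero ht.t₂_zero ht.t₃_zero
      (map_zero _) (by simp) (map_zero _) (by rw [sub_self, map_zero]; linarith)
    rfl
  · obtain ⟨s₁, s₂, s₃, h, c₁, c₂, c₃, e₁, e₂⟩ :=
      exists_halphen_scaled a0 b0 b1 hz0 hz (-coeff 1 (t₁ - t₃))
    obtain ⟨rfl, rfl, rfl⟩ := hs.unique h ht.t₁_zero ht.t₂_zero ht.t₃_zero c₁ c₂ c₃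
      (by rw [e₁, neg_neg])
    exact e₂

theorem IsHalphenSolution.isAlmostIntegral_iff (hm : IsHyperbolicType m₁ m₂) {t₁ t₂ t₃ z : ℚ⟦X⟧}
    (ht : IsHalphenSolution m₁ m₂ t₁ t₂ t₃) (hz0 : constantCoeff z = 0)
    (hz : z * (hypU (parA m₁ m₂) (parB m₁ m₂)).subst z = X) :
    IsAlmostIntegral (hauptmodul t₁ t₂ t₃) ↔ ∃ B : ℕ, ∀ p : ℕ, p.Prime → B < p →
      ∃ K : ℚ, K ≠ 0 ∧
        ∀ n : ℕ, padicNorm p (K * coeff n ((hypU (parA m₁ m₂) (parB m₁ m₂)).subst z)) ≤ 1 := by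
  obtain ⟨r, hr, e⟩ := ht.exists_scale hm hz0 hz
  obtain ⟨B, hB⟩ := exists_padicNorm_eq_one hr
  constructor
  · intro h
    obtain ⟨B', hB'⟩ := Set.Finite.bddAbove h
    refine ⟨max B B', fun p hp hlt => ?_⟩
    have : Fact p.Prime := ⟨hp⟩
    rw [← isPIntegral_hauptmodul_iff (hB p hp (by omega)) ht.nonconst e]
    by_contra hcon
    have : p ≤ B' := hB' ⟨hp, hcon⟩
    omega
  · rintro ⟨B', h⟩
    refine (Set.finite_Iic (max B B')).subset ?_
    rintro p ⟨hp, hcon⟩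
    by_contra hlt
    have hlt' : max B B' < p := not_le.1 hlt
    have : Fact p.Prime := ⟨hp⟩
    exact hcon ((isPIntegral_hauptmodul_iff (hB p hp (by omega)) ht.nonconst e).2
      (h p hp (by omega)))

end Types

/-! ### Residues of large primes -/

theorem exists_prime_dvd_sub {D u : ℕ} (hD : D ≠ 0) (hu : u.Coprime D) (B : ℕ) :
    ∃ p : ℕ, p.Prime ∧ B < p ∧ (D : ℤ) ∣ p - u := by
  have : NeZero D := ⟨hD⟩
  obtain ⟨p, hlt, hp, h⟩ :=
    Nat.forall_exists_prime_gt_and_eq_mod ((ZMod.isUnit_iff_coprime u D).2 hu) B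
  refine ⟨p, hp, hlt, (ZMod.intCast_zmod_eq_zero_iff_dvd _ D).1 ?_⟩
  push_cast
  rw [h, sub_self]

/-- The unit group modulo `k` is contained in `{1, -1}` only for `k = 2, 3, 4, 6`. -/
theorem exists_coprime_not_dvd {k : ℕ} (hk : 2 ≤ k) (h : ¬ (k = 2 ∨ k = 3 ∨ k = 4 ∨ k = 6)) :
    ∃ u : ℕ, u.Coprime k ∧ ¬ (k : ℤ) ∣ u - 1 ∧ ¬ (k : ℤ) ∣ u + 1 := by
  have small : ∀ u : ℕ, 1 < u → u + 1 < k → ¬ (k : ℤ) ∣ u - 1 ∧ ¬ (k : ℤ) ∣ u + 1 := by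
    intro u h1 h2
    constructor
    · intro hd
      have := Int.le_of_dvd (by omega) hd
      omega
    · intro hd
      have := Int.le_of_dvd (by omega) hd
      omega
  rcases Nat.even_or_odd' k with ⟨l, rfl | rfl⟩
  · rcases Nat.even_or_odd' l with ⟨n, rfl | rfl⟩
    · refine ⟨2 * n + 1, ?_, small _ (by omega) (by omega)⟩
      have h2 : Nat.Coprime (2 * n + 1) 2 := by simp
      have hn : Nat.Coprime (2 * n + 1) n := by simp
      exact h2.mul_right (h2.mul_right hn)
    · refine ⟨2 * n + 1 + 2, ?_, small _ (by omega) (by omega)⟩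
      have h2 : Nat.Coprime (2 * n + 1 + 2) 2 :=
        Nat.coprime_two_right.2 ⟨n + 1, by ring⟩
      have hn : Nat.Coprime (2 * n + 1 + 2) (2 * n + 1) := by
        rw [Nat.coprime_self_add_left]
        simp
      exact h2.mul_right hn
  · exact ⟨2, by simp, small 2 (by omega) (by omega)⟩

theorem eq_of_forall_prime_dvd {k B : ℕ} (hk : 2 ≤ k)
    (h : ∀ p : ℕ, p.Prime → B < p → ∃ ε : ℤ, (ε = 1 ∨ ε = -1) ∧ (k : ℤ) ∣ p - ε) :
    k = 2 ∨ k = 3 ∨ k = 4 ∨ k = 6 := by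
  by_contra hcon
  obtain ⟨u, hu, h1, h2⟩ := exists_coprime_not_dvd hk hcon
  obtain ⟨p, hp, hlt, hd⟩ := exists_prime_dvd_sub (by omega) hu B
  obtain ⟨ε, rfl | rfl, hε⟩ := h p hp hlt
  · exact h1 (by have := dvd_sub hε hd; rwa [sub_sub_sub_cancel_left] at this)
  · exact h2 (by have := dvd_sub hε hd; rwa [sub_sub_sub_cancel_left, sub_neg_eq_add] at this)

/-- If, for all large primes `p`, multiplication by `p` maps one of `±α / 24, ±β / 24` to `α / 24`
modulo `1`, then the same holds for multiplication by any unit `u` modulo `24`. -/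
theorem dvd_of_forall_prime {α β u B : ℕ} (hu : u.Coprime 24)
    (h : ∀ p : ℕ, p.Prime → B < p → ∃ (y : ℚ) (k : ℤ), (y = α / 24 ∨ y = β / 24 ∨
      y = 1 - α / 24 ∨ y = 1 - β / 24) ∧ (p : ℚ) * y - α / 24 = k) :
    (24 : ℤ) ∣ u * α - α ∨ (24 : ℤ) ∣ u * β - α ∨ (24 : ℤ) ∣ u * α + α ∨
      (24 : ℤ) ∣ u * β + α := by
  obtain ⟨p, hp, hlt, q, hq⟩ := exists_prime_dvd_sub (by norm_num) hu B
  have pos : ∀ {γ : ℕ} {k : ℤ}, (p : ℚ) * (γ / 24) - α / 24 = k → (24 : ℤ) ∣ u * γ - α := by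
    intro γ k hk
    have : (p : ℤ) * γ - α = 24 * k := by
      have : (p : ℚ) * γ - α = 24 * k := by linear_combination 24 * hk
      exact_mod_cast this
    exact ⟨k - q * γ, by push_cast at hq; linear_combination this - γ * hq⟩
  have neg : ∀ {γ : ℕ} {k : ℤ}, (p : ℚ) * (1 - γ / 24) - α / 24 = k →
      (24 : ℤ) ∣ u * γ + α := by
    intro γ k hk
    have : (p : ℤ) * (24 - γ) - α = 24 * k := by
      have : (p : ℚ) * (24 - γ) - α = 24 * k := by linear_combination 24 * hk
      exact_mod_cast this
    exact ⟨p - k - q * γ, by push_cast at hq; linear_combination -this - γ * hq⟩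
  obtain ⟨y, k, rfl | rfl | rfl | rfl, hk⟩ := h p hp hlt
  · exact Or.inl (pos hk)
  · exact Or.inr (Or.inl (pos hk))
  · exact Or.inr (Or.inr (Or.inl (neg hk)))
  · exact Or.inr (Or.inr (Or.inr (neg hk)))

/-! ### Classification -/

section Classification

variable {m₁ m₂ : ℕ∞} {z : ℚ⟦X⟧}

/-- The types with almost integral Hauptmodul. -/
def arithmeticTypes : Set (ℕ∞ × ℕ∞) :=
  {(2, 3), (2, 4), (2, 6), (2, ⊤), (3, 3), (3, ⊤), (4, 4), (6, 6), (⊤, ⊤)}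

/-- If all large primes are `±1` modulo `m`, then `m` is one of the orders of crystallographic
rotations, or infinite. -/
theorem recip_cases {m : ℕ∞} {B : ℕ} (hm : 2 ≤ m)
    (h : ∀ p : ℕ, p.Prime → B < p → ∃ ε k : ℤ, (ε = 1 ∨ ε = -1) ∧ ((p : ℚ) - ε) * recip m = k) :
    m = 2 ∨ m = 3 ∨ m = 4 ∨ m = 6 ∨ m = ⊤ := by
  induction m using ENat.recTopCoe with
  | top => simp
  | coe n =>
    have hn : 2 ≤ n := by exact_mod_cast hm
    have hn0 : (n : ℚ) ≠ 0 := by exact_mod_cast (by omega : n ≠ 0)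
    have := eq_of_forall_prime_dvd (B := B) hn fun p hp hlt => by
      obtain ⟨ε, k, hε, hk⟩ := h p hp hlt
      refine ⟨ε, hε, k, ?_⟩
      rw [recip_natCast, mul_one_div, div_eq_iff hn0] at hk
      have : (p : ℤ) - ε = k * n := by exact_mod_cast hk
      rw [this, mul_comm]
    rcases this with rfl | rfl | rfl | rfl <;> simp

theorem mem_arithmeticTypes (hm : IsHyperbolicType m₁ m₂) (hz0 : constantCoeff z = 0)
    (hz : z * (hypU (parA m₁ m₂) (parB m₁ m₂)).subst z = X)
    (h : ∃ B : ℕ, ∀ p : ℕ, p.Prime → B < p → ∃ K : ℚ, K ≠ 0 ∧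
      ∀ n : ℕ, padicNorm p (K * coeff n ((hypU (parA m₁ m₂) (parB m₁ m₂)).subst z)) ≤ 1) :
    (m₁, m₂) ∈ arithmeticTypes := by
  obtain ⟨B, h⟩ := h
  obtain ⟨N, hN0, ha, hb⟩ := hm.exists_mem_fracSet
  have key := fun (p : ℕ) (hp : p.Prime) (hlt : max B (max 2 (N ^ 2)) < p) =>
    haveI : Fact p.Prime := ⟨hp⟩
    exists_int_of_bounded (by omega)
      (Nat.coprime_of_lt_prime hN0.ne' (by nlinarith [max_lt_iff.1 (max_lt_iff.1 hlt).2]) hp).symm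
      (by omega) ha hb hz0 hz (h p hp (by omega))
  have c₁ := recip_cases hm.1 fun p hp hlt => by
    obtain ⟨⟨ε, k, hε, hk⟩, -⟩ := key p hp hlt
    refine ⟨ε, p - ε - k, hε, ?_⟩
    push_cast
    rw [← hk]
    unfold parA parB
    ring
  have c₂ := recip_cases (hm.1.trans hm.2.1) fun p hp hlt => by
    obtain ⟨-, ⟨ε, k, hε, hk⟩, -⟩ := key p hp hlt
    refine ⟨ε, k, hε, ?_⟩
    rw [← hk]
    unfold parA parB
    ring
  have excl : ∀ α β u : ℕ, u.Coprime 24 → parA m₁ m₂ = α / 24 → parB m₁ m₂ = β / 24 →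
      (24 : ℤ) ∣ u * α - α ∨ (24 : ℤ) ∣ u * β - α ∨ (24 : ℤ) ∣ u * α + α ∨
        (24 : ℤ) ∣ u * β + α := fun α β u hu e₁ e₂ => dvd_of_forall_prime hu fun p hp hlt => by
    rw [← e₁, ← e₂]
    exact (key p hp hlt).2.2
  have hle := hm.2.1
  have hlt := hm.2.2
  clear key ha hb hz h hN0
  rcases c₁ with rfl | rfl | rfl | rfl | rfl <;> rcases c₂ with rfl | rfl | rfl | rfl | rfl
  -- the types listed, those that violate `m₁ ≤ m₂`, and the Euclidean type `(2, 2, ∞)`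
  all_goals try first
    | (simp [arithmeticTypes]; done)
    | (exfalso; revert hle; simp; done)
    | (exfalso; revert hle; norm_cast; done)
    | (exfalso; norm_num [recip_ofNat] at hlt; done)
  -- the five remaining types, each with a unit modulo `24` that moves `a` out of
  -- `{a, b, 1 - a, 1 - b}`
  · have := excl 11 5 5 (by norm_num) (by norm_num [parA, recip_ofNat])
      (by norm_num [parB, recip_ofNat])
    omega
  · have := excl 10 6 5 (by norm_num) (by norm_num [parA, recip_ofNat])
      (by norm_num [parB, recip_ofNat])
    omega
  · have := excl 11 7 7 (by norm_num) (by norm_num [parA, recip_ofNat])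
      (by norm_num [parB, recip_ofNat])
    omega
  · have := excl 9 9 11 (by norm_num) (by norm_num [parA, recip_ofNat, recip_top])
      (by norm_num [parB, recip_ofNat, recip_top])
    omega
  · have := excl 10 10 5 (by norm_num) (by norm_num [parA, recip_ofNat, recip_top])
      (by norm_num [parB, recip_ofNat, recip_top])
    omega

theorem padicNorm_hypU_of_mem (hm : (m₁, m₂) ∈ arithmeticTypes) {p : ℕ} [hp : Fact p.Prime]
    (hp24 : 24 < p) (n : ℕ) :
    padicNorm p (coeff n (hypU (parA m₁ m₂) (parB m₁ m₂))) ≤ 1 := by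
  have key : ∃ α β : ℕ, parA m₁ m₂ = α / 24 ∧ parB m₁ m₂ = β / 24 ∧ 0 < α ∧ α < 24 ∧ 0 < β ∧
      β < 24 ∧ ∀ u : ZMod 24, u * u = 1 → (u * α = α ∧ u * β = β) ∨ (u * β = α ∧ u * α = β) ∨
        (u * α = -α ∧ u * β = -β) ∨ (u * β = -α ∧ u * α = -β) := by
    simp only [arithmeticTypes, Set.mem_insert_iff, Set.mem_singleton_iff, Prod.mk.injEq] at hm
    rcases hm with ⟨rfl, rfl⟩ | ⟨rfl, rfl⟩ | ⟨rfl, rfl⟩ | ⟨rfl, rfl⟩ | ⟨rfl, rfl⟩ | ⟨rfl, rfl⟩ |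
      ⟨rfl, rfl⟩ | ⟨rfl, rfl⟩ | ⟨rfl, rfl⟩
    · refine ⟨10, 2, ?_, ?_, by decide⟩ <;> norm_num [parA, parB, recip_ofNat]
    · refine ⟨9, 3, ?_, ?_, by decide⟩ <;> norm_num [parA, parB, recip_ofNat]
    · refine ⟨8, 4, ?_, ?_, by decide⟩ <;> norm_num [parA, parB, recip_ofNat]
    · refine ⟨6, 6, ?_, ?_, by decide⟩ <;> norm_num [parA, parB, recip_ofNat, recip_top]
    · refine ⟨12, 4, ?_, ?_, by decide⟩ <;> norm_num [parA, parB, recip_ofNat]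
    · refine ⟨8, 8, ?_, ?_, by decide⟩ <;> norm_num [parA, parB, recip_ofNat, recip_top]
    · refine ⟨12, 6, ?_, ?_, by decide⟩ <;> norm_num [parA, parB, recip_ofNat]
    · refine ⟨12, 8, ?_, ?_, by decide⟩ <;> norm_num [parA, parB, recip_ofNat]
    · refine ⟨12, 12, ?_, ?_, by decide⟩ <;> norm_num [parA, parB, recip_top]
  obtain ⟨α, β, ha, hb, hα0, hα, hβ0, hβ, hu⟩ := key
  rw [ha, hb]
  exact padicNorm_coeff_hypU_div_le_one hp24 hα0 hα hβ0 hβ hu n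

end Classification

end TriangleHauptmodul

theorem corollary1 (m₁ m₂ : ℕ∞) (hm : TriangleHauptmodul.IsHyperbolicType m₁ m₂) :
    (∃ t₁ t₂ t₃ : PowerSeries ℚ, TriangleHauptmodul.IsHalphenSolution m₁ m₂ t₁ t₂ t₃) ∧
    ∀ t₁ t₂ t₃ : PowerSeries ℚ, TriangleHauptmodul.IsHalphenSolution m₁ m₂ t₁ t₂ t₃ →
      (TriangleHauptmodul.IsAlmostIntegral (TriangleHauptmodul.hauptmodul t₁ t₂ t₃) ↔
        (m₁, m₂) ∈ ({(2, 3), (2, 4), (2, 6), (2, ⊤), (3, 3), (3, ⊤), (4, 4), (6, 6),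
          (⊤, ⊤)} : Set (ℕ∞ × ℕ∞))) := by
  refine ⟨hm.exists_isHalphenSolution, fun t₁ t₂ t₃ ht => ?_⟩
  obtain ⟨z, hz0, hz⟩ := TriangleHauptmodul.exists_mirror_inverse
    (TriangleHauptmodul.parA m₁ m₂) (TriangleHauptmodul.parB m₁ m₂)
  rw [ht.isAlmostIntegral_iff hm hz0 hz]
  refine ⟨TriangleHauptmodul.mem_arithmeticTypes hm hz0 hz, fun h => ⟨24, fun p hp hlt => ?_⟩⟩
  have : Fact p.Prime := ⟨hp⟩
  refine ⟨1, one_ne_zero, fun n => ?_⟩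
  rw [one_mul]
  exact TriangleHauptmodul.padicNorm_coeff_subst_le_one hz0 hz
    (TriangleHauptmodul.padicNorm_hypU_of_mem h hlt) n
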